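/- Let $G$ be a finite group, $p$ a prime, and $\Gamma$ a Mackey functor for $G$, i.e. a functor, taking finite coproducts to coproducts, from $\omega(G)$ to abelian groups, where $\omega(G)$ has the finite $G$-sets as objects, isomorphism classes of spans $S\leftarrow V\to T$ of finite $G$-sets as morphisms, and composition by fiber product. A $G$-space is a simplicial $G$-set. For a $G$-space $Y$, $H_*^{\mathrm{br}}(Y;\Gamma)$ and $H^*_{\mathrm{br}}(Y;\Gamma)$ denote Bredon homology and cohomology: the homology of the (co)chains obtained by applying degreewise to $Y$ the covariant functor $\gamma$, respectively the contravariant functor $\gamma^\natural$, underlying $\Gamma$, extended to all $G$-sets so that disjoint unions go to direct sums, respectively products. A $G$-map is a $\Gamma_*^*$-isomorphism if it induces isomorphisms on $H_*^{\mathrm{br}}(-;\Gamma)$ and $H^*_{\mathrm{br}}(-;\Gamma)$ in all degrees. A collection is a set of subgroups of $G$ closed under conjugation. For a collection $\mathcal C$ and a $G$-space $X$, a $\mathcal C$-approximation to $X$ is a $G$-map $Y\to X$ such that every isotropy group of a simplex of $Y$ lies in $\mathcal C$ and $Y^H\to X^H$ is a weak homotopy equivalence for each $H\in\mathcal C$.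 Let $\mathcal A$ be the collection of all $p$-subgroups of $G$. For subgroups $D\subseteq K$ of $G$ with $D$ a $p$-group, let $W=N_K(D)/D$, let $L$ be the nerve of the poset of nontrivial $p$-subgroups of $W$, with $W$ acting by conjugation, and let $L_{hW}=(EW\times L)/W$. The group $W$ acts on $\Gamma(G/D)$ through its action on $G/D$ by $G$-maps ($n\in N_K(D)$ acts by $gD\mapsto gn^{-1}D$, via $\gamma$). We say that $D$ is $\Gamma(G/D)$-superfluous in $K$ if the natural map $L_{hW}\to BW$ induces isomorphisms $$H_*(L_{hW};\Gamma(G/D))\to H_*(BW;\Gamma(G/D)),\qquad H^*(BW;\Gamma(G/D))\to H^*(L_{hW};\Gamma(G/D))$$ on homology and cohomology with twisted coefficients, in all degrees. **Proposition 5.2.** Let $\mathcal C\subseteq\mathcal A$ be a subcollection that is closed under passage to $p$-supergroups (if $D\in\mathcal C$ and $Q\supseteq D$ is a $p$-subgroup of $G$, then $Q\in\mathcal C$), and let $X$ be a $G$-space. Suppose that for every isotropy group $K$ of a simplex of $X$, every $D\in\mathcal A\setminus\mathcal C$ with $D\subseteq K$ is $\Gamma(G/D)$-superfluous in $K$. Then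 $X_{\mathcal C}\to X_{\mathcal A}$ is a $\Gamma_*^*$-isomorphism; that is, for every $\mathcal A$-approximation $X_{\mathcal A}\to X$ and every $G$-map $X_{\mathcal C}\to X_{\mathcal A}$ whose composite with it is a $\mathcal C$-approximation $X_{\mathcal C}\to X$, the map $X_{\mathcal C}\to X_{\mathcal A}$ is a $\Gamma_*^*$-isomorphism. -/

import Mathlib

open CategoryTheory Limits Opposite

universe v u

namespace Bredon

noncomputable section

/-! ### The span category -/

section Spans

variable {C : Type u} [Category.{v} C]

/-- A span `X ← apex → Y` in `C`. -/
structure CSpan (X Y : C) where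
  apex : C
  left : apex ⟶ X
  right : apex ⟶ Y

/-- Two spans are equivalent if there is an isomorphism of their apices commuting with both legs. -/
def CSpan.Equivalent {X Y : C} (A B : CSpan X Y) : Prop :=
  ∃ e : A.apex ≅ B.apex, e.hom ≫ B.left = A.left ∧ e.hom ≫ B.right = A.right

instance CSpan.setoid (X Y : C) : Setoid (CSpan X Y) where
  r := CSpan.Equivalent
  iseqv :=
    { refl := fun _ => ⟨Iso.refl _, by simp, by simp⟩
      symm := by
        rintro A B ⟨e, h₁, h₂⟩
        exact ⟨e.symm, by simp [← h₁], by simp [← h₂]⟩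
      trans := by
        rintro A B D ⟨e, h₁, h₂⟩ ⟨e', h₁', h₂'⟩
        exact ⟨e ≪≫ e', by simp [h₁', h₁], by simp [h₂', h₂]⟩ }

/-- The identity span `X ← X → X`. -/
def CSpan.id (X : C) : CSpan X X := ⟨X, 𝟙 X, 𝟙 X⟩

/-- Composition of spans by fiber product. -/
def CSpan.comp [HasPullbacks C] {X Y Z : C} (A : CSpan X Y) (B : CSpan Y Z) : CSpan X Z :=
  ⟨pullback A.right B.left, pullback.fst _ _ ≫ A.left, pullback.snd _ _ ≫ B.right⟩

theorem CSpan.comp_congr [HasPullbacks C] {X Y Z : C} {A A' : CSpan X Y} {B B' : CSpan Y Z}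
    (hA : A ≈ A') (hB : B ≈ B') : A.comp B ≈ A'.comp B' := by
  obtain ⟨e, h₁, h₂⟩ := hA
  obtain ⟨e', h₁', h₂'⟩ := hB
  let i : pullback A.right B.left ≅ pullback A'.right B'.left :=
    asIso (pullback.map A.right B.left A'.right B'.left e.hom e'.hom (𝟙 Y)
      (by simp [h₂]) (by simp [h₁']))
  refine ⟨i, ?_, ?_⟩
  · change i.hom ≫ pullback.fst _ _ ≫ A'.left = _
    simp only [i, asIso_hom]
    rw [pullback.lift_fst_assoc, Category.assoc, h₁]
    rfl
  · change i.hom ≫ pullback.snd _ _ ≫ B'.right = _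
    simp only [i, asIso_hom]
    rw [pullback.lift_snd_assoc, Category.assoc, h₂']
    rfl

theorem CSpan.id_comp [HasPullbacks C] {X Y : C} (A : CSpan X Y) : (CSpan.id X).comp A ≈ A := by
  let i : pullback (𝟙 X) A.left ≅ A.apex := asIso (pullback.snd (𝟙 X) A.left)
  exact ⟨i, pullback.condition.symm, rfl⟩

theorem CSpan.comp_id [HasPullbacks C] {X Y : C} (A : CSpan X Y) : A.comp (CSpan.id Y) ≈ A := by
  let i : pullback A.right (𝟙 Y) ≅ A.apex := asIso (pullback.fst A.right (𝟙 Y))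
  exact ⟨i, rfl, pullback.condition⟩

theorem CSpan.comp_assoc [HasPullbacks C] {X Y Z T : C} (A : CSpan X Y) (B : CSpan Y Z)
    (D : CSpan Z T) : (A.comp B).comp D ≈ A.comp (B.comp D) :=
  ⟨pullbackAssoc A.right B.left B.right D.left,
    by simp [CSpan.comp, pullbackAssoc_hom_fst_assoc],
    by simp [CSpan.comp, pullbackAssoc_hom_snd_snd_assoc]⟩

/-- The category with the same objects as `C` and equivalence classes of spans as morphisms. -/
structure SpanCat (C : Type u) where
  obj : C

instance [HasPullbacks C] : Category (SpanCat C) where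
  Hom X Y := Quotient (CSpan.setoid X.obj Y.obj)
  id X := Quotient.mk _ (CSpan.id X.obj)
  comp := Quotient.map₂ CSpan.comp fun _ _ hA _ _ hB => CSpan.comp_congr hA hB
  id_comp := by rintro X Y ⟨A⟩; exact Quotient.sound A.id_comp
  comp_id := by rintro X Y ⟨A⟩; exact Quotient.sound A.comp_id
  assoc := by rintro X Y Z T ⟨A⟩ ⟨B⟩ ⟨D⟩; exact Quotient.sound (A.comp_assoc B D)

/-- The functor `C ⥤ SpanCat C` sending `f : X ⟶ Y` to the class of `X ← X → Y`. -/
def SpanCat.covariant (C : Type u) [Category.{v} C] [HasPullbacks C] : C ⥤ SpanCat C where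
  obj X := ⟨X⟩
  map {X Y} f := Quotient.mk (CSpan.setoid X Y) ⟨X, 𝟙 X, f⟩
  map_id _ := rfl
  map_comp {X Y Z} f g := Quotient.sound <| by
    let i : pullback f (𝟙 Y) ≅ X := asIso (pullback.fst f (𝟙 Y))
    refine Setoid.symm ⟨i, rfl, ?_⟩
    simp [i, CSpan.comp, pullback.condition_assoc]

/-- The functor `Cᵒᵖ ⥤ SpanCat C` sending `f : X ⟶ Y` to the class of `Y ← X → X`. -/
def SpanCat.contravariant (C : Type u) [Category.{v} C] [HasPullbacks C] :
    Cᵒᵖ ⥤ SpanCat C where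
  obj X := ⟨X.unop⟩
  map {Y X} f := Quotient.mk (CSpan.setoid Y.unop X.unop) ⟨X.unop, f.unop, 𝟙 X.unop⟩
  map_id _ := rfl
  map_comp {X Y Z} f g := Quotient.sound <| by
    let i : pullback (𝟙 Y.unop) g.unop ≅ Z.unop := asIso (pullback.snd (𝟙 Y.unop) g.unop)
    refine Setoid.symm ⟨i, ?_, rfl⟩
    simp [i, CSpan.comp, ← pullback.condition_assoc]

end Spans

/-! ### Homology and cohomology of simplicial objects with coefficients in a functor -/

section Homology

/-- Apply a covariant functor `F` degreewise to a simplicial object, and take the `n`-th homology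
of the associated chain complex (alternating sums of faces). -/
def homologyWith {C : Type*} [Category* C] (F : C ⥤ AddCommGrpCat.{u}) (n : ℕ) :
    SimplicialObject C ⥤ AddCommGrpCat.{u} :=
  (SimplicialObject.whiskering _ _).obj F ⋙
    AlgebraicTopology.alternatingFaceMapComplex _ ⋙ HomologicalComplex.homologyFunctor _ _ n

/-- Apply a contravariant functor `F` degreewise to a simplicial object, and take the `n`-th
cohomology of the associated cochain complex (alternating sums of cofaces). -/
def cohomologyWith {C : Type*} [Category* C] (F : Cᵒᵖ ⥤ AddCommGrpCat.{u}) (n : ℕ) :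
    (SimplicialObject C)ᵒᵖ ⥤ AddCommGrpCat.{u} :=
  (simplicialCosimplicialEquiv C).functor ⋙ (CosimplicialObject.whiskering _ _).obj F ⋙
    AlgebraicTopology.alternatingCofaceMapComplex _ ⋙ HomologicalComplex.homologyFunctor _ _ n

end Homology

/-! ### `G`-sets and finite `G`-sets -/

section GSets

variable (G : Type u) [Group G]

/-- The category of `G`-sets. -/
abbrev GSet := Action (Type u) G

/-- The category of finite `G`-sets. -/
abbrev FinGSet := Action FintypeCat.{u} G

variable {G}

/-- A finite type with a `G`-action, as an object of `FinGSet G`. -/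
def FinGSet.of (G : Type u) [Group G] (S : Type u) [Finite S] [MulAction G S] : FinGSet G :=
  letI : MulAction G (FintypeCat.of S) := inferInstanceAs (MulAction G S)
  Action.FintypeCat.ofMulAction G (FintypeCat.of S)

/-- An equivariant function between finite types with `G`-action, as a morphism of `FinGSet G`. -/
def FinGSet.homMk {S T : Type u} [Finite S] [MulAction G S] [Finite T] [MulAction G T]
    (f : S → T) (hf : ∀ (g : G) (s : S), f (g • s) = g • f s) :
    FinGSet.of G S ⟶ FinGSet.of G T where
  hom := FintypeCat.homMk f
  comm g := by
    ext s
    exact hf g s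

instance GSet.mulAction (S : GSet G) : MulAction G S.V := Action.instMulAction S

theorem GSet.smul_def (S : GSet G) (g : G) (s : S.V) : g • s = S.ρ g s := rfl

theorem GSet.hom_smul {S T : GSet G} (f : S ⟶ T) (g : G) (s : S.V) :
    f.hom (g • s) = g • f.hom s :=
  ConcreteCategory.congr_hom (f.comm g) s

/-- The set of orbits of a `G`-set. -/
abbrev GSet.Orbits (S : GSet G) : Type u := MulAction.orbitRel.Quotient G S.V

/-- The map on orbit sets induced by a `G`-map. -/
def GSet.orbitsMap {S T : GSet G} (f : S ⟶ T) : S.Orbits → T.Orbits :=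
  Quotient.map f.hom fun a b h => by
    obtain ⟨g, hg⟩ := h
    exact ⟨g, by
      have hg' : g • b = a := hg
      change g • f.hom b = f.hom a
      rw [← GSet.hom_smul, hg']⟩

theorem GSet.finite_orbit [Finite G] (S : GSet G) (ω : S.Orbits) : Finite ω.orbit := by
  induction ω using Quotient.inductionOn with
  | h s =>
    change Finite (MulAction.orbit G s)
    exact Set.finite_range _

/-- An orbit of a `G`-set, as a finite `G`-set. -/
def GSet.orbit [Finite G] (S : GSet G) (ω : S.Orbits) : FinGSet G :=
  haveI := S.finite_orbit ω
  FinGSet.of G ω.orbit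

/-- The restriction of a `G`-map to an orbit. -/
def GSet.orbitMap [Finite G] {S T : GSet G} (f : S ⟶ T) (ω : S.Orbits) :
    S.orbit ω ⟶ T.orbit (GSet.orbitsMap f ω) :=
  haveI := S.finite_orbit ω
  haveI := T.finite_orbit (GSet.orbitsMap f ω)
  FinGSet.homMk
    (fun s => ⟨f.hom s.1, by
      have h := MulAction.orbitRel.Quotient.mem_orbit.mp s.2
      exact MulAction.orbitRel.Quotient.mem_orbit.mpr (congrArg (GSet.orbitsMap f) h)⟩)
    (fun g s => Subtype.ext (GSet.hom_smul f g s.1))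

/-- The additive extension to all `G`-sets of a covariant functor on finite `G`-sets:
`S ↦ ⨁ γ(ω)`, the sum over the orbits `ω` of `S`. -/
def extendCovariant [Finite G] (γ : FinGSet G ⥤ AddCommGrpCat.{u}) :
    GSet G ⥤ AddCommGrpCat.{u} where
  obj S := ∐ fun ω : S.Orbits => γ.obj (S.orbit ω)
  map {S T} f := Sigma.desc fun ω =>
    γ.map (GSet.orbitMap f ω) ≫
      Sigma.ι (fun ω' : T.Orbits => γ.obj (T.orbit ω')) (GSet.orbitsMap f ω)
  map_id S := by
    apply Sigma.hom_ext
    intro ω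
    induction ω using Quotient.inductionOn with
    | h s =>
      rw [Sigma.ι_desc, Category.comp_id]
      exact (congrArg (· ≫ _) (γ.map_id _)).trans (Category.id_comp _)
  map_comp {S T R} f g := by
    apply Sigma.hom_ext
    intro ω
    induction ω using Quotient.inductionOn with
    | h s =>
      rw [Sigma.ι_desc, Sigma.ι_desc_assoc, Category.assoc, Sigma.ι_desc]
      have h : γ.map (GSet.orbitMap (f ≫ g) (Quotient.mk _ s)) =
          γ.map (GSet.orbitMap f (Quotient.mk _ s)) ≫
            γ.map (GSet.orbitMap g (GSet.orbitsMap f (Quotient.mk _ s))) :=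
        γ.map_comp (GSet.orbitMap f (Quotient.mk _ s))
          (GSet.orbitMap g (GSet.orbitsMap f (Quotient.mk _ s)))
      exact (congrArg (· ≫ Sigma.ι (fun ω' : R.Orbits => γ.obj (R.orbit ω')) _) h).trans
        (Category.assoc _ _ _)

/-- The extension to all `G`-sets of a contravariant functor on finite `G`-sets that turns
coproducts into products: `S ↦ ∏ γ(ω)`, the product over the orbits `ω` of `S`. -/
def extendContravariant [Finite G] (γ : (FinGSet G)ᵒᵖ ⥤ AddCommGrpCat.{u}) :
    (GSet G)ᵒᵖ ⥤ AddCommGrpCat.{u} where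
  obj S := ∏ᶜ fun ω : S.unop.Orbits => γ.obj (op (S.unop.orbit ω))
  map {T S} f := Pi.lift fun ω : S.unop.Orbits =>
    Pi.π (fun ω' : T.unop.Orbits => γ.obj (op (T.unop.orbit ω'))) (GSet.orbitsMap f.unop ω) ≫
      γ.map (GSet.orbitMap f.unop ω).op
  map_id S := by
    apply Pi.hom_ext
    intro ω
    induction ω using Quotient.inductionOn with
    | h s =>
      rw [Pi.lift_π, Category.id_comp]
      exact (congrArg (_ ≫ ·) (γ.map_id _)).trans (Category.comp_id _)
  map_comp {R T S} f g := by
    apply Pi.hom_ext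
    intro ω
    induction ω using Quotient.inductionOn with
    | h s =>
      rw [Pi.lift_π, Category.assoc, Pi.lift_π, Pi.lift_π_assoc]
      have h : γ.map (GSet.orbitMap (f ≫ g).unop (Quotient.mk _ s)).op =
          γ.map (GSet.orbitMap f.unop (GSet.orbitsMap g.unop (Quotient.mk _ s))).op ≫
            γ.map (GSet.orbitMap g.unop (Quotient.mk _ s)).op :=
        γ.map_comp (GSet.orbitMap f.unop (GSet.orbitsMap g.unop (Quotient.mk _ s))).op
          (GSet.orbitMap g.unop (Quotient.mk _ s)).op
      exact (congrArg (Pi.π (fun ω' : R.unop.Orbits => γ.obj (op (R.unop.orbit ω'))) _ ≫ ·) h).trans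
        (Category.assoc _ _ _).symm

end GSets

/-! ### Mackey functors -/

section Mackey

variable (G : Type u) [Group G]

/-- The category `ω(G)`: finite `G`-sets, with equivalence classes of spans as morphisms. -/
abbrev Omega := SpanCat (FinGSet G)

/-- A Mackey functor for `G`: a functor from `ω(G)` to abelian groups that takes finite coproducts
in `ω(G)` to coproducts of abelian groups. -/
structure MackeyFunctor where
  functor : Omega G ⥤ AddCommGrpCat.{u}
  additive : PreservesFiniteCoproducts functor

variable {G}

/-- The covariant functor on finite `G`-sets underlying a Mackey functor. -/
def MackeyFunctor.lower (Γ : MackeyFunctor G) : FinGSet G ⥤ AddCommGrpCat.{u} :=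
  SpanCat.covariant _ ⋙ Γ.functor

/-- The contravariant functor on finite `G`-sets underlying a Mackey functor. -/
def MackeyFunctor.upper (Γ : MackeyFunctor G) : (FinGSet G)ᵒᵖ ⥤ AddCommGrpCat.{u} :=
  SpanCat.contravariant _ ⋙ Γ.functor

end Mackey

/-! ### `G`-spaces -/

section GSpaces

variable (G : Type u) [Group G]

/-- A `G`-space is a simplicial `G`-set. -/
abbrev GSpace := SimplicialObject (GSet G)

variable {G}

/-- Bredon homology of `G`-spaces with coefficients in a Mackey functor. -/
def bredonHomology [Finite G] (Γ : MackeyFunctor G) (n : ℕ) : GSpace G ⥤ AddCommGrpCat.{u} :=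
  homologyWith (extendCovariant Γ.lower) n

/-- Bredon cohomology of `G`-spaces with coefficients in a Mackey functor. -/
def bredonCohomology [Finite G] (Γ : MackeyFunctor G) (n : ℕ) :
    (GSpace G)ᵒᵖ ⥤ AddCommGrpCat.{u} :=
  cohomologyWith (extendContravariant Γ.upper) n

/-- A `Γ_*^*`-isomorphism: a `G`-map that induces isomorphisms on Bredon homology and on Bredon
cohomology with coefficients in `Γ`, in all degrees. -/
def IsMackeyIso [Finite G] (Γ : MackeyFunctor G) {X Y : GSpace G} (f : X ⟶ Y) : Prop :=
  (∀ n, IsIso ((bredonHomology Γ n).map f)) ∧ (∀ n, IsIso ((bredonCohomology Γ n).map f.op))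

/-- The functor of `K`-fixed points on `G`-sets. -/
def fixedSet (K : Subgroup G) : GSet G ⥤ Type u where
  obj S := {s : S.V // ∀ k ∈ K, k • s = s}
  map f := ↾fun s => ⟨f.hom s.1, fun k hk => by rw [← GSet.hom_smul, s.2 k hk]⟩

/-- The simplicial set `X^K` of `K`-fixed points of a `G`-space, as a functor of `X`. -/
def fixedPoints (K : Subgroup G) : GSpace G ⥤ SSet.{u} :=
  (SimplicialObject.whiskering _ _).obj (fixedSet K)

/-- `Iso(X)`: the subgroups of `G` that are isotropy groups of simplices of `X`. -/
def isotropy (X : GSpace G) : Set (Subgroup G) :=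
  {K | ∃ (n : SimplexCategoryᵒᵖ) (x : (X.obj n).V), MulAction.stabilizer G x = K}

end GSpaces

/-- A map `f : X ⟶ Y` of simplicial sets is a weak homotopy equivalence: for every Kan complex
`Z`, precomposition with `f` is a bijection from the simplicial homotopy classes of maps `Y ⟶ Z`
to those of maps `X ⟶ Z`. -/
def IsWeakEquivalence {X Y : SSet.{u}} (f : X ⟶ Y) : Prop :=
  ∀ (Z : SSet.{u}) [SSet.KanComplex Z],
    (∀ g : X ⟶ Z, ∃ h : Y ⟶ Z, Nonempty (SSet.Homotopy (f ≫ h) g)) ∧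
    (∀ h h' : Y ⟶ Z, Nonempty (SSet.Homotopy (f ≫ h) (f ≫ h')) → Nonempty (SSet.Homotopy h h'))

/-! ### Collections and approximations -/

section Approximations

variable {G : Type u} [Group G]

/-- A collection of subgroups is a set of subgroups closed under conjugation. -/
def IsCollection (𝒞 : Set (Subgroup G)) : Prop :=
  ∀ H ∈ 𝒞, ∀ g : G, H.map (MulAut.conj g).toMonoidHom ∈ 𝒞

/-- The collection of all `p`-subgroups of `G`. -/
def pSubgroups (p : ℕ) (G : Type u) [Group G] : Set (Subgroup G) := {H | IsPGroup p H}

/-- `𝒞` is closed under passage to `p`-supergroups. -/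
def ClosedUnderPSupergroups (p : ℕ) (𝒞 : Set (Subgroup G)) : Prop :=
  ∀ D ∈ 𝒞, ∀ Q : Subgroup G, D ≤ Q → IsPGroup p Q → Q ∈ 𝒞

/-- `𝒞 ↓ K`: the members of `𝒞` that are contained in `K`. -/
def restrictTo (𝒞 : Set (Subgroup G)) (K : Subgroup G) : Set (Subgroup G) := {H | H ∈ 𝒞 ∧ H ≤ K}

/-- A `𝒞`-approximation to `X`: a `G`-map `Y ⟶ X` such that all isotropy groups of `Y` are in `𝒞`
and the map `Y^K ⟶ X^K` is a weak equivalence for each `K ∈ 𝒞`. -/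
structure IsApproximation (𝒞 : Set (Subgroup G)) {Y X : GSpace G} (f : Y ⟶ X) : Prop where
  isotropy_subset : isotropy Y ⊆ 𝒞
  isWeakEquivalence : ∀ K ∈ 𝒞, IsWeakEquivalence ((fixedPoints K).map f)

end Approximations

/-! ### Borel constructions and twisted homology -/

section Twisted

variable {W : Type u} [Group W]

/-- The `W`-space underlying a simplicial set with an action of `W`. -/
def GSpace.ofAction (Y : Action SSet.{u} W) : GSpace W where
  obj n :=
    { V := Y.V.obj n
      ρ :=
        { toFun w := (Y.ρ w).app n
          map_one' := by rw [map_one]; rfl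
          map_mul' w w' := by rw [map_mul]; rfl } }
  map f := { hom := Y.V.map f, comm := fun w => ((Y.ρ w).naturality f).symm }
  map_id n := by
    ext x
    exact ConcreteCategory.congr_hom (Y.V.map_id n) x
  map_comp f g := by
    ext x
    exact ConcreteCategory.congr_hom (Y.V.map_comp f g) x

/-- The product of two `W`-spaces, with the diagonal action. -/
def GSpace.prod (X Y : GSpace W) : GSpace W where
  obj n := Action.ofMulAction W ((X.obj n).V × (Y.obj n).V)
  map f :=
    { hom := ↾fun x => ((X.map f).hom x.1, (Y.map f).hom x.2)
      comm := fun w => by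
        ext x
        exact Prod.ext (GSet.hom_smul (X.map f) w x.1) (GSet.hom_smul (Y.map f) w x.2) }
  map_id n := by
    ext x
    change ((X.map (𝟙 n)).hom x.1, (Y.map (𝟙 n)).hom x.2) = x
    rw [X.map_id, Y.map_id]
    rfl
  map_comp f g := by
    ext x
    change ((X.map (f ≫ g)).hom x.1, (Y.map (f ≫ g)).hom x.2) = _
    rw [X.map_comp, Y.map_comp]
    rfl

/-- The projection `X × Y ⟶ X`. -/
def GSpace.fst (X Y : GSpace W) : X.prod Y ⟶ X where
  app _ := { hom := ↾fun x => x.1, comm := fun _ => rfl }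
  naturality _ _ _ := rfl

/-- The free contractible `W`-space `EW`, whose `n`-simplices are the elements of `W ^ (n + 1)`. -/
abbrev universalSpace (W : Type u) [Group W] : GSpace W := classifyingSpaceUniversalCover W

/-- `W`-modules. -/
abbrev GModule (W : Type u) [Group W] := Action AddCommGrpCat.{u} W

/-- The action of `w ∈ W` on a `W`-module. -/
def GModule.act (M : GModule W) (w : W) : M.V →+ M.V := AddCommGrpCat.Hom.hom (M.ρ w)

/-- For a `W`-set `S` and a `W`-module `M`, the subgroup of `ℤ[S] ⊗ M` (finitely supported
functions `S → M`) generated by the elements `w s ⊗ w m - s ⊗ m`. -/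
def twistedRelations (M : GModule W) (S : GSet W) : AddSubgroup (S.V →₀ M.V) :=
  AddSubgroup.closure
    {x | ∃ (w : W) (s : S.V) (m : M.V),
      x = Finsupp.single (w • s) (M.act w m) - Finsupp.single s m}

/-- The functor `S ↦ ℤ[S] ⊗_{ℤ[W]} M = (ℤ[S] ⊗ M)_W` on `W`-sets. -/
def twistedChains (M : GModule W) : GSet W ⥤ AddCommGrpCat.{u} where
  obj S := AddCommGrpCat.of ((S.V →₀ M.V) ⧸ twistedRelations M S)
  map {S T} f := AddCommGrpCat.ofHom <|
    QuotientAddGroup.map (twistedRelations M S) (twistedRelations M T)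
      (Finsupp.mapDomain.addMonoidHom f.hom) (by
        rw [twistedRelations, AddSubgroup.closure_le]
        rintro _ ⟨w, s, m, rfl⟩
        refine AddSubgroup.subset_closure ⟨w, f.hom s, m, ?_⟩
        rw [map_sub, ← GSet.hom_smul]
        exact congrArg₂ (· - ·) Finsupp.mapDomain_single Finsupp.mapDomain_single)
  map_id S := by
    apply AddCommGrpCat.hom_ext
    refine QuotientAddGroup.addMonoidHom_ext _ (AddMonoidHom.ext fun x => ?_)
    exact congrArg (QuotientAddGroup.mk (s := twistedRelations M S)) Finsupp.mapDomain_id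
  map_comp {S T R} f g := by
    apply AddCommGrpCat.hom_ext
    refine QuotientAddGroup.addMonoidHom_ext _ (AddMonoidHom.ext fun x => ?_)
    have h : Finsupp.mapDomain (fun s => g.hom (f.hom s)) x =
        Finsupp.mapDomain g.hom (Finsupp.mapDomain f.hom x) := Finsupp.mapDomain_comp
    exact congrArg (QuotientAddGroup.mk (s := twistedRelations M R)) h

/-- The group of `W`-equivariant functions `S → M`, i.e. `Hom_{ℤ[W]}(ℤ[S], M)`. -/
def equivariantMaps (M : GModule W) (S : GSet W) : AddSubgroup (S.V → M.V) where
  carrier := {φ | ∀ (w : W) (s : S.V), φ (w • s) = M.act w (φ s)}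
  zero_mem' := fun w _ => (map_zero (M.act w)).symm
  add_mem' {φ ψ} hφ hψ := fun w s => by
    rw [Pi.add_apply, Pi.add_apply, hφ, hψ, map_add]
  neg_mem' {φ} hφ := fun w s => by
    rw [Pi.neg_apply, Pi.neg_apply, hφ, map_neg]

/-- The contravariant functor `S ↦ Hom_{ℤ[W]}(ℤ[S], M)` on `W`-sets. -/
def twistedCochains (M : GModule W) : (GSet W)ᵒᵖ ⥤ AddCommGrpCat.{u} where
  obj S := AddCommGrpCat.of (equivariantMaps M S.unop)
  map {T S} f := AddCommGrpCat.ofHom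
    { toFun := fun φ => ⟨fun s => φ.1 (f.unop.hom s), fun w s => by
        exact (congrArg φ.1 (GSet.hom_smul f.unop w s)).trans (φ.2 w _)⟩
      map_zero' := rfl
      map_add' := fun _ _ => rfl }
  map_id _ := rfl
  map_comp _ _ := rfl

/-- Homology of the Borel construction with twisted coefficients: for a `W`-space `L`,
this is `H_n(L_{hW}; M)`, where `L_{hW} = (EW × L)/W`, computed as the homology of
`ℤ[EW × L] ⊗_{ℤ[W]} M` (the chains on the principal `W`-cover `EW × L` of `L_{hW}`). -/
def borelHomology (M : GModule W) (n : ℕ) (L : GSpace W) : AddCommGrpCat.{u} :=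
  (homologyWith (twistedChains M) n).obj ((universalSpace W).prod L)

/-- `H^n(L_{hW}; M)`, computed as the cohomology of `Hom_{ℤ[W]}(ℤ[EW × L], M)`. -/
def borelCohomology (M : GModule W) (n : ℕ) (L : GSpace W) : AddCommGrpCat.{u} :=
  (cohomologyWith (twistedCochains M) n).obj (op ((universalSpace W).prod L))

/-- `H_n(BW; M)`, where `BW = EW/W`. -/
def classifyingHomology (M : GModule W) (n : ℕ) : AddCommGrpCat.{u} :=
  (homologyWith (twistedChains M) n).obj (universalSpace W)

/-- `H^n(BW; M)`, where `BW = EW/W`. -/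
def classifyingCohomology (M : GModule W) (n : ℕ) : AddCommGrpCat.{u} :=
  (cohomologyWith (twistedCochains M) n).obj (op (universalSpace W))

/-- The map `H_n(L_{hW}; M) ⟶ H_n(BW; M)` induced by `L_{hW} → *_{hW} = BW`. -/
def borelHomologyMap (M : GModule W) (n : ℕ) (L : GSpace W) :
    borelHomology M n L ⟶ classifyingHomology M n :=
  (homologyWith (twistedChains M) n).map (GSpace.fst (universalSpace W) L)

/-- The map `H^n(BW; M) ⟶ H^n(L_{hW}; M)` induced by `L_{hW} → *_{hW} = BW`. -/
def borelCohomologyMap (M : GModule W) (n : ℕ) (L : GSpace W) :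
    classifyingCohomology M n ⟶ borelCohomology M n L :=
  (cohomologyWith (twistedCochains M) n).map (GSpace.fst (universalSpace W) L).op

end Twisted

/-! ### The poset of nontrivial `p`-subgroups -/

section PSubgroups

/-- The poset of nontrivial `p`-subgroups of `W`. -/
abbrev NontrivialPSubgroup (p : ℕ) (W : Type u) [Group W] : Type u :=
  {P : Subgroup W // IsPGroup p P ∧ P ≠ ⊥}

variable (p : ℕ) {W : Type u} [Group W]

/-- Conjugation `P ↦ w P w⁻¹` as an endofunctor of the poset of nontrivial `p`-subgroups. -/
def conjFunctor (w : W) : NontrivialPSubgroup p W ⥤ NontrivialPSubgroup p W :=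
  Monotone.functor (f := fun P => ⟨P.1.map (MulAut.conj w).toMonoidHom,
    P.2.1.map _, fun h => P.2.2 <| by
      rwa [Subgroup.map_eq_bot_iff_of_injective _ (MulAut.conj w).injective] at h⟩)
    fun _ _ h => Subgroup.map_mono h

theorem conjFunctor_one : conjFunctor p (1 : W) = 𝟭 _ :=
  CategoryTheory.Functor.ext (fun P => Subtype.ext <| by
    ext x
    simp [conjFunctor, Monotone.functor]) fun _ _ _ => Subsingleton.elim _ _

theorem conjFunctor_mul (w w' : W) :
    conjFunctor p (w * w') = conjFunctor p w' ⋙ conjFunctor p w :=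
  CategoryTheory.Functor.ext (fun P => Subtype.ext <| by
    change P.1.map _ = (P.1.map _).map _
    rw [Subgroup.map_map, map_mul]
    rfl) fun _ _ _ => Subsingleton.elim _ _

/-- The nerve of the poset of nontrivial `p`-subgroups of `W`, with `W` acting by conjugation. -/
def pSubgroupSpace (W : Type u) [Group W] : GSpace W :=
  GSpace.ofAction
    { V := nerve (NontrivialPSubgroup p W)
      ρ :=
        { toFun w := nerveMap (conjFunctor p w)
          map_one' := by rw [conjFunctor_one]; rfl
          map_mul' w w' := by rw [conjFunctor_mul]; rfl } }

end PSubgroups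

/-! ### Superfluous subgroups -/

section Superfluous

variable {G : Type u} [Group G]

/-- The normalizer of `D` in `K` (for `D ≤ K`). -/
abbrev normalizerIn (K D : Subgroup G) : Subgroup G := K ⊓ Subgroup.normalizer (D : Set G)

instance normal_subgroupOf_normalizerIn (K D : Subgroup G) :
    (D.subgroupOf (normalizerIn K D)).Normal :=
  Subgroup.normal_subgroupOf_of_le_normalizer inf_le_right

/-- The group `W = N_K(D) / D` (for `D ≤ K`). -/
abbrev weyl (K D : Subgroup G) : Type u := normalizerIn K D ⧸ D.subgroupOf (normalizerIn K D)

/-- `G/D` as a finite `G`-set. -/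
abbrev cosets [Finite G] (D : Subgroup G) : FinGSet G := FinGSet.of G (G ⧸ D)

theorem rightMul_aux (K D : Subgroup G) (n : normalizerIn K D) (a b : G)
    (h : QuotientGroup.leftRel D a b) :
    QuotientGroup.leftRel D (a * (n : G)⁻¹) (b * (n : G)⁻¹) := by
  rw [QuotientGroup.leftRel_apply] at h ⊢
  have := (Subgroup.mem_normalizer_iff.mp n.2.2 (a⁻¹ * b)).mp h
  simpa [mul_assoc] using this

/-- For `n ∈ N_K(D)`, the `G`-map `G/D ⟶ G/D`, `g D ↦ g n⁻¹ D`; this is a homomorphism in `n`. -/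
def normalizerAction [Finite G] (K D : Subgroup G) : normalizerIn K D →* End (cosets D) where
  toFun n := FinGSet.homMk (Quotient.map (fun g => g * (n : G)⁻¹) (rightMul_aux K D n)) (by
    rintro g ⟨a⟩
    exact congrArg (QuotientGroup.mk (s := D)) (mul_assoc g a _))
  map_one' := by
    apply Action.hom_ext
    ext x
    induction x using Quotient.inductionOn with
    | h a => exact congrArg (QuotientGroup.mk (s := D)) (by simp)
  map_mul' m n := by
    apply Action.hom_ext
    ext x
    induction x using Quotient.inductionOn with
    | h a =>
      exact congrArg (QuotientGroup.mk (s := D)) (a₁ := a * ((m * n : normalizerIn K D) : G)⁻¹)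
        (a₂ := a * (n : G)⁻¹ * (m : G)⁻¹) (by simp [mul_assoc])

/-- The induced homomorphism from `W = N_K(D) / D` to the `G`-endomorphisms of `G/D`. -/
def weylAction [Finite G] (K D : Subgroup G) : weyl K D →* End (cosets D) :=
  QuotientGroup.lift _ (normalizerAction K D) fun n hn => by
    apply Action.hom_ext
    ext x
    induction x using Quotient.inductionOn with
    | h a =>
      refine QuotientGroup.eq.mpr ?_
      simpa [Subgroup.mem_subgroupOf] using hn

/-- `Γ(G/D)` as a module over `W = N_K(D) / D`: `W` acts on `Γ(G/D)` through its action on `G/D`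
and the covariant functor underlying `Γ`. -/
def coefficientModule [Finite G] (Γ : MackeyFunctor G) (K D : Subgroup G) :
    GModule (weyl K D) where
  V := Γ.lower.obj (cosets D)
  ρ := (Γ.lower.mapEnd (cosets D)).comp (weylAction K D)

/-- For `D ≤ K` and a module `M` over `W = N_K(D) / D`, the subgroup `D` is `M`-superfluous in `K`
if `L_{hW} → BW` induces isomorphisms on homology and cohomology twisted by `M`, where `L` is the
nerve of the poset of nontrivial `p`-subgroups of `W`. -/
def IsSuperfluous (p : ℕ) {K D : Subgroup G} (M : GModule (weyl K D)) : Prop :=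
  (∀ n, IsIso (borelHomologyMap M n (pSubgroupSpace p (weyl K D)))) ∧
  (∀ n, IsIso (borelCohomologyMap M n (pSubgroupSpace p (weyl K D))))

end Superfluous

end

end Bredon

/-!
The argument is carried out on cochains with coefficients in an arbitrary contravariant functor `M`
on finite `G`-sets. Cohomology is the case `M = γ♮` (`contraModule_upper` identifies its modules
`M(G/D)` with those of the covariant functor). For homology, `ℚ/ℤ` is an injective cogenerator, so
a map is an isomorphism on homology if and only if it is one on the dual cochains
(`isIso_homologyWith_iff`), and those are the cochains of `M = Hom(γ, ℚ/ℤ)`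
(`quasiIsoDG_dual_extendCovariant`, `quasiIsoDG_twistedCochains_dualModule`).
A cochain complex is encoded as the product of its terms with its total differential.

Bredon cochains are filtered by the index of isotropy groups. The graded pieces are products, over
the conjugacy classes of subgroups `D`, of the cochains supported on the simplices with isotropy
group exactly `D`. In the space `Y^D` with its action of `W = N_G(D)/D`, these are the simplices
with trivial isotropy in `W`, because a proper subgroup of a `p`-group is properly contained in its
normalizer (`stabilizer_eq_of_weyl_eq_bot`). So it suffices to compare, for each `D`, the cochains
of the free parts of `X_𝒞^D` and `X_𝒜^D` with coefficients in the `W`-module `M(G/D)`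
(`quasiIsoDG_extendContravariant`).

For a `W`-space `Y`, the cochains of the free part are, up to quasi-isomorphism, the kernel of
restriction from `EW × Y` to `EW × Y_s`, where `Y_s` is the singular part. If all isotropy groups of
`Y` are `p`-groups, then `Y_s` can be replaced by the space of simplices labelled by chains of
nontrivial `p`-subgroups of their isotropy groups, since the poset of nontrivial `p`-subgroups of a
nontrivial `p`-group has a largest element (`quasiIsoDG_subgroupToSingular`). Both `EW × Y` and the
labelled space are built from free `W`-cells times fixed point spaces `Y^P` of `p`-subgroups `P`
(`quasiIsoDG_labelSpace_column`). Hence the cochains of the free part depend only on the cochains of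
the spaces `Y^P` (`quasiIsoDG_freeCochains`), which weak equivalences preserve: Eilenberg-MacLane
spaces are Kan complexes and represent cohomology (`quasiIsoDG_of_isWeakEquivalence`).

If `D` is in `𝒞`, then all larger `p`-subgroups are as well, so `X_𝒞 → X_𝒜` is a weak equivalence on
all fixed point spaces involved, and the free parts agree. If `D` is a `p`-group that is not in `𝒞`,
then the free part of `X_𝒞^D` is empty. The free part of `X_𝒜^D` is compared with `X` instead: as
`X_𝒜^Q → X^Q` is a weak equivalence for each `p`-subgroup `Q`, its cochains are acyclic as soon as
restriction from `EW × X^D` to the labelled space is a quasi-isomorphism (`freeCochains_acyclic`).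
For a simplex of `X^D` with isotropy group `K` in `G`, hence `N_K(D)/D` in `W`, the labels are the
simplices of the nerve of the poset of nontrivial `p`-subgroups of `N_K(D)/D`, so this is the
hypothesis that `D` is superfluous in `K` (`quasiIsoDG_restrictSubgroup`). If `D` is not a
`p`-group, both free parts are empty. The cases are put together in
`quasiIsoDG_freeCochains_weylSpace`.
-/

namespace Bredon

noncomputable section

/-! ### Differential groups -/

section DifferentialGroups

variable {V V' V'' : Type*} [AddCommGroup V] [AddCommGroup V'] [AddCommGroup V'']
  {d : V →+ V} {d' : V' →+ V'} {d'' : V'' →+ V''}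

/-- A map `f` between abelian groups with differentials `d` and `d'` is a quasi-isomorphism. The
groups carry no grading: a cochain complex is encoded as the product of its terms. The condition is
the exactness of the mapping cone, stated for elements; for a map of differential groups it says
that `ker d / im d → ker d' / im d'` is bijective (`quasiIsoDG_iff`). -/
def QuasiIsoDG (d : V →+ V) (d' : V' →+ V') (f : V →+ V') : Prop :=
  ∀ a a', d a = 0 → f a = d' a' → ∃ b b', d b = a ∧ f b - a' = d' b'

theorem quasiIsoDG_iff {f : V →+ V'} (hf : ∀ a, f (d a) = d' (f a)) :
    QuasiIsoDG d d' f ↔ (∀ a, d a = 0 → (∃ a', f a = d' a') → ∃ b, d b = a) ∧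
      ∀ a', d' a' = 0 → ∃ a, d a = 0 ∧ ∃ b', f a - a' = d' b' := by
  constructor
  · intro h
    refine ⟨fun a ha ⟨a', ha'⟩ => ?_, fun a' ha' => ?_⟩
    · obtain ⟨b, -, hb, -⟩ := h a a' ha ha'
      exact ⟨b, hb⟩
    · obtain ⟨b, b', hb, hb'⟩ := h 0 a' (map_zero d) (by rw [map_zero, ha'])
      exact ⟨b, hb, b', hb'⟩
  · rintro ⟨h₁, h₂⟩ a a' ha ha'
    obtain ⟨b, rfl⟩ := h₁ a ha ⟨a', ha'⟩
    obtain ⟨c, hc, b', hb'⟩ := h₂ (f b - a') (by rw [map_sub, ← hf, ha', sub_self])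
    refine ⟨b - c, -b', by rw [map_sub, hc, sub_zero], ?_⟩
    rw [map_neg, ← hb', map_sub]
    abel

theorem QuasiIsoDG.comp {f : V →+ V'} {g : V' →+ V''}
    (hf : ∀ a, f (d a) = d' (f a)) (hg : ∀ a, g (d' a) = d'' (g a))
    (h : QuasiIsoDG d d' f) (h' : QuasiIsoDG d' d'' g) : QuasiIsoDG d d'' (g.comp f) := by
  rw [quasiIsoDG_iff hf] at h
  rw [quasiIsoDG_iff hg] at h'
  rw [quasiIsoDG_iff (by simp [hf, hg])]
  refine ⟨fun a ha ⟨a', ha'⟩ => h.1 a ha ?_, fun a' ha' => ?_⟩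
  · obtain ⟨b, hb⟩ := h'.1 (f a) (by rw [← hf, ha, map_zero]) ⟨a', ha'⟩
    exact ⟨b, hb.symm⟩
  · obtain ⟨b, hb, c, hc⟩ := h'.2 a' ha'
    obtain ⟨e, he, k, hk⟩ := h.2 b hb
    refine ⟨e, he, g k + c, ?_⟩
    rw [map_add, ← hc, ← hg, ← hk, map_sub, AddMonoidHom.comp_apply]
    abel

theorem QuasiIsoDG.of_comp_left {f : V →+ V'} {g : V' →+ V''}
    (hf : ∀ a, f (d a) = d' (f a)) (hg : ∀ a, g (d' a) = d'' (g a))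
    (h' : QuasiIsoDG d' d'' g) (h : QuasiIsoDG d d'' (g.comp f)) : QuasiIsoDG d d' f := by
  rw [quasiIsoDG_iff (by simp [hf, hg])] at h
  rw [quasiIsoDG_iff hg] at h'
  rw [quasiIsoDG_iff hf]
  refine ⟨fun a ha ⟨a', ha'⟩ => h.1 a ha ⟨g a', ?_⟩, fun a' ha' => ?_⟩
  · rw [AddMonoidHom.comp_apply, ha', hg]
  · obtain ⟨a, ha, c, hc⟩ := h.2 (g a') (by rw [← hg, ha', map_zero])
    obtain ⟨b, hb⟩ := h'.1 (f a - a') (by rw [map_sub, ← hf, ha, ha', map_zero, sub_zero])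
      ⟨c, by rw [map_sub, ← hc, AddMonoidHom.comp_apply]⟩
    exact ⟨a, ha, b, hb.symm⟩

theorem QuasiIsoDG.of_comp_right {f : V →+ V'} {g : V' →+ V''}
    (hf : ∀ a, f (d a) = d' (f a)) (hg : ∀ a, g (d' a) = d'' (g a))
    (h' : QuasiIsoDG d d' f) (h : QuasiIsoDG d d'' (g.comp f)) : QuasiIsoDG d' d'' g := by
  rw [quasiIsoDG_iff (by simp [hf, hg])] at h
  rw [quasiIsoDG_iff hf] at h'
  rw [quasiIsoDG_iff hg]
  refine ⟨fun a' ha' ⟨a'', ha''⟩ => ?_, fun a'' ha'' => ?_⟩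
  · obtain ⟨a, ha, c, hc⟩ := h'.2 a' ha'
    obtain ⟨b, hb⟩ := h.1 a ha ⟨g c + a'', by
      rw [map_add, ← hg, ← hc, ← ha'', map_sub, AddMonoidHom.comp_apply]; abel⟩
    exact ⟨f b - c, by rw [map_sub, ← hf, hb, ← hc]; abel⟩
  · obtain ⟨a, ha, c, hc⟩ := h.2 a'' ha''
    exact ⟨f a, by rw [← hf, ha, map_zero], c, hc⟩

/-- In a commutative square with two opposite quasi-isomorphisms, one of the other two sides is a
quasi-isomorphism if and only if both are. -/
theorem QuasiIsoDG.square_iff {U U' : Type*} [AddCommGroup U] [AddCommGroup U'] {e : U →+ U}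
    {e' : U' →+ U'} {f : V →+ V'} {g : U →+ U'} {i : V →+ U} {i' : V' →+ U'}
    (hf : ∀ a, f (d a) = d' (f a)) (hg : ∀ a, g (e a) = e' (g a))
    (hi : ∀ a, i (d a) = e (i a)) (hi' : ∀ a, i' (d' a) = e' (i' a))
    (hgi : ∀ a, g (i a) = i' (f a)) (h : QuasiIsoDG d e i) (h' : QuasiIsoDG d' e' i') :
    QuasiIsoDG d d' f ↔ QuasiIsoDG e e' g := by
  have hc : g.comp i = i'.comp f := AddMonoidHom.ext hgi
  constructor
  · intro hqf
    refine QuasiIsoDG.of_comp_right hi hg h ?_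
    rw [hc]
    exact QuasiIsoDG.comp hf hi' hqf h'
  · intro hqg
    refine QuasiIsoDG.of_comp_left hf hi' h' ?_
    rw [← hc]
    exact QuasiIsoDG.comp hi hg h hqg

/-- A map of differential groups that has an inverse up to homotopy is a quasi-isomorphism. -/
theorem QuasiIsoDG.of_homotopyEquiv {f : V →+ V'} (g : V' →+ V) (s : V →+ V) (s' : V' →+ V')
    (hf : ∀ a, f (d a) = d' (f a)) (hg : ∀ a, g (d' a) = d (g a))
    (hs : ∀ a, d a = 0 → g (f a) - a = d (s a)) (hs' : ∀ a, d' a = 0 → f (g a) - a = d' (s' a)) :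
    QuasiIsoDG d d' f := by
  rw [quasiIsoDG_iff hf]
  refine ⟨fun a ha ⟨a', ha'⟩ => ⟨g a' - s a, ?_⟩, fun a' ha' => ?_⟩
  · rw [map_sub, ← hg, ← ha', ← hs a ha]; abel
  · exact ⟨g a', by rw [← hg, ha', map_zero], s' a', hs' a' ha'⟩

theorem QuasiIsoDG.of_bijective {f : V →+ V'}
    (hf : ∀ a, f (d a) = d' (f a)) (h : Function.Bijective f) : QuasiIsoDG d d' f := by
  rw [quasiIsoDG_iff hf]
  refine ⟨fun a _ ⟨a', ha'⟩ => ?_, fun a' ha' => ?_⟩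
  · obtain ⟨b, rfl⟩ := h.2 a'
    exact ⟨b, h.1 (by rw [hf, ha'])⟩
  · obtain ⟨a, rfl⟩ := h.2 a'
    exact ⟨a, h.1 (by rw [hf, ha', map_zero]), 0, by simp⟩

/-- Quasi-isomorphisms are invariant under isomorphisms of maps of differential groups. -/
theorem QuasiIsoDG.of_equiv {U U' : Type*} [AddCommGroup U] [AddCommGroup U'] {e : U →+ U}
    {e' : U' →+ U'} {f : V →+ V'} {g : U →+ U'} (i : V ≃+ U) (i' : V' ≃+ U')
    (hi : ∀ a, i (d a) = e (i a)) (hi' : ∀ a, i' (d' a) = e' (i' a))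
    (hg : ∀ a, g (i a) = i' (f a)) (h : QuasiIsoDG d d' f) : QuasiIsoDG e e' g := by
  intro a a' ha ha'
  obtain ⟨b, b', hb, hb'⟩ := h (i.symm a) (i'.symm a')
    (i.injective (by rw [hi, map_zero, AddEquiv.apply_symm_apply, ha]))
    (i'.injective (by rw [← hg, hi']; simpa using ha'))
  refine ⟨i b, i' b', by rw [← hi, hb, AddEquiv.apply_symm_apply], ?_⟩
  rw [← hi', ← hb', map_sub, hg, AddEquiv.apply_symm_apply]

/-- In a map of short exact sequences `0 → R → V → U → 0` of differential groups, if the maps on `V`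
and `U` are quasi-isomorphisms, then so is the map on `R`. -/
theorem QuasiIsoDG.ker {R R' U U' : Type*} [AddCommGroup R] [AddCommGroup R'] [AddCommGroup U]
    [AddCommGroup U'] {r : R →+ R} {r' : R' →+ R'} {e : U →+ U} {e' : U' →+ U'} {f : V →+ V'}
    {g : U →+ U'} {k : R →+ R'} {i : R →+ V} {i' : R' →+ V'} {p : V →+ U} {p' : V' →+ U'}
    (hd : ∀ a, d (d a) = 0) (hd' : ∀ a, d' (d' a) = 0)
    (hf : ∀ a, f (d a) = d' (f a))
    (hi : ∀ a, i (r a) = d (i a)) (hi' : ∀ a, i' (r' a) = d' (i' a))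
    (hp : ∀ a, p (d a) = e (p a)) (hp' : ∀ a, p' (d' a) = e' (p' a))
    (hinj : Function.Injective i) (hinj' : Function.Injective i')
    (hex : ∀ a, p a = 0 ↔ ∃ b, i b = a) (hex' : ∀ a, p' a = 0 ↔ ∃ b, i' b = a)
    (hsurj : Function.Surjective p) (hsurj' : Function.Surjective p')
    (hg : ∀ a, g (p a) = p' (f a)) (hk : ∀ a, i' (k a) = f (i a))
    (h : QuasiIsoDG d d' f) (h' : QuasiIsoDG e e' g) : QuasiIsoDG r r' k := by
  intro a a' ha ha'
  obtain ⟨b, b', hb, hb'⟩ := h (i a) (i' a') (by rw [← hi, ha, map_zero])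
    (by rw [← hk, ha', hi'])
  obtain ⟨c, c', hc, hc'⟩ := h' (p b) (p' b') (by rw [← hp, hb, (hex _).2 ⟨a, rfl⟩])
    (by rw [hg, ← hp', ← hb', map_sub, (hex' _).2 ⟨a', rfl⟩, sub_zero])
  obtain ⟨x, rfl⟩ := hsurj c
  obtain ⟨x', rfl⟩ := hsurj' c'
  obtain ⟨y, hy⟩ := (hex (b - d x)).1 (by rw [map_sub, hp, hc, sub_self])
  obtain ⟨y', hy'⟩ := (hex' (b' - f x + d' x')).1
    (by rw [map_add, map_sub, hp', ← hc', hg]; abel)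
  refine ⟨y, y', hinj ?_, hinj' ?_⟩
  · rw [hi, hy, map_sub, hd, sub_zero, hb]
  · rw [map_sub, hk, hi', hy, hy', map_add, hd', add_zero, map_sub, map_sub, ← hb', hf]; abel

/-- In a short exact sequence `0 → R → V → U → 0` of differential groups, if `V → U` is a
quasi-isomorphism, then `R` is acyclic. -/
theorem QuasiIsoDG.ker_acyclic {R U : Type*} [AddCommGroup R] [AddCommGroup U] {r : R →+ R}
    {e : U →+ U} {i : R →+ V} {p : V →+ U} (hd : ∀ a, d (d a) = 0)
    (hi : ∀ a, i (r a) = d (i a)) (hp : ∀ a, p (d a) = e (p a)) (hinj : Function.Injective i)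
    (hex : ∀ a, p a = 0 ↔ ∃ b, i b = a) (hsurj : Function.Surjective p)
    (h : QuasiIsoDG d e p) (a : R) (ha : r a = 0) : ∃ b, r b = a := by
  obtain ⟨b, c, hb, hc⟩ := h (i a) 0 (by rw [← hi, ha, map_zero])
    (by rw [(hex _).2 ⟨a, rfl⟩, map_zero])
  obtain ⟨x, rfl⟩ := hsurj c
  obtain ⟨y, hy⟩ := (hex (b - d x)).1 (by rw [map_sub, hp, ← hc]; abel)
  exact ⟨y, hinj (by rw [hi, hy, map_sub, hd, sub_zero, hb])⟩

/-- A filtered map of differential groups with finite filtrations is a quasi-isomorphism if it is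
one on the graded pieces. -/
theorem QuasiIsoDG.of_filtration {f : V →+ V'} (F : ℕ → AddSubgroup V) (F' : ℕ → AddSubgroup V')
    (m : ℕ) (h0 : F 0 = ⊤) (h0' : F' 0 = ⊤) (hm : F m = ⊥) (hm' : F' m = ⊥)
    (hd : ∀ a, d (d a) = 0) (hd' : ∀ a, d' (d' a) = 0) (hf : ∀ a, f (d a) = d' (f a))
    (h : ∀ j a a', a ∈ F j → a' ∈ F' j → d a ∈ F (j + 1) → f a - d' a' ∈ F' (j + 1) →
      ∃ b b', b ∈ F j ∧ b' ∈ F' j ∧ a - d b ∈ F (j + 1) ∧ a' - f b + d' b' ∈ F' (j + 1)) :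
    QuasiIsoDG d d' f := by
  have key : ∀ k j, k + j = m → ∀ a a', a ∈ F j → a' ∈ F' j → d a = 0 → f a = d' a' →
      ∃ b b', d b = a ∧ f b - a' = d' b' := by
    intro k
    induction k with
    | zero =>
      intro j hj a a' ha ha' _ _
      obtain rfl : j = m := by omega
      rw [hm, AddSubgroup.mem_bot] at ha
      rw [hm', AddSubgroup.mem_bot] at ha'
      exact ⟨0, 0, by simp [ha], by simp [ha']⟩
    | succ k ih =>
      intro j hj a a' ha ha' hda hfa
      obtain ⟨b, b', -, -, h₁, h₂⟩ := h j a a' ha ha' (by rw [hda]; exact zero_mem _)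
        (by rw [hfa, sub_self]; exact zero_mem _)
      obtain ⟨c, c', hc, hc'⟩ := ih (j + 1) (by omega) _ _ h₁ h₂
        (by rw [map_sub, hda, hd, sub_zero])
        (by rw [map_sub, map_add, map_sub, hd', add_zero, hfa, hf])
      refine ⟨b + c, b' + c', by rw [map_add, hc]; abel, ?_⟩
      rw [map_add, map_add, ← hc']
      abel
  intro a a' ha ha'
  exact key m 0 rfl a a' (h0 ▸ AddSubgroup.mem_top _) (h0' ▸ AddSubgroup.mem_top _) ha ha'

end DifferentialGroups

/-! ### Totalization of double complexes -/

section Totalization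

variable {R : ℕ → Type*} [∀ n, AddCommGroup (R n)]

/-- The differential on `∏ n, R n` given by a sequence of maps `R n → R (n + 1)`. -/
def seqD (v : ∀ n, R n →+ R (n + 1)) : (∀ n, R n) →+ (∀ n, R n) where
  toFun a n := match n with
    | 0 => 0
    | n + 1 => v n (a n)
  map_zero' := by
    funext n
    cases n <;> simp
  map_add' a b := by
    funext n
    cases n <;> simp

@[simp]
theorem seqD_zero (v : ∀ n, R n →+ R (n + 1)) (a : ∀ n, R n) : seqD v a 0 = 0 := rfl

@[simp]
theorem seqD_succ (v : ∀ n, R n →+ R (n + 1)) (a : ∀ n, R n) (n : ℕ) :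
    seqD v a (n + 1) = v n (a n) := rfl

theorem seqD_seqD {v : ∀ n, R n →+ R (n + 1)} (hv : ∀ n a, v (n + 1) (v n a) = 0)
    (a : ∀ n, R n) : seqD v (seqD v a) = 0 := by
  funext n
  match n with
  | 0 => rfl
  | 1 => simp
  | n + 2 => simp [hv]

/-- The total differential on `∏ n, R n`, for a sequence `R 0 → R 1 → ⋯` of differential groups. -/
def totD (d : ∀ n, R n →+ R n) (v : ∀ n, R n →+ R (n + 1)) : (∀ n, R n) →+ (∀ n, R n) where
  toFun a n := (-1 : ℤ) ^ n • d n (a n) + seqD v a n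
  map_zero' := by
    funext n
    simp
  map_add' a b := by
    funext n
    simp only [Pi.add_apply, map_add, smul_add]
    abel

theorem totD_apply (d : ∀ n, R n →+ R n) (v : ∀ n, R n →+ R (n + 1)) (a : ∀ n, R n) (n : ℕ) :
    totD d v a n = (-1 : ℤ) ^ n • d n (a n) + seqD v a n := rfl

theorem totD_totD {d : ∀ n, R n →+ R n} {v : ∀ n, R n →+ R (n + 1)}
    (hd : ∀ n a, d n (d n a) = 0) (hv : ∀ n a, v (n + 1) (v n a) = 0)
    (hdv : ∀ n a, d (n + 1) (v n a) = v n (d n a)) (a : ∀ n, R n) :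
    totD d v (totD d v a) = 0 := by
  funext n
  match n with
  | 0 => simp [totD_apply, hd]
  | 1 => simp [totD_apply, hd, hdv]
  | n + 2 => simp [totD_apply, hd, hdv, hv, pow_succ]

variable {R' : ℕ → Type*} [∀ n, AddCommGroup (R' n)]

/-- The map on products induced by maps of the factors. -/
def piMap (f : ∀ n, R n →+ R' n) : (∀ n, R n) →+ (∀ n, R' n) where
  toFun a n := f n (a n)
  map_zero' := by
    funext n
    simp
  map_add' a b := by
    funext n
    simp

@[simp]
theorem piMap_apply (f : ∀ n, R n →+ R' n) (a : ∀ n, R n) (n : ℕ) : piMap f a n = f n (a n) := rfl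

theorem piMap_seqD {v : ∀ n, R n →+ R (n + 1)} {v' : ∀ n, R' n →+ R' (n + 1)}
    {f : ∀ n, R n →+ R' n} (hfv : ∀ n a, f (n + 1) (v n a) = v' n (f n a)) (a : ∀ n, R n) :
    piMap f (seqD v a) = seqD v' (piMap f a) := by
  funext n
  cases n <;> simp [hfv]

theorem piMap_totD {d : ∀ n, R n →+ R n} {v : ∀ n, R n →+ R (n + 1)} {d' : ∀ n, R' n →+ R' n}
    {v' : ∀ n, R' n →+ R' (n + 1)} {f : ∀ n, R n →+ R' n}
    (hfd : ∀ n a, f n (d n a) = d' n (f n a))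
    (hfv : ∀ n a, f (n + 1) (v n a) = v' n (f n a)) (a : ∀ n, R n) :
    piMap f (totD d v a) = totD d' v' (piMap f a) := by
  funext n
  rw [piMap_apply, totD_apply, totD_apply, map_add, map_zsmul, hfd, ← piMap_seqD hfv]
  rfl

/-- Dependent recursion: a sequence can be chosen step by step, as long as an invariant `I` can be
maintained. -/
theorem exists_sequence {T : ℕ → Type*} (I : ∀ n, T n → Prop) (S : ∀ n, T n → T (n + 1) → Prop)
    (h0 : ∃ x, I 0 x) (h : ∀ n x, I n x → ∃ y, I (n + 1) y ∧ S n x y) :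
    ∃ x : ∀ n, T n, I 0 (x 0) ∧ ∀ n, S n (x n) (x (n + 1)) := by
  choose x₀ hx₀ using h0
  choose g hg hS using h
  let y : ∀ n, {x : T n // I n x} := fun n =>
    Nat.rec ⟨x₀, hx₀⟩ (fun n x => ⟨g n x.1 x.2, hg n x.1 x.2⟩) n
  exact ⟨fun n => (y n).1, (y 0).2, fun n => hS n _ (y n).2⟩

/-- A map of sequences of differential groups that is a quasi-isomorphism in each place is a
quasi-isomorphism on totalizations. -/
theorem QuasiIsoDG.tot {d : ∀ n, R n →+ R n} {v : ∀ n, R n →+ R (n + 1)} {d' : ∀ n, R' n →+ R' n}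
    {v' : ∀ n, R' n →+ R' (n + 1)} {f : ∀ n, R n →+ R' n}
    (hv' : ∀ n a, v' (n + 1) (v' n a) = 0)
    (hdv : ∀ n a, d (n + 1) (v n a) = v n (d n a))
    (hdv' : ∀ n a, d' (n + 1) (v' n a) = v' n (d' n a))
    (hfv : ∀ n a, f (n + 1) (v n a) = v' n (f n a)) (hv : ∀ n a, v (n + 1) (v n a) = 0)
    (h : ∀ n, QuasiIsoDG (d n) (d' n) (f n)) :
    QuasiIsoDG (totD d v) (totD d' v') (piMap f) := by
  intro a a' ha ha'
  have sgn : ∀ n : ℕ, ((-1 : ℤ) ^ n) * (-1) ^ n = 1 := fun n => by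
    rw [← mul_pow]; simp
  -- The solution is built by induction on `n`; solving at `n` only needs the equations below `n`.
  have step : ∀ n (c : R n) (c' : R' n), d n c = 0 → f n c = (-1 : ℤ) ^ n • d' n c' →
      ∃ b b', (-1 : ℤ) ^ n • d n b = c ∧ f n b - c' = (-1 : ℤ) ^ n • d' n b' := by
    intro n c c' hc hc'
    obtain ⟨b, b', hb, hb'⟩ := h n c ((-1 : ℤ) ^ n • c') hc (by rw [hc', map_zsmul])
    refine ⟨(-1 : ℤ) ^ n • b, b', by rw [map_zsmul, hb, smul_smul, sgn, one_smul], ?_⟩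
    rw [map_zsmul, ← hb', smul_sub, smul_smul, sgn, one_smul]
  have e : ∀ n, (-1 : ℤ) ^ n • d n (a n) + seqD v a n = 0 := fun n => congrFun ha n
  have e' : ∀ n, f n (a n) = (-1 : ℤ) ^ n • d' n (a' n) + seqD v' a' n := fun n => congrFun ha' n
  obtain ⟨x, hx0, hx⟩ := exists_sequence (T := fun n => R n × R' n)
    (fun n x => v n (a n) = (-1 : ℤ) ^ n • v n (d n x.1) ∧
      v' n (f n x.1 - a' n) = (-1 : ℤ) ^ n • v' n (d' n x.2) ∧
      (n = 0 → (-1 : ℤ) ^ n • d n x.1 = a n ∧ f n x.1 - a' n = (-1 : ℤ) ^ n • d' n x.2))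
    (fun n x y => (-1 : ℤ) ^ (n + 1) • d (n + 1) y.1 + v n x.1 = a (n + 1) ∧
      f (n + 1) y.1 - a' (n + 1) = (-1 : ℤ) ^ (n + 1) • d' (n + 1) y.2 + v' n x.2)
    (by
      obtain ⟨b, b', hb, hb'⟩ := step 0 (a 0) (a' 0) (by simpa using e 0) (by simpa using e' 0)
      exact ⟨⟨b, b'⟩, by rw [← hb, map_zsmul], by rw [hb', map_zsmul], fun _ => ⟨hb, hb'⟩⟩)
    (by
      rintro n ⟨b, b'⟩ ⟨h₁, h₂, -⟩
      have e₁ : d (n + 1) (a (n + 1)) = (-1 : ℤ) ^ n • v n (a n) := by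
        have := congrArg (((-1 : ℤ) ^ n) • ·) (e (n + 1))
        simp only [pow_succ, smul_add, smul_smul, seqD_succ, smul_zero] at this
        rw [← mul_assoc, sgn, one_mul, neg_one_zsmul, neg_add_eq_zero] at this
        exact this
      obtain ⟨c, c', hc, hc'⟩ := step (n + 1) (a (n + 1) - v n b) (a' (n + 1) + v' n b')
        (by rw [map_sub, e₁, h₁, smul_smul, sgn, one_smul, hdv, sub_self])
        (by
          have h₃ := h₂
          rw [map_sub, sub_eq_iff_eq_add] at h₃
          rw [map_sub, e', seqD_succ, hfv, h₃, map_add, hdv', smul_add, pow_succ]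
          simp only [mul_neg, mul_one, neg_smul]
          abel)
      refine ⟨⟨c, c'⟩, ⟨?_, ?_, by simp⟩, ?_, ?_⟩
      · rw [← map_zsmul, hc, map_sub, hv, sub_zero]
      · rw [← map_zsmul, ← hc', map_sub, map_sub, map_add, hv', add_zero]
      · rw [hc]; abel
      · rw [← hc']; abel)
  refine ⟨fun n => (x n).1, fun n => (x n).2, ?_, ?_⟩
  · funext n
    cases n with
    | zero => simpa [totD_apply] using (hx0.2.2 rfl).1
    | succ n => exact (hx n).1
  · funext n
    cases n with
    | zero => simpa [totD_apply] using (hx0.2.2 rfl).2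
    | succ n => exact (hx n).2

end Totalization

section DoubleComplex

variable {A : ℕ → ℕ → Type*} [∀ n k, AddCommGroup (A n k)] {B : ℕ → ℕ → Type*}
  [∀ n k, AddCommGroup (B n k)]

/-- The isomorphism between the two ways to totalize a double complex; it involves a sign. -/
def doubleSwap (A : ℕ → ℕ → Type*) [∀ n k, AddCommGroup (A n k)] :
    (∀ k n, A n k) ≃+ (∀ n k, A n k) where
  toFun a n k := (-1 : ℤ) ^ (n * k) • a k n
  invFun a k n := (-1 : ℤ) ^ (n * k) • a n k
  left_inv a := by
    funext k n
    simp [smul_smul, ← mul_pow]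
  right_inv a := by
    funext k n
    simp [smul_smul, ← mul_pow]
  map_add' a b := by
    funext k n
    simp [smul_add]

theorem doubleSwap_totD (dh : ∀ n k, A n k →+ A n (k + 1)) (dv : ∀ n k, A n k →+ A (n + 1) k)
    (a : ∀ k n, A n k) :
    doubleSwap A (totD (R := fun k => ∀ n, A n k) (fun k => seqD fun n => dv n k)
      (fun k => piMap fun n => dh n k) a) =
    totD (R := fun n => ∀ k, A n k) (fun n => seqD (dh n)) (fun n => piMap (dv n))
      (doubleSwap A a) := by
  funext n k
  match n, k with
  | 0, 0 => simp [totD_apply, doubleSwap]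
  | 0, k + 1 => simp [totD_apply, doubleSwap]
  | n + 1, 0 => simp [totD_apply, doubleSwap]
  | n + 1, k + 1 =>
    simp only [totD_apply, doubleSwap, AddEquiv.coe_mk, Equiv.coe_fn_mk, Pi.add_apply, seqD_succ,
      piMap_apply, Pi.smul_apply, smul_add, map_zsmul, smul_smul]
    refine (add_comm _ _).trans ?_
    have h : ∀ m : ℕ, (-1 : ℤ) ^ (m * 2) = 1 := fun m => by rw [mul_comm, pow_mul]; simp
    congr 2
    · ring_nf
    · ring_nf
      simp [h]

/-- A map of double complexes that is a quasi-isomorphism on each column is a quasi-isomorphism on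
totalizations. -/
theorem QuasiIsoDG.tot_of_columns {dh : ∀ n k, A n k →+ A n (k + 1)}
    {dv : ∀ n k, A n k →+ A (n + 1) k} {eh : ∀ n k, B n k →+ B n (k + 1)}
    {ev : ∀ n k, B n k →+ B (n + 1) k} {f : ∀ n k, A n k →+ B n k}
    (hh : ∀ n k a, dh n (k + 1) (dh n k a) = 0) (hh' : ∀ n k a, eh n (k + 1) (eh n k a) = 0)
    (hc : ∀ n k a, dh (n + 1) k (dv n k a) = dv n (k + 1) (dh n k a))
    (hc' : ∀ n k a, eh (n + 1) k (ev n k a) = ev n (k + 1) (eh n k a))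
    (hfh : ∀ n k a, f n (k + 1) (dh n k a) = eh n k (f n k a))
    (h : ∀ k, QuasiIsoDG (seqD fun n => dv n k) (seqD fun n => ev n k) (piMap fun n => f n k)) :
    QuasiIsoDG (totD (R := fun n => ∀ k, A n k) (fun n => seqD (dh n)) (fun n => piMap (dv n)))
      (totD (R := fun n => ∀ k, B n k) (fun n => seqD (eh n)) (fun n => piMap (ev n)))
      (piMap fun n => piMap (f n)) := by
  refine QuasiIsoDG.of_equiv (doubleSwap A) (doubleSwap B) (doubleSwap_totD dh dv)
    (doubleSwap_totD eh ev) ?_ (QuasiIsoDG.tot (f := fun k => piMap fun n => f n k)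
      ?_ ?_ ?_ ?_ ?_ h)
  · intro a
    funext n k
    simp [doubleSwap]
  · intro k a
    funext n
    simp [hh']
  · intro k a
    funext n
    cases n <;> simp [hc]
  · intro k a
    funext n
    cases n <;> simp [hc']
  · intro k a
    funext n
    simp [hfh]
  · intro k a
    funext n
    simp [hh]

end DoubleComplex

/-! ### Cohomology in terms of cochains -/

section Classes

variable (K : CochainComplex AddCommGrpCat.{u} ℕ)

theorem iCycles_injective (n : ℕ) : Function.Injective (K.iCycles n).hom :=
  (AddCommGrpCat.mono_iff_injective _).1 inferInstance

/-- A cocycle, as an element of the kernel object `K.cycles n`. -/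
def cocycleMk {n : ℕ} (a : K.X n) (ha : (K.d n (n + 1)).hom a = 0) : K.cycles n :=
  (K.sc n).abCyclesIso.inv ⟨a, by
    have h : (ComplexShape.up ℕ).next n = n + 1 := by simp
    change (K.d n ((ComplexShape.up ℕ).next n)).hom a = 0
    rw [h, ha]⟩

theorem iCycles_cocycleMk {n : ℕ} (a : K.X n) (ha : (K.d n (n + 1)).hom a = 0) :
    (K.iCycles n).hom (cocycleMk K a ha) = a :=
  (K.sc n).abCyclesIso_inv_apply_iCycles _

/-- The cohomology class of a cocycle. -/
def cohomologyClass {n : ℕ} (a : K.X n) (ha : (K.d n (n + 1)).hom a = 0) : K.homology n :=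
  (K.homologyπ n).hom (cocycleMk K a ha)

variable {K}

theorem exists_cohomologyClass {n : ℕ} (x : K.homology n) :
    ∃ (a : K.X n) (ha : (K.d n (n + 1)).hom a = 0), cohomologyClass K a ha = x := by
  obtain ⟨z, rfl⟩ := (AddCommGrpCat.epi_iff_surjective (K.homologyπ n)).1 inferInstance x
  refine ⟨(K.iCycles n).hom z, ?_, ?_⟩
  · exact ConcreteCategory.congr_hom (K.iCycles_d n (n + 1)) z
  · refine congrArg (K.homologyπ n).hom (iCycles_injective _ n ?_)
    exact iCycles_cocycleMk _ _ _

theorem cohomologyClass_eq_zero_iff {n : ℕ} (a : K.X n) (ha : (K.d n (n + 1)).hom a = 0) :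
    cohomologyClass K a ha = 0 ↔
      ∃ b, (K.d ((ComplexShape.up ℕ).prev n) n).hom b = a := by
  have hi : ∀ z, (K.iCycles n).hom z = a → z = cocycleMk K a ha :=
    fun z hz => iCycles_injective _ n (hz.trans (iCycles_cocycleMk K a ha).symm)
  have hex : (ShortComplex.mk (K.sc n).toCycles (K.sc n).homologyπ (by simp)).Exact :=
    ShortComplex.exact_of_g_is_cokernel _ (K.sc n).homologyIsCokernel
  rw [ShortComplex.ab_exact_iff] at hex
  constructor
  · intro h
    obtain ⟨b, hb⟩ := hex _ h
    refine ⟨b, ?_⟩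
    have h₁ : (K.sc n).toCycles ≫ (K.sc n).iCycles = (K.sc n).f := (K.sc n).toCycles_i
    refine (ConcreteCategory.congr_hom h₁ b).symm.trans ?_
    refine (congrArg (K.sc n).iCycles.hom hb).trans ?_
    exact iCycles_cocycleMk _ _ _
  · rintro ⟨b, hb⟩
    have h₁ : (K.sc n).toCycles ≫ (K.sc n).iCycles = (K.sc n).f := (K.sc n).toCycles_i
    have h₂ := hi ((K.sc n).toCycles.hom b) ((ConcreteCategory.congr_hom h₁ b).trans hb)
    unfold cohomologyClass
    rw [← h₂]
    exact ConcreteCategory.congr_hom (show (K.sc n).toCycles ≫ (K.sc n).homologyπ = 0 by simp) b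

theorem map_cohomologyClass {L : CochainComplex AddCommGrpCat.{u} ℕ} (f : K ⟶ L) {n : ℕ}
    (a : K.X n) (ha : (K.d n (n + 1)).hom a = 0) (ha' : (L.d n (n + 1)).hom ((f.f n).hom a) = 0) :
    (HomologicalComplex.homologyMap f n).hom (cohomologyClass K a ha) =
      cohomologyClass L ((f.f n).hom a) ha' := by
  unfold cohomologyClass
  refine (ConcreteCategory.congr_hom (HomologicalComplex.homologyπ_naturality f n) _).trans ?_
  refine congrArg (L.homologyπ n).hom (iCycles_injective _ n ?_)
  refine (ConcreteCategory.congr_hom (HomologicalComplex.cyclesMap_i f n) _).trans ?_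
  refine (congrArg (f.f n).hom (iCycles_cocycleMk K _ _)).trans ?_
  exact (iCycles_cocycleMk L _ _).symm

theorem cohomologyClass_sub {n : ℕ} (a b : K.X n) (ha : (K.d n (n + 1)).hom a = 0)
    (hb : (K.d n (n + 1)).hom b = 0) (hab : (K.d n (n + 1)).hom (a - b) = 0) :
    cohomologyClass K (a - b) hab = cohomologyClass K a ha - cohomologyClass K b hb := by
  unfold cohomologyClass
  rw [← map_sub]
  refine congrArg (K.homologyπ n).hom (iCycles_injective _ n ?_)
  refine (iCycles_cocycleMk K _ _).trans ?_
  refine Eq.trans ?_ (map_sub (K.iCycles n).hom _ _).symm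
  exact congrArg₂ (· - ·) (iCycles_cocycleMk K _ _).symm
    (iCycles_cocycleMk K _ _).symm

/-- A sequence of cochains is a coboundary if and only if each term is. -/
theorem exists_seqD_eq_iff (a : ∀ n, K.X n) :
    (∃ b, seqD (fun n => (K.d n (n + 1)).hom) b = a) ↔
      ∀ n, ∃ b, (K.d ((ComplexShape.up ℕ).prev n) n).hom b = a n := by
  have h0 : ∀ b, (K.d ((ComplexShape.up ℕ).prev 0) 0).hom b = 0 := fun b => by
    rw [K.shape _ _ (by simp)]
    rfl
  have hs : ∀ n, (ComplexShape.up ℕ).prev (n + 1) = n := fun n => by simp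
  constructor
  · rintro ⟨b, rfl⟩ n
    cases n with
    | zero => exact ⟨0, map_zero _⟩
    | succ n =>
      rw [hs]
      exact ⟨b n, rfl⟩
  · intro h
    have h' : ∀ n, ∃ b, (K.d n (n + 1)).hom b = a (n + 1) := fun n => by
      have := h (n + 1)
      rwa [hs] at this
    choose b hb using h'
    refine ⟨b, funext fun n => ?_⟩
    cases n with
    | zero =>
      obtain ⟨c, hc⟩ := h 0
      rw [← hc, h0]
      rfl
    | succ n => exact hb n

/-- The differential groups of cochains detect quasi-isomorphisms. -/
theorem isIso_homologyMap_iff {L : CochainComplex AddCommGrpCat.{u} ℕ} (f : K ⟶ L) :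
    (∀ n, IsIso (HomologicalComplex.homologyMap f n)) ↔
      QuasiIsoDG (seqD fun n => (K.d n (n + 1)).hom) (seqD fun n => (L.d n (n + 1)).hom)
        (piMap fun n => (f.f n).hom) := by
  have hcomm : ∀ n a, (f.f (n + 1)).hom ((K.d n (n + 1)).hom a) =
      (L.d n (n + 1)).hom ((f.f n).hom a) := fun n a =>
    (ConcreteCategory.congr_hom (f.comm n (n + 1)) a).symm
  have hd : ∀ n a, seqD (fun n => (K.d n (n + 1)).hom) a = 0 → (K.d n (n + 1)).hom (a n) = 0 :=
    fun n a ha => congrFun ha (n + 1)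
  rw [quasiIsoDG_iff (piMap_seqD hcomm)]
  constructor
  · intro h
    have hbij : ∀ n, Function.Bijective (HomologicalComplex.homologyMap f n).hom := fun n =>
      ConcreteCategory.bijective_of_isIso (HomologicalComplex.homologyMap f n)
    constructor
    · rintro a ha ⟨a', ha'⟩
      rw [exists_seqD_eq_iff]
      intro n
      rw [← cohomologyClass_eq_zero_iff (a n) (hd n a ha)]
      refine (hbij n).1 ?_
      have h' : (L.d n (n + 1)).hom ((f.f n).hom (a n)) = 0 := by rw [← hcomm, hd n a ha, map_zero]
      rw [map_cohomologyClass f _ _ h', map_zero, cohomologyClass_eq_zero_iff]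
      exact (exists_seqD_eq_iff _).1 ⟨a', ha'.symm⟩ n
    · intro a' ha'
      have h₁ : ∀ n, ∃ (a : K.X n), (K.d n (n + 1)).hom a = 0 ∧
          ∃ b, (L.d ((ComplexShape.up ℕ).prev n) n).hom b = (f.f n).hom a - a' n := by
        intro n
        have hn : (L.d n (n + 1)).hom (a' n) = 0 := congrFun ha' (n + 1)
        obtain ⟨x, hx⟩ := (hbij n).2 (cohomologyClass L (a' n) hn)
        obtain ⟨a, ha, rfl⟩ := exists_cohomologyClass x
        have h' : (L.d n (n + 1)).hom ((f.f n).hom a) = 0 := by rw [← hcomm, ha, map_zero]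
        refine ⟨a, ha, ?_⟩
        rw [← cohomologyClass_eq_zero_iff _ (by rw [map_sub, h', hn, sub_zero]),
          cohomologyClass_sub _ _ h' hn, ← map_cohomologyClass f a ha h', hx, sub_self]
      choose a ha hb using h₁
      obtain ⟨b, hb⟩ := (exists_seqD_eq_iff (K := L) (fun n => (f.f n).hom (a n) - a' n)).2 hb
      refine ⟨a, ?_, b, hb.symm⟩
      funext n
      cases n with
      | zero => rfl
      | succ n => exact ha n
  · rintro ⟨h₁, h₂⟩ n
    have hsingle : ∀ (M : CochainComplex AddCommGrpCat.{u} ℕ) (x : M.X n),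
        (M.d n (n + 1)).hom x = 0 → seqD (fun n => (M.d n (n + 1)).hom) (Pi.single n x) = 0 := by
      intro M x hx
      funext m
      cases m with
      | zero => rfl
      | succ m =>
        rw [seqD_succ]
        by_cases hm : m = n
        · subst hm
          simpa using hx
        · simp [Pi.single_eq_of_ne hm]
    have hpi : ∀ x, piMap (fun n => (f.f n).hom) (Pi.single n x) =
        Pi.single n ((f.f n).hom x) := by
      intro x
      funext m
      by_cases hm : m = n
      · subst hm
        simp
      · simp [Pi.single_eq_of_ne hm]
    have : Function.Bijective (HomologicalComplex.homologyMap f n).hom := by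
      constructor
      · rw [injective_iff_map_eq_zero]
        intro x hx
        obtain ⟨a, ha, rfl⟩ := exists_cohomologyClass x
        have h' : (L.d n (n + 1)).hom ((f.f n).hom a) = 0 := by rw [← hcomm, ha, map_zero]
        rw [map_cohomologyClass f _ _ h', cohomologyClass_eq_zero_iff] at hx
        obtain ⟨b, hb⟩ := h₁ (Pi.single n a) (hsingle K a ha) (by
          obtain ⟨c, hc⟩ := (exists_seqD_eq_iff (K := L) (Pi.single n ((f.f n).hom a))).2
            (fun m => by
              by_cases hm : m = n
              · subst hm
                simpa using hx
              · exact ⟨0, by rw [map_zero, Pi.single_eq_of_ne hm]⟩)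
          exact ⟨c, by rw [hc, hpi]⟩)
        rw [cohomologyClass_eq_zero_iff]
        simpa using (exists_seqD_eq_iff _).1 ⟨b, hb⟩ n
      · intro y
        obtain ⟨a', ha', rfl⟩ := exists_cohomologyClass y
        obtain ⟨a, ha, b', hb'⟩ := h₂ (Pi.single n a') (hsingle L a' ha')
        have h' : (L.d n (n + 1)).hom ((f.f n).hom (a n)) = 0 := by
          rw [← hcomm, hd n a ha, map_zero]
        refine ⟨cohomologyClass K (a n) (hd n a ha), ?_⟩
        rw [map_cohomologyClass f _ _ h', ← sub_eq_zero,
          ← cohomologyClass_sub _ _ _ _ (by rw [map_sub, h', ha', sub_zero]),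
          cohomologyClass_eq_zero_iff]
        have := (exists_seqD_eq_iff _).1 ⟨b', hb'.symm⟩ n
        simpa using this
    exact (ConcreteCategory.isIso_iff_bijective _).2 this

end Classes

/-! ### Cochains of simplicial objects -/

section Cochains

open Simplicial

variable {C : Type*} [Category* C] (F F' : Cᵒᵖ ⥤ AddCommGrpCat.{u})

/-- The value of a contravariant functor on a morphism, as a homomorphism of groups. -/
def pullbackHom {S T : C} (f : S ⟶ T) : F.obj (op T) →+ F.obj (op S) := (F.map f.op).hom

theorem pullbackHom_id (S : C) (a : F.obj (op S)) : pullbackHom F (𝟙 S) a = a := by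
  simp [pullbackHom]

theorem pullbackHom_comp {S T R : C} (f : S ⟶ T) (g : T ⟶ R) (a : F.obj (op R)) :
    pullbackHom F (f ≫ g) a = pullbackHom F f (pullbackHom F g a) := by
  simp [pullbackHom]

/-- The alternating sum of the cofaces: the coboundary of the cochains obtained by applying `F` to
the simplicial object `X`. -/
def coface (X : SimplicialObject C) (n : ℕ) : F.obj (op (X _⦋n⦌)) →+ F.obj (op (X _⦋n + 1⦌)) :=
  ∑ i : Fin (n + 2), (-1 : ℤ) ^ (i : ℕ) • pullbackHom F (X.δ i)

theorem coface_apply (X : SimplicialObject C) (n : ℕ) (a : F.obj (op (X _⦋n⦌))) :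
    coface F X n a = ∑ i : Fin (n + 2), (-1 : ℤ) ^ (i : ℕ) • pullbackHom F (X.δ i) a := by
  simp [coface, AddMonoidHom.finsetSum_apply]

/-- The differential on the product of the cochains in all degrees. -/
def cochainD (X : SimplicialObject C) :
    (∀ n : ℕ, F.obj (op (X _⦋n⦌))) →+ (∀ n : ℕ, F.obj (op (X _⦋n⦌))) :=
  seqD fun n => coface F X n

/-- The map on cochains induced by a map of simplicial objects. -/
def cochainMap {X Y : SimplicialObject C} (f : X ⟶ Y) :
    (∀ n : ℕ, F.obj (op (Y _⦋n⦌))) →+ (∀ n : ℕ, F.obj (op (X _⦋n⦌))) :=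
  piMap fun n => pullbackHom F (f.app (op ⦋n⦌))

/-- The cochain complex whose cohomology is `cohomologyWith F`. -/
def cochainComplexWith : (SimplicialObject C)ᵒᵖ ⥤ CochainComplex AddCommGrpCat.{u} ℕ :=
  (simplicialCosimplicialEquiv C).functor ⋙ (CosimplicialObject.whiskering _ _).obj F ⋙
    AlgebraicTopology.alternatingCofaceMapComplex _

theorem cochainComplexWith_d (X : SimplicialObject C) (n : ℕ) :
    (((cochainComplexWith F).obj (op X)).d n (n + 1)).hom = coface F X n := by
  have h : ((cochainComplexWith F).obj (op X)).d n (n + 1) =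
      AlgebraicTopology.AlternatingCofaceMapComplex.objD
        (((simplicialCosimplicialEquiv C).functor ⋙
          (CosimplicialObject.whiskering _ _).obj F).obj (op X)) n :=
    CochainComplex.of_d _ (AlgebraicTopology.AlternatingCofaceMapComplex.objD _) n
  rw [h]
  simp only [AlgebraicTopology.AlternatingCofaceMapComplex.objD, coface]
  exact map_sum AddCommGrpCat.homAddEquiv _ _

theorem coface_coface (X : SimplicialObject C) (n : ℕ) (a : F.obj (op (X _⦋n⦌))) :
    coface F X (n + 1) (coface F X n a) = 0 := by
  rw [← cochainComplexWith_d, ← cochainComplexWith_d]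
  exact ConcreteCategory.congr_hom
    (((cochainComplexWith F).obj (op X)).d_comp_d n (n + 1) (n + 2)) a

theorem cochainD_cochainD (X : SimplicialObject C) (a : ∀ n : ℕ, F.obj (op (X _⦋n⦌))) :
    cochainD F X (cochainD F X a) = 0 :=
  seqD_seqD (coface_coface F X) a

theorem coface_natural {X Y : SimplicialObject C} (f : X ⟶ Y) (n : ℕ) (a : F.obj (op (Y _⦋n⦌))) :
    pullbackHom F (f.app (op ⦋n + 1⦌)) (coface F Y n a) =
      coface F X n (pullbackHom F (f.app (op ⦋n⦌)) a) := by
  rw [coface_apply, coface_apply, map_sum]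
  refine Finset.sum_congr rfl fun i _ => ?_
  rw [map_zsmul, ← pullbackHom_comp, ← pullbackHom_comp]
  congr 3
  exact (f.naturality (SimplexCategory.δ i).op).symm

theorem cochainMap_cochainD {X Y : SimplicialObject C} (f : X ⟶ Y)
    (a : ∀ n : ℕ, F.obj (op (Y _⦋n⦌))) :
    cochainMap F f (cochainD F Y a) = cochainD F X (cochainMap F f a) :=
  piMap_seqD (coface_natural F f) a

theorem cochainMap_comp {X Y Z : SimplicialObject C} (f : X ⟶ Y) (g : Y ⟶ Z)
    (a : ∀ n : ℕ, F.obj (op (Z _⦋n⦌))) :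
    cochainMap F (f ≫ g) a = cochainMap F f (cochainMap F g a) := by
  funext n
  exact pullbackHom_comp F _ _ _

variable {F F'}

theorem pullbackHom_app (α : F ⟶ F') {S T : C} (f : S ⟶ T) (a : F.obj (op T)) :
    (α.app (op S)).hom (pullbackHom F f a) = pullbackHom F' f ((α.app (op T)).hom a) :=
  ConcreteCategory.congr_hom (α.naturality f.op) a

theorem coface_app (α : F ⟶ F') (X : SimplicialObject C) (n : ℕ) (a : F.obj (op (X _⦋n⦌))) :
    (α.app (op (X _⦋n + 1⦌))).hom (coface F X n a) =
      coface F' X n ((α.app (op (X _⦋n⦌))).hom a) := by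
  rw [coface_apply, coface_apply, map_sum]
  refine Finset.sum_congr rfl fun i _ => ?_
  rw [map_zsmul, pullbackHom_app]

variable (F) in
theorem isIso_cohomologyWith_iff {X Y : SimplicialObject C} (f : X ⟶ Y) :
    (∀ n, IsIso ((cohomologyWith F n).map f.op)) ↔
      QuasiIsoDG (cochainD F Y) (cochainD F X) (cochainMap F f) := by
  have h := isIso_homologyMap_iff ((cochainComplexWith F).map f.op)
  simp only [cochainComplexWith_d] at h
  exact h

/-- Whether a map of simplicial objects is a quasi-isomorphism on cochains only depends on the
coefficient functor up to isomorphism. -/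
theorem quasiIsoDG_cochainMap_of_iso (e : F ≅ F') {X Y : SimplicialObject C} (f : X ⟶ Y)
    (h : QuasiIsoDG (cochainD F Y) (cochainD F X) (cochainMap F f)) :
    QuasiIsoDG (cochainD F' Y) (cochainD F' X) (cochainMap F' f) := by
  have key : ∀ n, IsIso ((cohomologyWith F' n).map f.op) := by
    rw [← isIso_cohomologyWith_iff] at h
    intro n
    let i : cohomologyWith F n ≅ cohomologyWith F' n :=
      Functor.isoWhiskerLeft (simplicialCosimplicialEquiv C).functor
        (Functor.isoWhiskerRight ((CosimplicialObject.whiskering _ _).mapIso e)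
          (AlgebraicTopology.alternatingCofaceMapComplex _ ⋙
            HomologicalComplex.homologyFunctor _ _ n))
    exact (NatIso.isIso_map_iff i f.op).1 (h n)
  exact (isIso_cohomologyWith_iff F' f).1 key

/-- The cofaces, as faces in the opposite category of abelian groups. -/
theorem unop_objD_whiskering (F : Cᵒᵖ ⥤ AddCommGrpCat.{u}) (X : SimplicialObject C) (n : ℕ) :
    (AlgebraicTopology.AlternatingFaceMapComplex.objD
      (((SimplicialObject.whiskering _ _).obj F.rightOp).obj X) n).unop.hom = coface F X n := by
  simp only [AlgebraicTopology.AlternatingFaceMapComplex.objD, coface]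
  rw [unop_sum]
  simp only [unop_zsmul]
  exact map_sum AddCommGrpCat.homAddEquiv _ _

/-- A simplicial homotopy induces a homotopy on cochains. -/
theorem exists_cochain_homotopy (F : Cᵒᵖ ⥤ AddCommGrpCat.{u}) {X Y : SimplicialObject C}
    {f g : X ⟶ Y} (H : SimplicialObject.Homotopy f g) :
    ∃ s : (∀ n : ℕ, F.obj (op (Y _⦋n⦌))) →+ (∀ n : ℕ, F.obj (op (X _⦋n⦌))),
      ∀ a, cochainMap F g a - cochainMap F f a = cochainD F X (s a) + s (cochainD F Y a) := by
  let T := (H.whiskerRight F.rightOp).toChainHomotopy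
  let t : ∀ n : ℕ, F.obj (op (Y _⦋n + 1⦌)) →+ F.obj (op (X _⦋n⦌)) := fun n =>
    (T.hom n (n + 1)).unop.hom
  have h0 : ∀ a, pullbackHom F (f.app (op ⦋0⦌)) a = t 0 (coface F Y 0 a) +
      pullbackHom F (g.app (op ⦋0⦌)) a := by
    intro a
    have h := T.comm 0
    rw [prevD_eq (j' := 1) (w := by simp), dNext_eq_zero _ _ (by simp), zero_add,
      AlgebraicTopology.alternatingFaceMapComplex_obj_d] at h
    have h' := ConcreteCategory.congr_hom (congrArg Quiver.Hom.unop h) a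
    rw [← unop_objD_whiskering]
    exact h'
  have hs : ∀ n a, pullbackHom F (f.app (op ⦋n + 1⦌)) a = coface F X n (t n a) +
      t (n + 1) (coface F Y (n + 1) a) + pullbackHom F (g.app (op ⦋n + 1⦌)) a := by
    intro n a
    have h := T.comm (n + 1)
    rw [dNext_eq (i' := n) (w := by simp), prevD_eq (j' := n + 2) (w := by simp),
      AlgebraicTopology.alternatingFaceMapComplex_obj_d,
      AlgebraicTopology.alternatingFaceMapComplex_obj_d] at h
    have h' := ConcreteCategory.congr_hom (congrArg Quiver.Hom.unop h) a
    rw [← unop_objD_whiskering, ← unop_objD_whiskering]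
    exact h'
  refine ⟨-{ toFun := fun a n => t n (a (n + 1))
             map_zero' := by funext n; simp
             map_add' := fun a b => by funext n; simp }, fun a => funext fun n => ?_⟩
  cases n with
  | zero =>
    change pullbackHom F _ _ - pullbackHom F _ _ = 0 + -(t 0 (coface F Y 0 (a 0)))
    rw [h0]
    abel
  | succ n =>
    change pullbackHom F _ _ - pullbackHom F _ _ = coface F X n (-(t n (a (n + 1)))) +
      -(t (n + 1) (coface F Y (n + 1) (a (n + 1))))
    rw [hs, map_neg]
    abel

end Cochains

/-! ### Duality with `ℚ/ℤ` -/

section Duality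

open Simplicial

variable {C : Type*} [Category* C]

/-- The group `ℚ/ℤ`. -/
def ratCircle : AddCommGrpCat.{u} := AddCommGrpCat.of (ULift.{u} (AddCircle (1 : ℚ)))

/-- The dual `Hom(F(-), ℚ/ℤ)` of a covariant functor to abelian groups. -/
def dualFunctor (F : C ⥤ AddCommGrpCat.{u}) : Cᵒᵖ ⥤ AddCommGrpCat.{u} :=
  F.op ⋙ preadditiveYoneda.obj ratCircle

instance : Injective ratCircle.{u} := by
  have : DivisibleBy (ULift.{u} (AddCircle (1 : ℚ))) ℤ :=
    { div := fun x n => ⟨DivisibleBy.div x.down n⟩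
      div_zero := fun x => by
        rw [DivisibleBy.div_zero]
        rfl
      div_cancel := fun {n} x hn => by
        ext
        exact DivisibleBy.div_cancel x.down hn }
  exact AddCommGrpCat.injective_of_divisible _

instance : (preadditiveYoneda.obj ratCircle.{u}).Faithful where
  map_injective {A B} f g h := by
    apply Quiver.Hom.unop_inj
    ext x
    rw [← sub_eq_zero]
    refine CharacterModule.eq_zero_of_character_apply fun c => ?_
    let c' : (A.unop : AddCommGrpCat.{u}) ⟶ ratCircle :=
      AddCommGrpCat.ofHom (AddEquiv.ulift.symm.toAddMonoidHom.comp c)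
    have h' : f.unop ≫ c' = g.unop ≫ c' := ConcreteCategory.congr_hom h c'
    rw [map_sub, sub_eq_zero]
    exact congrArg ULift.down (ConcreteCategory.congr_hom h' x)

instance : (preadditiveYoneda.obj ratCircle.{u}).PreservesHomology := by
  have := (Injective.injective_iff_preservesEpimorphisms_preadditiveYoneda_obj
    ratCircle.{u}).mp inferInstance
  apply Functor.preservesHomology_of_preservesEpis_and_kernels

theorem objD_comp (F : C ⥤ AddCommGrpCat.{u}) (Z : SimplicialObject C) (n : ℕ)
    (x : F.obj (Z _⦋n⦌) ⟶ ratCircle) :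
    AlgebraicTopology.AlternatingFaceMapComplex.objD
      (((SimplicialObject.whiskering C AddCommGrpCat).obj F).obj Z) n ≫ x =
        coface (dualFunctor F) Z n x := by
  refine (Preadditive.sum_comp _ _ _).trans
    (Eq.trans ?_ (coface_apply (dualFunctor F) Z n x).symm)
  exact Finset.sum_congr rfl fun i _ => Preadditive.zsmul_comp _ _ _

/-- Because `ℚ/ℤ` is an injective cogenerator, a map induces isomorphisms on homology if and only
if the dual map is a quasi-isomorphism on cochains. -/
theorem isIso_homologyWith_iff (F : C ⥤ AddCommGrpCat.{u}) {X Y : SimplicialObject C}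
    (f : X ⟶ Y) :
    (∀ n, IsIso ((homologyWith F n).map f)) ↔
      QuasiIsoDG (cochainD (dualFunctor F) Y) (cochainD (dualFunctor F) X)
        (cochainMap (dualFunctor F) f) := by
  let φ := ((SimplicialObject.whiskering _ _).obj F ⋙
    AlgebraicTopology.alternatingFaceMapComplex _).map f
  have h₁ : (∀ n, IsIso ((homologyWith F n).map f)) ↔ QuasiIso φ := by
    simp only [quasiIso_iff, quasiIsoAt_iff_isIso_homologyMap]
    rfl
  rw [h₁, ← HomologicalComplex.quasiIso_opFunctor_map_iff,
    ← HomologicalComplex.quasiIso_map_iff_of_preservesHomology _ (preadditiveYoneda.obj ratCircle)]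
  simp only [quasiIso_iff, quasiIsoAt_iff_isIso_homologyMap]
  let ψ := ((preadditiveYoneda.obj ratCircle.{u}).mapHomologicalComplex _).map
    ((HomologicalComplex.opFunctor _ _).map φ.op)
  have h₂ := isIso_homologyMap_iff ψ
  refine h₂.trans ?_
  have hd : ∀ (Z : SimplicialObject C) n,
      ((((preadditiveYoneda.obj ratCircle.{u}).mapHomologicalComplex _).obj
        ((HomologicalComplex.opFunctor _ _).obj (op (((SimplicialObject.whiskering _ _).obj F ⋙
          AlgebraicTopology.alternatingFaceMapComplex _).obj Z)))).d n (n + 1)).hom =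
      coface (dualFunctor F) Z n := by
    intro Z n
    refine AddMonoidHom.ext fun x => ?_
    refine Eq.trans ?_ (objD_comp F Z n x)
    exact congrArg (· ≫ (x : F.obj (Z _⦋n⦌) ⟶ ratCircle))
      (AlgebraicTopology.alternatingFaceMapComplex_obj_d _ n)
  simp only [ψ, hd]
  rfl

end Duality

/-! ### Eilenberg-MacLane spaces and weak equivalences -/

section Kan

open Simplicial

variable (Z : SimplicialObject AddCommGrpCat.{u})

theorem δ_δ_apply {n : ℕ} {i j : Fin (n + 2)} (h : i ≤ j) (x : Z _⦋n + 2⦌) :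
    Z.δ i (Z.δ j.succ x) = Z.δ j (Z.δ i.castSucc x) :=
  ConcreteCategory.congr_hom (Z.δ_comp_δ h) x

/-- Faces `0, …, r - 1` of a horn in a simplicial abelian group can be filled if `r` is at most
the index of the missing face. -/
theorem exists_filler_lower {n : ℕ} (i : Fin (n + 3)) (y : Fin (n + 3) → Z _⦋n + 1⦌)
    (hy : ∀ j k : Fin (n + 2), j ≤ k → j.castSucc ≠ i → k.succ ≠ i →
      Z.δ k (y j.castSucc) = Z.δ j (y k.succ)) (r : ℕ) (hr : r ≤ (i : ℕ)) :
    ∃ w : Z _⦋n + 2⦌, ∀ j : Fin (n + 3), (j : ℕ) < r → Z.δ j w = y j := by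
  induction r with
  | zero => exact ⟨0, fun j hj => absurd hj (Nat.not_lt_zero _)⟩
  | succ r ih =>
    obtain ⟨w, hw⟩ := ih (by omega)
    have hrn : r < n + 2 := by omega
    let r' : Fin (n + 2) := ⟨r, hrn⟩
    refine ⟨w - Z.σ r' (Z.δ r'.castSucc w) + Z.σ r' (y r'.castSucc), fun j hj => ?_⟩
    rw [map_add, map_sub]
    have hself : ∀ x, Z.δ r'.castSucc (Z.σ r' x) = x := fun x =>
      ConcreteCategory.congr_hom (Z.δ_comp_σ_self (i := r')) x
    rcases Nat.lt_or_ge (j : ℕ) r with hjr | hjr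
    · obtain ⟨r'', hr''⟩ : ∃ r'' : Fin (n + 1), r' = r''.succ :=
        ⟨⟨r - 1, by omega⟩, Fin.ext (by simp [r']; omega)⟩
      let j' : Fin (n + 2) := ⟨j, by omega⟩
      have hj' : j = j'.castSucc := rfl
      have hle : j' ≤ r''.castSucc := by
        have h2 := congrArg Fin.val hr''
        simp [r'] at h2
        rw [Fin.le_def]
        simp [j']
        omega
      have hsw : ∀ x, Z.δ j (Z.σ r' x) = Z.σ r'' (Z.δ j' x) := fun x => by
        rw [hr'', hj']
        exact ConcreteCategory.congr_hom (Z.δ_comp_σ_of_le hle) x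
      rw [hsw, hsw, hw j hjr]
      have e : r'.castSucc = r''.castSucc.succ := by rw [hr'']; rfl
      rw [e, δ_δ_apply Z hle, ← hj', hw j hjr, hj', hy j' r''.castSucc hle]
      · abel
      · intro h
        have := congrArg Fin.val h
        simp [j'] at this
        omega
      · rw [← e]
        intro h
        have := congrArg Fin.val h
        simp [r'] at this
        omega
    · have hj' : j = r'.castSucc := Fin.ext (by simp [r']; omega)
      rw [hj', hself, hself]
      abel

/-- The remaining faces of a horn in a simplicial abelian group can be filled from the top. -/
theorem exists_filler {n : ℕ} (i : Fin (n + 3)) (y : Fin (n + 3) → Z _⦋n + 1⦌)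
    (hy : ∀ j k : Fin (n + 2), j ≤ k → j.castSucc ≠ i → k.succ ≠ i →
      Z.δ k (y j.castSucc) = Z.δ j (y k.succ)) (r : ℕ) (hr : r + i ≤ n + 2) :
    ∃ w : Z _⦋n + 2⦌, ∀ j : Fin (n + 3), ((j : ℕ) < i ∨ n + 2 < j + r) → Z.δ j w = y j := by
  induction r with
  | zero =>
    obtain ⟨w, hw⟩ := exists_filler_lower Z i y hy i le_rfl
    exact ⟨w, fun j hj => hw j (by omega)⟩
  | succ r ih =>
    obtain ⟨w, hw⟩ := ih (by omega)
    let r' : Fin (n + 2) := ⟨n + 1 - r, by omega⟩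
    refine ⟨w - Z.σ r' (Z.δ r'.succ w) + Z.σ r' (y r'.succ), fun j hj => ?_⟩
    rw [map_add, map_sub]
    have hself : ∀ x, Z.δ r'.succ (Z.σ r' x) = x := fun x =>
      ConcreteCategory.congr_hom (Z.δ_comp_σ_succ (i := r')) x
    have hri : r'.succ ≠ i := by
      intro h
      have := congrArg Fin.val h
      simp [r'] at this
      omega
    by_cases hjr : j = r'.succ
    · rw [hjr, hself, hself]
      abel
    have hjr' : (j : ℕ) ≠ n + 2 - r := by
      intro h
      exact hjr (Fin.ext (by simp [r']; omega))
    rcases hj with hji | hjr2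
    · obtain ⟨r'', hr''⟩ : ∃ r'' : Fin (n + 1), r' = r''.succ :=
        ⟨⟨n - r, by omega⟩, Fin.ext (by simp [r']; omega)⟩
      let j' : Fin (n + 2) := ⟨j, by omega⟩
      have hj' : j = j'.castSucc := rfl
      have h2 := congrArg Fin.val hr''
      simp [r'] at h2
      have hle : j' ≤ r''.castSucc := by
        rw [Fin.le_def]
        simp [j']
        omega
      have hsw : ∀ x, Z.δ j (Z.σ r' x) = Z.σ r'' (Z.δ j' x) := fun x => by
        rw [hr'', hj']
        exact ConcreteCategory.congr_hom (Z.δ_comp_σ_of_le hle) x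
      have hle' : j' ≤ r' := by
        rw [Fin.le_def]
        simp [j', r']
        omega
      rw [hsw, hsw, hw j (Or.inl hji), δ_δ_apply Z hle', ← hj', hw j (Or.inl hji), hj',
        hy j' r' hle' _ hri]
      · abel
      · intro h
        have := congrArg Fin.val h
        simp [j'] at this
        omega
    · obtain ⟨r'', hr''⟩ : ∃ r'' : Fin (n + 1), r' = r''.castSucc :=
        ⟨⟨n + 1 - r, by omega⟩, Fin.ext (by simp [r'])⟩
      obtain ⟨j', hj'⟩ : ∃ j' : Fin (n + 2), j = j'.succ :=
        ⟨⟨j - 1, by omega⟩, Fin.ext (by simp; omega)⟩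
      have h2 := congrArg Fin.val hr''
      simp [r'] at h2
      have h3 := congrArg Fin.val hj'
      simp at h3
      have hlt : r''.castSucc < j' := by
        rw [Fin.lt_def]
        simp
        omega
      have hsw : ∀ x, Z.δ j (Z.σ r' x) = Z.σ r'' (Z.δ j' x) := fun x => by
        rw [hr'', hj']
        exact ConcreteCategory.congr_hom (Z.δ_comp_σ_of_gt hlt) x
      have hle : r''.succ ≤ j' := by
        rw [Fin.le_def]
        simp
        omega
      have e : r'.succ = r''.succ.castSucc := by rw [hr'']; rfl
      have hjw : Z.δ j w = y j := hw j (Or.inr (by omega))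
      rw [hsw, hsw, hjw, e, ← δ_δ_apply Z hle, ← hj', hjw, hj', ← hy r''.succ j' hle]
      · abel
      · rw [← e]; exact hri
      · rw [← hj']
        intro h
        have := congrArg Fin.val h
        omega

/-- The simplicial set underlying a simplicial abelian group. -/
abbrev underlyingSSet : SSet.{u} :=
  ((SimplicialObject.whiskering _ _).obj (forget AddCommGrpCat)).obj Z

/-- Simplicial abelian groups are Kan complexes (Moore). -/
instance kanComplex_underlyingSSet : SSet.KanComplex (underlyingSSet Z) := by
  rw [SSet.KanComplex.iff]
  intro n i f hf
  cases n with
  | zero =>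
    obtain ⟨j, hj, hji⟩ : ∃ j : Fin 2, j ≠ i ∧ ∀ k, k ≠ i → k = j := by
      fin_cases i
      · exact ⟨1, by simp, by intro k; fin_cases k <;> simp⟩
      · exact ⟨0, by simp, by intro k; fin_cases k <;> simp⟩
    refine ⟨SSet.stdSimplex.σ 0 ≫ f j hj, fun k hk => ?_⟩
    obtain rfl := hji k hk
    rw [← Category.assoc]
    have : SSet.stdSimplex.{u}.δ k ≫ SSet.stdSimplex.{u}.σ (0 : Fin 1) = 𝟙 _ := by
      fin_cases k
      · exact SSet.stdSimplex.{u}.δ_comp_σ_self (i := (0 : Fin 1))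
      · exact SSet.stdSimplex.{u}.δ_comp_σ_succ (i := (0 : Fin 1))
    rw [this, Category.id_comp]
  | succ n =>
    let y : Fin (n + 3) → Z _⦋n + 1⦌ := fun j =>
      if hj : j ≠ i then SSet.yonedaEquiv (f j hj) else 0
    have hyj : ∀ j hj, y j = SSet.yonedaEquiv (f j hj) := fun j hj => dif_pos hj
    obtain ⟨w, hw⟩ := exists_filler Z i y (fun j k hjk hj hk => by
      have h := hf j.castSucc k.succ hj hk (by simpa [Fin.lt_def] using Nat.lt_succ_of_le hjk)
      have h' := congrArg SSet.yonedaEquiv h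
      rw [SSet.stdSimplex.yonedaEquiv_δ_comp, SSet.stdSimplex.yonedaEquiv_δ_comp] at h'
      rw [hyj _ hj, hyj _ hk]
      exact h') (n + 2 - i) (by omega)
    refine ⟨SSet.yonedaEquiv.symm w, fun j hj => SSet.yonedaEquiv.injective ?_⟩
    rw [SSet.stdSimplex.yonedaEquiv_δ_comp, ← hyj j hj]
    let w' : (underlyingSSet Z).obj (op (SimplexCategory.mk (n + 2))) := w
    have hw' : SSet.yonedaEquiv (SSet.yonedaEquiv.symm w') = w' := Equiv.apply_symm_apply _ w'
    refine (congrArg ((underlyingSSet Z).δ j) hw').trans (hw j ?_)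
    have : (j : ℕ) ≠ i := fun h => hj (Fin.ext h)
    omega

end Kan

section EilenbergMacLane

open Simplicial MonoidalCategory

variable (M : Type u) [AddCommGroup M]

/-- The functor `S ↦ Map(S, M)`. -/
def mapFunctor : (Type u)ᵒᵖ ⥤ AddCommGrpCat.{u} where
  obj S := AddCommGrpCat.of (S.unop → M)
  map f := AddCommGrpCat.ofHom
    { toFun := fun a s => a (f.unop s)
      map_zero' := rfl
      map_add' := fun _ _ => rfl }

/-- The (inhomogeneous) cocycles of a simplicial set with coefficients in `M`, as a functor. -/
def cocycleFunctor : SSet.{u}ᵒᵖ ⥤ AddCommGrpCat.{u} where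
  obj X := AddCommGrpCat.of (cochainD (mapFunctor M) X.unop).ker
  map {Y X} f := AddCommGrpCat.ofHom
    ((cochainMap (mapFunctor M) f.unop).comp (AddSubgroup.subtype _) |>.codRestrict _ fun z => by
      rw [AddMonoidHom.mem_ker]
      refine (cochainMap_cochainD (mapFunctor M) f.unop z.1).symm.trans ?_
      rw [z.2]
      exact map_zero _)

/-- The product of the Eilenberg-MacLane spaces `K(M, n)`: its `m`-simplices are the cocycles of
`Δ[m]`, of all degrees. -/
def eilenbergMacLane : SimplicialObject AddCommGrpCat.{u} :=
  SSet.stdSimplex.op ⋙ cocycleFunctor M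

variable {M} {X Y : SSet.{u}}

/-- The map to the Eilenberg-MacLane space classifying a cocycle. -/
def classifyingMap (z : ∀ n : ℕ, (mapFunctor M).obj (op (X _⦋n⦌)))
    (hz : cochainD (mapFunctor M) X z = 0) : X ⟶ underlyingSSet (eilenbergMacLane M) where
  app m := ↾fun x => ((cocycleFunctor M).map (SSet.yonedaEquiv.symm x).op).hom ⟨z, hz⟩
  naturality m m' g := by
    ext x
    have : SSet.yonedaEquiv.symm (X.map g x) =
        SSet.stdSimplex.map g.unop ≫ SSet.yonedaEquiv.symm x :=
      (SSet.yonedaEquiv_symm_naturality_left g.unop x).symm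
    change ((cocycleFunctor M).map (SSet.yonedaEquiv.symm (X.map g x)).op).hom ⟨z, hz⟩ = _
    rw [this, op_comp, Functor.map_comp]
    rfl

/-- The universal cocycle on the Eilenberg-MacLane space. -/
def universalCocycle (n : ℕ) :
    (mapFunctor M).obj (op ((underlyingSSet (eilenbergMacLane M)) _⦋n⦌)) :=
  fun c => c.1 n (SSet.yonedaEquiv (𝟙 _))

theorem coface_mapFunctor_apply (X : SSet.{u}) (n : ℕ)
    (a : (mapFunctor M).obj (op (X _⦋n⦌))) (x : X _⦋n + 1⦌) :
    (coface (mapFunctor M) X n a : X _⦋n + 1⦌ → M) x =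
      ∑ i : Fin (n + 2), (-1 : ℤ) ^ (i : ℕ) • (a : X _⦋n⦌ → M) (X.δ i x) :=
  (congrFun (coface_apply (mapFunctor M) X n a) x).trans (Finset.sum_apply x _ _)

theorem universalCocycle_d :
    cochainD (mapFunctor M) _ (universalCocycle (M := M)) = 0 := by
  funext n
  cases n with
  | zero => rfl
  | succ n =>
    funext c
    refine (coface_mapFunctor_apply (underlyingSSet (eilenbergMacLane M)) n _ c).trans ?_
    have hc := congrFun (congrFun c.2 (n + 1)) (SSet.yonedaEquiv (𝟙 _))
    refine Eq.trans ?_ ((coface_mapFunctor_apply _ n (c.1 n) _).symm.trans hc)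
    refine Finset.sum_congr rfl fun i _ => ?_
    congr 1

theorem classifyingMap_universalCocycle (z : ∀ n : ℕ, (mapFunctor M).obj (op (X _⦋n⦌)))
    (hz : cochainD (mapFunctor M) X z = 0) :
    cochainMap (mapFunctor M) (classifyingMap z hz) universalCocycle = z := by
  funext n x
  exact congrArg (z n) (SSet.yonedaEquiv_symm_app_id x)

theorem comp_classifyingMap (f : X ⟶ Y) (z : ∀ n : ℕ, (mapFunctor M).obj (op (Y _⦋n⦌)))
    (hz : cochainD (mapFunctor M) Y z = 0)
    (hz' : cochainD (mapFunctor M) X (cochainMap (mapFunctor M) f z) = 0) :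
    f ≫ classifyingMap z hz = classifyingMap (cochainMap (mapFunctor M) f z) hz' := by
  ext m x
  refine Subtype.ext ?_
  change cochainMap (mapFunctor M) (SSet.yonedaEquiv.symm (f.app m x)) z = _
  rw [← SSet.yonedaEquiv_symm_comp, cochainMap_comp]
  rfl

theorem exists_eq_cochainD_of_homotopy {f g : X ⟶ underlyingSSet (eilenbergMacLane M)}
    (H : SSet.Homotopy f g) :
    ∃ β, cochainMap (mapFunctor M) g universalCocycle -
      cochainMap (mapFunctor M) f universalCocycle = cochainD (mapFunctor M) X β := by
  obtain ⟨s, hs⟩ := exists_cochain_homotopy (mapFunctor M) H.toSimplicialObjectHomotopy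
  refine ⟨s universalCocycle, (hs _).trans ?_⟩
  rw [universalCocycle_d, map_zero, add_zero]

open Classical in
/-- The cochain on a cylinder that agrees with `β` at the end `1` and vanishes on all simplices
that are not contained in that end. -/
def cylinderCochain (β : ∀ n : ℕ, (mapFunctor M).obj (op (X _⦋n⦌))) (n : ℕ) :
    (mapFunctor M).obj (op ((X ⊗ Δ[1] : SSet.{u}) _⦋n⦌)) :=
  fun x => if ∀ i, x.2 i = 1 then (β n : X _⦋n⦌ → M) x.1 else 0

theorem homotopy_classifyingMap {z z' β : ∀ n : ℕ, (mapFunctor M).obj (op (X _⦋n⦌))}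
    (hz : cochainD (mapFunctor M) X z = 0) (hz' : cochainD (mapFunctor M) X z' = 0)
    (h : z' - z = cochainD (mapFunctor M) X β) :
    Nonempty (SSet.Homotopy (classifyingMap z hz) (classifyingMap z' hz')) := by
  let Z := cochainMap (mapFunctor M) (SemiCartesianMonoidalCategory.fst X Δ[1]) z +
    cochainD (mapFunctor M) _ (cylinderCochain β)
  have hZ : cochainD (mapFunctor M) _ Z = 0 := by
    refine (map_add _ _ _).trans ?_
    rw [cochainD_cochainD, ← cochainMap_cochainD, hz, map_zero, add_zero]
  have e₀ : cochainMap (mapFunctor M) SSet.ι₀ Z = z := by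
    refine (map_add _ _ _).trans ?_
    rw [cochainMap_cochainD, ← cochainMap_comp]
    have h1 : cochainMap (mapFunctor M) (SSet.ι₀ : X ⟶ _) (cylinderCochain β) = 0 := by
      funext n x
      exact if_neg fun h => absurd (h 0 : (0 : Fin 2) = 1) (by decide)
    rw [h1, map_zero, add_zero]
    rfl
  have e₁ : cochainMap (mapFunctor M) SSet.ι₁ Z = z' := by
    refine (map_add _ _ _).trans ?_
    rw [cochainMap_cochainD, ← cochainMap_comp]
    have h1 : cochainMap (mapFunctor M) (SSet.ι₁ : X ⟶ _) (cylinderCochain β) = β := by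
      funext n x
      exact if_pos fun i => rfl
    rw [h1, ← h]
    exact add_sub_cancel z z'
  refine ⟨{ h := classifyingMap Z hZ, h₀ := ?_, h₁ := ?_, rel := ?_ }⟩
  · refine (comp_classifyingMap _ Z hZ (by rw [e₀, hz])).trans ?_
    congr 1
  · refine (comp_classifyingMap _ Z hZ (by rw [e₁, hz'])).trans ?_
    congr 1
  · ext m x
    exact x.1.2.elim

/-- A weak equivalence induces a quasi-isomorphism on cochains: cohomology is represented by
Eilenberg-MacLane spaces, which are Kan complexes. -/
theorem quasiIsoDG_of_isWeakEquivalence (M : Type u) [AddCommGroup M] {f : X ⟶ Y}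
    (hf : IsWeakEquivalence f) :
    QuasiIsoDG (cochainD (mapFunctor M) Y) (cochainD (mapFunctor M) X)
      (cochainMap (mapFunctor M) f) := by
  obtain ⟨h₁, h₂⟩ := hf (underlyingSSet (eilenbergMacLane M))
  rw [quasiIsoDG_iff (cochainMap_cochainD (mapFunctor M) f)]
  constructor
  · rintro b hb ⟨a, ha⟩
    have hb' : cochainD (mapFunctor M) X (cochainMap (mapFunctor M) f b) = 0 := by
      rw [← cochainMap_cochainD, hb, map_zero]
    have h0 : ∀ {X : SSet.{u}}, cochainD (mapFunctor M) X 0 = 0 := map_zero _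
    have h0' : cochainD (mapFunctor M) X (cochainMap (mapFunctor M) f 0) = 0 := by
      rw [map_zero, map_zero]
    have H := h₂ (classifyingMap 0 h0) (classifyingMap b hb) (by
      rw [comp_classifyingMap f _ _ h0', comp_classifyingMap f _ _ hb']
      exact homotopy_classifyingMap _ _ (β := a) (by rw [map_zero, sub_zero, ha]))
    obtain ⟨β, hβ⟩ := exists_eq_cochainD_of_homotopy H.some
    refine ⟨β, hβ.symm.trans ?_⟩
    rw [classifyingMap_universalCocycle, classifyingMap_universalCocycle, sub_zero]
  · intro a ha
    obtain ⟨h, ⟨H⟩⟩ := h₁ (classifyingMap a ha)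
    obtain ⟨β, hβ⟩ := exists_eq_cochainD_of_homotopy H
    refine ⟨cochainMap (mapFunctor M) h universalCocycle, ?_, -β, ?_⟩
    · rw [← cochainMap_cochainD, universalCocycle_d, map_zero]
    · rw [map_neg, ← hβ, classifyingMap_universalCocycle, cochainMap_comp, neg_sub]

end EilenbergMacLane

/-! ### Nerves of ordered sets with a group action -/

section OrderedSets

open Simplicial

variable {W : Type u} [Group W]

section

variable (E : Type u) [Preorder E] [MulAction W E] [CovariantClass W E HSMul.hSMul LE.le]

/-- The action on the chains of an ordered `W`-set. -/
instance chainAction (n : ℕ) : MulAction W (Fin (n + 1) →o E) where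
  smul w σ := ⟨fun i => w • σ i, fun _ _ h => smul_mono_right w (σ.monotone h)⟩
  one_smul σ := OrderHom.ext _ _ (funext fun i => one_smul W (σ i))
  mul_smul w w' σ := OrderHom.ext _ _ (funext fun i => mul_smul w w' (σ i))

variable (W) in
/-- The nerve of an ordered `W`-set: its `n`-simplices are the chains of length `n + 1`. -/
def orderSpace : GSpace W where
  obj n := Action.ofMulAction W (Fin (n.unop.len + 1) →o E)
  map θ :=
    { hom := ↾fun σ => σ.comp θ.unop.toOrderHom
      comm := fun _ => rfl }
  map_id _ := rfl
  map_comp _ _ := rfl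

variable {E}
variable {E' : Type u} [Preorder E'] [MulAction W E'] [CovariantClass W E' HSMul.hSMul LE.le]

/-- The map of nerves induced by an equivariant monotone map. -/
def orderSpaceMap (f : E →o E') (hf : ∀ (w : W) (x : E), f (w • x) = w • f x) :
    orderSpace W E ⟶ orderSpace W E' where
  app n :=
    { hom := ↾fun σ => f.comp σ
      comm := fun w => by
        ext σ
        change Fin (n.unop.len + 1) →o E at σ
        exact OrderHom.ext _ _ (funext fun i => hf w (σ i)) }
  naturality _ _ _ := rfl

/-- The `(n + 1)`-simplex `p σ_0 ≤ ⋯ ≤ p σ_i ≤ q σ_i ≤ ⋯ ≤ q σ_n` of a prism. -/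
def prism (p q : E →o E') (h : p ≤ q) {n : ℕ} (i : Fin (n + 1)) (σ : Fin (n + 1) →o E) :
    Fin (n + 1 + 1) →o E' where
  toFun j := if (j : ℕ) ≤ i then p (σ (i.predAbove j)) else q (σ (i.predAbove j))
  monotone' a b hab := by
    have hσ := σ.monotone (Fin.predAbove_right_monotone i hab)
    have hab' : (a : ℕ) ≤ b := hab
    beta_reduce
    split_ifs with h₁ h₂ h₂
    · exact p.monotone hσ
    · exact (h _).trans (q.monotone hσ)
    · omega
    · exact q.monotone hσ

theorem val_predAbove {n : ℕ} (i : Fin (n + 1)) (j : Fin (n + 2)) :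
    (i.predAbove j : ℕ) = if (i : ℕ) < j then (j : ℕ) - 1 else j := by
  rcases lt_or_ge i.castSucc j with h | h
  · rw [Fin.predAbove_of_castSucc_lt _ _ h, if_pos (by simpa [Fin.lt_def] using h), Fin.val_pred]
  · rw [Fin.predAbove_of_le_castSucc _ _ h, if_neg (by simpa [Fin.le_def] using h)]
    rfl

theorem val_succAbove {n : ℕ} (i : Fin (n + 2)) (j : Fin (n + 1)) :
    (i.succAbove j : ℕ) = if (j : ℕ) < i then (j : ℕ) else j + 1 := by
  grind [Fin.succAbove]

theorem ite_chain_eq {n : ℕ} (p q : E →o E') (σ : Fin (n + 1) →o E) {c c' : Prop} [Decidable c]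
    [Decidable c'] {a b : Fin (n + 1)} (hc : c ↔ c') (hab : (a : ℕ) = b) :
    (if c then p (σ a) else q (σ a)) = if c' then p (σ b) else q (σ b) := by
  rw [Fin.ext hab]
  simp only [hc]

set_option linter.unusedSimpArgs false in
/-- Comparable equivariant monotone maps induce homotopic maps of nerves. -/
def orderSpaceHomotopy (p q : E →o E') (h : p ≤ q) (hp : ∀ (w : W) (x : E), p (w • x) = w • p x)
    (hq : ∀ (w : W) (x : E), q (w • x) = w • q x) :
    SimplicialObject.Homotopy (orderSpaceMap p hp) (orderSpaceMap q hq) where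
  h i :=
    { hom := ↾fun σ => prism p q h i σ
      comm := fun w => by
        ext σ
        change Fin (_ + 1) →o E at σ
        refine OrderHom.ext _ _ (funext fun j => ?_)
        change (if _ then p (w • σ _) else q (w • σ _)) = w • (if _ then p (σ _) else q (σ _))
        split_ifs
        · exact hp _ _
        · exact hq _ _ }
  h_zero_comp_δ_zero n := by
    ext σ
    change Fin (_ + 1) →o E at σ
    refine OrderHom.ext _ _ (funext fun j => ?_)
    have h0 : ¬ ((Fin.succAbove 0 j : Fin (n + 2)) : ℕ) ≤ ((0 : Fin (n + 1)) : ℕ) := by simp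
    exact ite_chain_eq p q σ (c' := False) (b := j) (iff_of_false h0 not_false) (by
      change ((Fin.predAbove 0 (Fin.succAbove 0 j) : Fin (n + 1)) : ℕ) = j
      simp)
  h_last_comp_δ_last n := by
    ext σ
    change Fin (_ + 1) →o E at σ
    refine OrderHom.ext _ _ (funext fun j => ?_)
    refine (if_pos ?_).trans (congrArg (fun k => p (σ k)) (Fin.ext ?_))
    · change (((Fin.last (n + 1)).succAbove j : Fin (n + 2)) : ℕ) ≤ Fin.last n
      simp; omega
    · change (((Fin.last n).predAbove ((Fin.last (n + 1)).succAbove j) : Fin (n + 1)) : ℕ) = j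
      simp
  h_succ_comp_δ_castSucc_of_lt i j hij := by
    ext σ
    change Fin (_ + 1) →o E at σ
    refine OrderHom.ext _ _ (funext fun k => ite_chain_eq p q σ ?_ ?_)
    · change ((i.castSucc.succAbove k : Fin _) : ℕ) ≤ _ ↔ ((k : Fin _) : ℕ) ≤ _
      simp only [val_succAbove, val_predAbove, Fin.val_succ, Fin.val_castSucc, Fin.le_def,
        Fin.lt_def] at *
      grind
    · change ((j.succ.predAbove (i.castSucc.succAbove k) : Fin _) : ℕ) = ((i.succAbove (j.predAbove k) : Fin _) : ℕ)
      simp only [val_succAbove, val_predAbove, Fin.val_succ, Fin.val_castSucc, Fin.le_def,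
        Fin.lt_def] at *
      grind
  h_succ_comp_δ_castSucc_succ j := by
    ext σ
    change Fin (_ + 1) →o E at σ
    refine OrderHom.ext _ _ (funext fun k => ite_chain_eq p q σ ?_ ?_)
    · change ((j.castSucc.succ.succAbove k : Fin _) : ℕ) ≤ _ ↔ ((j.castSucc.succ.succAbove k : Fin _) : ℕ) ≤ _
      simp only [val_succAbove, val_predAbove, Fin.val_succ, Fin.val_castSucc, Fin.le_def,
        Fin.lt_def] at *
      grind
    · change ((j.succ.predAbove (j.castSucc.succ.succAbove k) : Fin _) : ℕ) = ((j.castSucc.predAbove (j.castSucc.succ.succAbove k) : Fin _) : ℕ)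
      simp only [val_succAbove, val_predAbove, Fin.val_succ, Fin.val_castSucc, Fin.le_def,
        Fin.lt_def] at *
      grind
  h_castSucc_comp_δ_succ_of_lt i j hij := by
    ext σ
    change Fin (_ + 1) →o E at σ
    refine OrderHom.ext _ _ (funext fun k => ite_chain_eq p q σ ?_ ?_)
    · change ((i.succ.succAbove k : Fin _) : ℕ) ≤ _ ↔ ((k : Fin _) : ℕ) ≤ _
      simp only [val_succAbove, val_predAbove, Fin.val_succ, Fin.val_castSucc, Fin.le_def,
        Fin.lt_def] at *
      grind
    · change ((j.castSucc.predAbove (i.succ.succAbove k) : Fin _) : ℕ) = ((i.succAbove (j.predAbove k) : Fin _) : ℕ)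
      simp only [val_succAbove, val_predAbove, Fin.val_succ, Fin.val_castSucc, Fin.le_def,
        Fin.lt_def] at *
      grind
  h_comp_σ_castSucc_of_le i j hij := by
    ext σ
    change Fin (_ + 1) →o E at σ
    refine OrderHom.ext _ _ (funext fun k => ite_chain_eq p q σ ?_ ?_)
    · change ((i.castSucc.predAbove k : Fin _) : ℕ) ≤ _ ↔ ((k : Fin _) : ℕ) ≤ _
      simp only [val_succAbove, val_predAbove, Fin.val_succ, Fin.val_castSucc, Fin.le_def,
        Fin.lt_def] at *
      grind
    · change ((j.predAbove (i.castSucc.predAbove k) : Fin _) : ℕ) = ((i.predAbove (j.succ.predAbove k) : Fin _) : ℕ)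
      simp only [val_succAbove, val_predAbove, Fin.val_succ, Fin.val_castSucc, Fin.le_def,
        Fin.lt_def] at *
      grind
  h_comp_σ_succ_of_lt i j hij := by
    ext σ
    change Fin (_ + 1) →o E at σ
    refine OrderHom.ext _ _ (funext fun k => ite_chain_eq p q σ ?_ ?_)
    · change ((i.succ.predAbove k : Fin _) : ℕ) ≤ _ ↔ ((k : Fin _) : ℕ) ≤ _
      simp only [val_succAbove, val_predAbove, Fin.val_succ, Fin.val_castSucc, Fin.le_def,
        Fin.lt_def] at *
      grind
    · change ((j.predAbove (i.succ.predAbove k) : Fin _) : ℕ) = ((i.predAbove (j.castSucc.predAbove k) : Fin _) : ℕ)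
      simp only [val_succAbove, val_predAbove, Fin.val_succ, Fin.val_castSucc, Fin.le_def,
        Fin.lt_def] at *
      grind

theorem orderSpaceMap_comp {E'' : Type u} [Preorder E''] [MulAction W E'']
    [CovariantClass W E'' HSMul.hSMul LE.le] (f : E →o E') (hf : ∀ (w : W) (x : E), f (w • x) = w • f x)
    (g : E' →o E'') (hg : ∀ (w : W) (x : E'), g (w • x) = w • g x) :
    orderSpaceMap f hf ≫ orderSpaceMap g hg =
      orderSpaceMap (g.comp f) fun w x => (congrArg g (hf w x)).trans (hg w _) := rfl

theorem exists_cochainMap_sub_eq (F : (GSet W)ᵒᵖ ⥤ AddCommGrpCat.{u}) {p q : E →o E'}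
    (h : p ≤ q ∨ q ≤ p) (hp : ∀ (w : W) (x : E), p (w • x) = w • p x)
    (hq : ∀ (w : W) (x : E), q (w • x) = w • q x) :
    ∃ s : (∀ n : ℕ, F.obj (op ((orderSpace W E') _⦋n⦌))) →+
        (∀ n : ℕ, F.obj (op ((orderSpace W E) _⦋n⦌))),
      ∀ a, cochainD F _ a = 0 → cochainMap F (orderSpaceMap p hp) a -
        cochainMap F (orderSpaceMap q hq) a = cochainD F _ (s a) := by
  rcases h with h | h
  · obtain ⟨s, hs⟩ := exists_cochain_homotopy F (orderSpaceHomotopy p q h hp hq)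
    refine ⟨-s, fun a ha => ?_⟩
    rw [← neg_sub, hs, ha, map_zero, add_zero]
    exact (map_neg _ _).symm
  · obtain ⟨s, hs⟩ := exists_cochain_homotopy F (orderSpaceHomotopy q p h hq hp)
    exact ⟨s, fun a ha => by rw [hs, ha, map_zero, add_zero]⟩

theorem cochainMap_orderSpaceMap_id (F : (GSet W)ᵒᵖ ⥤ AddCommGrpCat.{u})
    (a : ∀ n : ℕ, F.obj (op ((orderSpace W E) _⦋n⦌))) :
    cochainMap F (orderSpaceMap OrderHom.id fun _ _ => rfl) a = a := by
  funext n
  exact pullbackHom_id F _ _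

/-- Equivariant monotone maps in both directions, with composites comparable with the identity,
induce quasi-isomorphisms on cochains. -/
theorem quasiIsoDG_orderSpaceMap (F : (GSet W)ᵒᵖ ⥤ AddCommGrpCat.{u}) (p : E →o E') (q : E' →o E)
    (hp : ∀ (w : W) (x : E), p (w • x) = w • p x) (hq : ∀ (w : W) (x : E'), q (w • x) = w • q x)
    (hqp : q.comp p ≤ OrderHom.id ∨ OrderHom.id ≤ q.comp p)
    (hpq : p.comp q ≤ OrderHom.id ∨ OrderHom.id ≤ p.comp q) :
    QuasiIsoDG (cochainD F (orderSpace W E')) (cochainD F (orderSpace W E))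
      (cochainMap F (orderSpaceMap p hp)) := by
  obtain ⟨s, hs⟩ := exists_cochainMap_sub_eq F hqp
    (fun w x => (congrArg q (hp w x)).trans (hq w _)) fun _ _ => rfl
  obtain ⟨s', hs'⟩ := exists_cochainMap_sub_eq F hpq
    (fun w x => (congrArg p (hq w x)).trans (hp w _)) fun _ _ => rfl
  refine QuasiIsoDG.of_homotopyEquiv (cochainMap F (orderSpaceMap q hq)) s' s
    (cochainMap_cochainD F _) (cochainMap_cochainD F _) (fun a ha => ?_) fun a ha => ?_
  · rw [← hs' a ha, cochainMap_orderSpaceMap_id, ← cochainMap_comp, orderSpaceMap_comp]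
  · rw [← hs a ha, cochainMap_orderSpaceMap_id, ← cochainMap_comp, orderSpaceMap_comp]

end

end OrderedSets

/-! ### Double complexes of functors -/

section FunctorComplexes

open Simplicial

/-- A sequence of contravariant functors to abelian groups, with a differential. -/
structure FunctorComplex (C : Type*) [Category* C] where
  obj : ℕ → Cᵒᵖ ⥤ AddCommGrpCat.{u}
  d : ∀ k, obj k ⟶ obj (k + 1)
  d_d : ∀ k, d k ≫ d (k + 1) = 0

variable {C : Type*} [Category* C] (P Q : FunctorComplex.{u} C)

theorem FunctorComplex.d_d_apply (k : ℕ) (S : Cᵒᵖ) (a : (P.obj k).obj S) :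
    ((P.d (k + 1)).app S).hom (((P.d k).app S).hom a) = 0 :=
  ConcreteCategory.congr_hom (NatTrans.congr_app (P.d_d k) S) a

/-- The differential of the complex obtained by evaluation at an object. -/
def rowD (S : C) : (∀ k, (P.obj k).obj (op S)) →+ (∀ k, (P.obj k).obj (op S)) :=
  seqD fun k => ((P.d k).app (op S)).hom

/-- The differential of the total complex obtained by applying a complex of functors to a
simplicial object. -/
def totalD (Y : SimplicialObject C) : (∀ n k, (P.obj k).obj (op (Y _⦋n⦌))) →+
    (∀ n k, (P.obj k).obj (op (Y _⦋n⦌))) :=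
  totD (R := fun n => ∀ k, (P.obj k).obj (op (Y _⦋n⦌))) (fun n => rowD P (Y _⦋n⦌))
    (fun n => piMap fun k => coface (P.obj k) Y n)

/-- The map of total complexes induced by a map of simplicial objects. -/
def totalMap {Y Z : SimplicialObject C} (g : Y ⟶ Z) : (∀ n k, (P.obj k).obj (op (Z _⦋n⦌))) →+
    (∀ n k, (P.obj k).obj (op (Y _⦋n⦌))) :=
  piMap (R := fun n => ∀ k, (P.obj k).obj (op (Z _⦋n⦌)))
    (R' := fun n => ∀ k, (P.obj k).obj (op (Y _⦋n⦌)))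
    fun n => piMap fun k => pullbackHom (P.obj k) (g.app (op ⦋n⦌))

variable {P Q}

/-- The map of complexes obtained by evaluating maps of functors at an object. -/
def rowMap (f : ∀ k, P.obj k ⟶ Q.obj k) (S : C) :
    (∀ k, (P.obj k).obj (op S)) →+ (∀ k, (Q.obj k).obj (op S)) :=
  piMap fun k => ((f k).app (op S)).hom

theorem rowD_rowD (S : C) (a : ∀ k, (P.obj k).obj (op S)) : rowD P S (rowD P S a) = 0 :=
  seqD_seqD (fun k => P.d_d_apply k (op S)) a

theorem rowMap_rowD {f : ∀ k, P.obj k ⟶ Q.obj k} (hf : ∀ k, P.d k ≫ f (k + 1) = f k ≫ Q.d k)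
    (S : C) (a : ∀ k, (P.obj k).obj (op S)) :
    rowMap f S (rowD P S a) = rowD Q S (rowMap f S a) :=
  piMap_seqD (fun k a => ConcreteCategory.congr_hom (NatTrans.congr_app (hf k) (op S)) a) a

theorem rowD_coface (Y : SimplicialObject C) (n : ℕ) (a : ∀ k, (P.obj k).obj (op (Y _⦋n⦌))) :
    rowD P (Y _⦋n + 1⦌) (piMap (fun k => coface (P.obj k) Y n) a) =
      piMap (fun k => coface (P.obj k) Y n) (rowD P (Y _⦋n⦌) a) :=
  (piMap_seqD (fun k a => (coface_app (P.d k) Y n a).symm) a).symm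

theorem totalD_totalD (Y : SimplicialObject C) (a : ∀ n k, (P.obj k).obj (op (Y _⦋n⦌))) :
    totalD P Y (totalD P Y a) = 0 :=
  totD_totD (R := fun n => ∀ k, (P.obj k).obj (op (Y _⦋n⦌))) (fun n => rowD_rowD _)
    (fun n a => funext fun k => coface_coface (P.obj k) Y n (a k)) (fun _ => rowD_coface Y _) a

theorem totalMap_totalD {Y Z : SimplicialObject C} (g : Y ⟶ Z)
    (a : ∀ n k, (P.obj k).obj (op (Z _⦋n⦌))) :
    totalMap P g (totalD P Z a) = totalD P Y (totalMap P g a) :=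
  piMap_totD (R := fun n => ∀ k, (P.obj k).obj (op (Z _⦋n⦌)))
    (R' := fun n => ∀ k, (P.obj k).obj (op (Y _⦋n⦌)))
    (fun n => piMap_seqD fun k a => (pullbackHom_app (P.d k) (g.app (op ⦋n⦌)) a).symm)
    (fun n a => funext fun k => coface_natural (P.obj k) g n (a k)) a

/-- The map of total complexes induced by maps of functors. -/
def totalRowMap (f : ∀ k, P.obj k ⟶ Q.obj k) (Y : SimplicialObject C) :
    (∀ n k, (P.obj k).obj (op (Y _⦋n⦌))) →+ (∀ n k, (Q.obj k).obj (op (Y _⦋n⦌))) :=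
  piMap (R := fun n => ∀ k, (P.obj k).obj (op (Y _⦋n⦌)))
    (R' := fun n => ∀ k, (Q.obj k).obj (op (Y _⦋n⦌))) fun n => rowMap f (Y _⦋n⦌)

theorem totalRowMap_totalD {f : ∀ k, P.obj k ⟶ Q.obj k}
    (hf : ∀ k, P.d k ≫ f (k + 1) = f k ≫ Q.d k)
    (Y : SimplicialObject C) (a : ∀ n k, (P.obj k).obj (op (Y _⦋n⦌))) :
    totalRowMap f Y (totalD P Y a) = totalD Q Y (totalRowMap f Y a) :=
  piMap_totD (R := fun n => ∀ k, (P.obj k).obj (op (Y _⦋n⦌)))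
    (R' := fun n => ∀ k, (Q.obj k).obj (op (Y _⦋n⦌))) (fun _ => rowMap_rowD hf _)
    (fun n a => funext fun k => coface_app (f k) Y n (a k)) a

theorem totalRowMap_totalMap (f : ∀ k, P.obj k ⟶ Q.obj k) {Y Z : SimplicialObject C} (g : Y ⟶ Z)
    (a : ∀ n k, (P.obj k).obj (op (Z _⦋n⦌))) :
    totalRowMap f Y (totalMap P g a) = totalMap Q g (totalRowMap f Z a) :=
  funext fun n => funext fun k => pullbackHom_app (f k) (g.app (op ⦋n⦌)) (a n k)

theorem QuasiIsoDG.total_of_rows {f : ∀ k, P.obj k ⟶ Q.obj k} (Y : SimplicialObject C)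
    (h : ∀ n, QuasiIsoDG (rowD P (Y _⦋n⦌)) (rowD Q (Y _⦋n⦌)) (rowMap f (Y _⦋n⦌))) :
    QuasiIsoDG (totalD P Y) (totalD Q Y) (totalRowMap f Y) :=
  QuasiIsoDG.tot (R := fun n => ∀ k, (P.obj k).obj (op (Y _⦋n⦌)))
    (R' := fun n => ∀ k, (Q.obj k).obj (op (Y _⦋n⦌)))
    (fun n a => funext fun k => coface_coface (Q.obj k) Y n (a k)) (fun _ => rowD_coface Y _)
    (fun _ => rowD_coface Y _) (fun n a => funext fun k => coface_app (f k) Y n (a k))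
    (fun n a => funext fun k => coface_coface (P.obj k) Y n (a k)) h

theorem QuasiIsoDG.total_of_columns {Y Z : SimplicialObject C} (g : Y ⟶ Z)
    (h : ∀ k, QuasiIsoDG (cochainD (P.obj k) Z) (cochainD (P.obj k) Y) (cochainMap (P.obj k) g)) :
    QuasiIsoDG (totalD P Z) (totalD P Y) (totalMap P g) :=
  QuasiIsoDG.tot_of_columns (A := fun n k => (P.obj k).obj (op (Z _⦋n⦌)))
    (B := fun n k => (P.obj k).obj (op (Y _⦋n⦌)))
    (fun _ k a => P.d_d_apply k _ a) (fun _ k a => P.d_d_apply k _ a)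
    (fun n k a => (coface_app (P.d k) Z n a).symm ▸ rfl)
    (fun n k a => (coface_app (P.d k) Y n a).symm ▸ rfl)
    (fun n k a => (pullbackHom_app (P.d k) (g.app (op ⦋n⦌)) a).symm) h

end FunctorComplexes

/-! ### Equivariant maps -/

section EquivariantMaps

open Simplicial

variable {W : Type u} [Group W]

theorem GModule.act_mul (M : GModule W) (w w' : W) (m : M.V) :
    M.act (w * w') m = M.act w (M.act w' m) :=
  ConcreteCategory.congr_hom (M.ρ.map_mul w w') m

theorem GModule.act_one (M : GModule W) (m : M.V) : M.act 1 m = m :=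
  ConcreteCategory.congr_hom M.ρ.map_one m

/-- An equivariant map may be prescribed on a set that meets all orbits, if the prescription is
compatible with the translations that send members of this set to one another. -/
theorem exists_equivariantMap (M : GModule W) {S : GSet W} (R : Set S.V)
    (hR : ∀ s, ∃ w : W, ∃ r ∈ R, w • r = s) (ψ : S.V → M.V)
    (hψ : ∀ r ∈ R, ∀ r' ∈ R, ∀ w : W, w • r = r' → ψ r' = M.act w (ψ r)) :
    ∃ φ : equivariantMaps M S, ∀ r ∈ R, φ.1 r = ψ r := by
  choose n ρ hρ hn using hR
  refine ⟨⟨fun s => M.act (n s) (ψ (ρ s)), fun w s => ?_⟩, fun r hr => ?_⟩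
  · have h := hψ (ρ s) (hρ s) (ρ (w • s)) (hρ _) ((n (w • s))⁻¹ * (w * n s)) (by
      rw [mul_smul, mul_smul, hn, inv_smul_eq_iff, hn])
    change M.act (n (w • s)) (ψ (ρ (w • s))) = _
    rw [h, ← GModule.act_mul, mul_inv_cancel_left, GModule.act_mul]
  · exact (hψ (ρ r) (hρ r) r hr (n r) (hn r)).symm

/-- A functor whose values are products of the values of other functors gives a
quasi-isomorphism on cochains if all these functors do. -/
theorem quasiIsoDG_cochainMap_of_bijective {C : Type*} [Category* C] {ι : Type*}
    {F : Cᵒᵖ ⥤ AddCommGrpCat.{u}} {F' : ι → Cᵒᵖ ⥤ AddCommGrpCat.{u}} (α : ∀ x, F ⟶ F' x)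
    (hα : ∀ S, Function.Bijective fun (a : F.obj (op S)) x => ((α x).app (op S)).hom a)
    {X Y : SimplicialObject C} (f : X ⟶ Y)
    (h : ∀ x, QuasiIsoDG (cochainD (F' x) Y) (cochainD (F' x) X) (cochainMap (F' x) f)) :
    QuasiIsoDG (cochainD F Y) (cochainD F X) (cochainMap F f) := by
  have inj : ∀ {Z : SimplicialObject C} {a a' : ∀ n : ℕ, F.obj (op (Z _⦋n⦌))},
      (∀ x, piMap (fun n => ((α x).app (op (Z _⦋n⦌))).hom) a =
        piMap (fun n => ((α x).app (op (Z _⦋n⦌))).hom) a') → a = a' := fun h =>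
    funext fun n => (hα _).1 (funext fun x => congrFun (h x) n)
  have surj : ∀ {Z : SimplicialObject C} (a : ∀ x, ∀ n : ℕ, (F' x).obj (op (Z _⦋n⦌))),
      ∃ b : ∀ n : ℕ, F.obj (op (Z _⦋n⦌)), ∀ x,
        piMap (fun n => ((α x).app (op (Z _⦋n⦌))).hom) b = a x := fun a => by
    choose b hb using fun n => (hα _).2 fun x => a x n
    exact ⟨b, fun x => funext fun n => congrFun (hb n) x⟩
  have hd : ∀ {Z : SimplicialObject C} x (a : ∀ n : ℕ, F.obj (op (Z _⦋n⦌))),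
      piMap (fun n => ((α x).app (op (Z _⦋n⦌))).hom) (cochainD F Z a) =
        cochainD (F' x) Z (piMap (fun n => ((α x).app (op (Z _⦋n⦌))).hom) a) := fun x =>
    piMap_seqD fun n a => coface_app (α x) _ n a
  have hf : ∀ x (a : ∀ n : ℕ, F.obj (op (Y _⦋n⦌))),
      piMap (fun n => ((α x).app (op (X _⦋n⦌))).hom) (cochainMap F f a) =
        cochainMap (F' x) f (piMap (fun n => ((α x).app (op (Y _⦋n⦌))).hom) a) := fun x a =>
    funext fun n => pullbackHom_app (α x) _ _
  intro a a' ha haa'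
  choose b b' hb hb' using fun x => h x (piMap (fun n => ((α x).app (op (Y _⦋n⦌))).hom) a)
    (piMap (fun n => ((α x).app (op (X _⦋n⦌))).hom) a') (by rw [← hd, ha, map_zero])
    (by rw [← hf, haa', hd])
  obtain ⟨c, hc⟩ := surj b
  obtain ⟨c', hc'⟩ := surj b'
  refine ⟨c, c', inj fun x => ?_, inj fun x => ?_⟩
  · rw [hd, hc, hb]
  · rw [map_sub, hf, hd, hc, hc', hb']

end EquivariantMaps

/-! ### Chains of labelled points -/

section Labels

open Simplicial

/-- An ordered `W`-set of labels, with a condition on the subgroups `K` of `W` that says whether a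
label may be attached to a point with stabilizer `K`. -/
structure Labels (W : Type u) [Group W] where
  Label : Type u
  preorder : Preorder Label
  action : MulAction W Label
  smul_mono : ∀ w : W, Monotone fun l : Label => w • l
  ok : Label → Subgroup W → Prop
  ok_mono : ∀ {l K K'}, K ≤ K' → ok l K → ok l K'
  ok_smul : ∀ (w : W) {l K}, ok l K → ok (w • l) (K.map (MulAut.conj w).toMonoidHom)

attribute [instance] Labels.preorder Labels.action

variable {W : Type u} [Group W]

theorem GSet.stabilizer_le {S S' : GSet W} (f : S ⟶ S') (s : S.V) :
    MulAction.stabilizer W s ≤ MulAction.stabilizer W (f.hom s) := fun w hw => by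
  rw [MulAction.mem_stabilizer_iff] at hw ⊢
  rw [← GSet.hom_smul, hw]

/-- The vertices `(t, l, s)` with `t ∈ T`, and `l` a label that may be attached to `s ∈ S`. -/
@[ext]
structure Labelled (T : GSet W) (Λ : Labels W) (S : GSet W) : Type u where
  vertex : T.V
  label : Λ.Label
  point : S.V
  ok : Λ.ok label (MulAction.stabilizer W point)

variable (T : GSet W) (Λ : Labels W)

/-- The order is that of the labels; vertices with different points are not comparable, and the
components in `T` do not matter. -/
instance (S : GSet W) : Preorder (Labelled T Λ S) where
  le x y := x.label ≤ y.label ∧ x.point = y.point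
  le_refl _ := ⟨le_rfl, rfl⟩
  le_trans _ _ _ h h' := ⟨h.1.trans h'.1, h.2.trans h'.2⟩

instance (S : GSet W) : MulAction W (Labelled T Λ S) where
  smul w x := ⟨w • x.vertex, w • x.label, w • x.point, by
    rw [MulAction.stabilizer_smul_eq_stabilizer_map_conj]
    exact Λ.ok_smul w x.ok⟩
  one_smul x := Labelled.ext (one_smul W _) (one_smul W _) (one_smul W _)
  mul_smul w w' x := Labelled.ext (mul_smul w w' _) (mul_smul w w' _) (mul_smul w w' _)

instance (S : GSet W) : CovariantClass W (Labelled T Λ S) HSMul.hSMul LE.le where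
  elim w _ _ h := ⟨Λ.smul_mono w h.1, congrArg (w • ·) h.2⟩

/-- The nerve of the labelled points of a `W`-set. -/
def labelSpace : GSet W ⥤ GSpace W where
  obj S := orderSpace W (Labelled T Λ S)
  map f := orderSpaceMap
    ⟨fun x => ⟨x.vertex, x.label, f.hom x.point, Λ.ok_mono (GSet.stabilizer_le f _) x.ok⟩,
      fun _ _ h => ⟨h.1, congrArg f.hom h.2⟩⟩
    fun w x => Labelled.ext rfl rfl (GSet.hom_smul f w x.point)
  map_id _ := rfl
  map_comp _ _ := rfl

variable {Λ} in
/-- The map of nerves of labelled points induced by a map of labels. -/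
def labelSpaceMap {Λ' : Labels W} (f : Λ.Label →o Λ'.Label)
    (hf : ∀ (w : W) (l : Λ.Label), f (w • l) = w • f l)
    (hok : ∀ l K, Λ.ok l K → Λ'.ok (f l) K) : labelSpace T Λ ⟶ labelSpace T Λ' where
  app S := orderSpaceMap
    ⟨fun x => ⟨x.vertex, f x.label, x.point, hok _ _ x.ok⟩, fun _ _ h => ⟨f.monotone h.1, h.2⟩⟩
    fun w x => Labelled.ext rfl (hf w x.label) rfl
  naturality _ _ _ := rfl

/-- The complex of functors formed by the equivariant cochains of a functorial `W`-space. -/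
def spaceComplex {C : Type*} [Category* C] (L : C ⥤ GSpace W) (V : GModule W) :
    FunctorComplex.{u} C where
  obj k := (L ⋙ (evaluation _ _).obj (op ⦋k⦌)).op ⋙ twistedCochains V
  d k :=
    { app := fun S => AddCommGrpCat.ofHom (coface (twistedCochains V) (L.obj S.unop) k)
      naturality := fun _ _ f => by
        ext a
        exact (coface_natural (twistedCochains V) (L.map f.unop) k a).symm }
  d_d k := by
    ext S a
    exact coface_coface (twistedCochains V) (L.obj S.unop) k a

/-- The map of complexes of functors induced by a map of functorial `W`-spaces. -/
def spaceComplexMap {C : Type*} [Category* C] {L L' : C ⥤ GSpace W} (α : L ⟶ L') (V : GModule W)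
    (k : ℕ) : (spaceComplex L' V).obj k ⟶ (spaceComplex L V).obj k where
  app S := (twistedCochains V).map ((α.app S.unop).app (op ⦋k⦌)).op
  naturality S S' f := by
    exact congrArg (fun g => (twistedCochains V).map (g.app (op ⦋k⦌)).op)
      (α.naturality f.unop).symm

theorem spaceComplexMap_d {C : Type*} [Category* C] {L L' : C ⥤ GSpace W} (α : L ⟶ L')
    (V : GModule W) (k : ℕ) :
    (spaceComplex L' V).d k ≫ spaceComplexMap α V (k + 1) =
      spaceComplexMap α V k ≫ (spaceComplex L V).d k := by
  ext S a
  exact coface_natural (twistedCochains V) (α.app S.unop) k a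

/-- The `W`-set `W`. -/
abbrev regular (W : Type u) [Group W] : GSet W := Action.ofMulAction W W

/-- The cochains on the points whose stabilizer contains a given subgroup. -/
def fixedCochains (V : Type u) [AddCommGroup V] (K : Subgroup W) : (GSet W)ᵒᵖ ⥤ AddCommGrpCat.{u} :=
  (fixedSet K).op ⋙ mapFunctor V

theorem le_stabilizer_iff {S : GSet W} {K : Subgroup W} {s : S.V} :
    K ≤ MulAction.stabilizer W s ↔ ∀ k ∈ K, k • s = s := Iff.rfl

section Columns

variable (Λ : Labels W) (Q : Λ.Label → Subgroup W) (hQ : Monotone Q)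
    (hok : ∀ l K, Λ.ok l K ↔ Q l ≤ K)

/-- The chain of labelled points with given vertices and labels and a given constant point. -/
def constantChain {k : ℕ} (w : Fin (k + 1) → W) (l : Fin (k + 1) →o Λ.Label) {S : GSet W} (s : S.V)
    (hs : ∀ i, Λ.ok (l i) (MulAction.stabilizer W s)) :
    Fin (k + 1) →o Labelled (regular W) Λ S :=
  ⟨fun i => ⟨w i, l i, s, hs i⟩, fun _ _ h => ⟨l.monotone h, rfl⟩⟩

/-- Restriction of a cochain to the chains with given vertices and labels. -/
def chainRestriction (V : GModule W) {k : ℕ} (w : Fin (k + 1) → W) (l : Fin (k + 1) →o Λ.Label) :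
    (spaceComplex (labelSpace (regular W) Λ) V).obj k ⟶
      fixedCochains V.V (Q (l (Fin.last k))) where
  app S := AddCommGrpCat.ofHom
    { toFun := fun φ s => φ.1 (constantChain Λ w l s.1 fun i =>
        (hok _ _).2 ((hQ (l.monotone (Fin.le_last i))).trans (le_stabilizer_iff.2 s.2)))
      map_zero' := rfl
      map_add' := fun _ _ => rfl }
  naturality _ _ _ := rfl

theorem eq_constantChain {k : ℕ} {S : GSet W} (σ : Fin (k + 1) →o Labelled (regular W) Λ S) :
    ∃ (w : Fin (k + 1) → W) (l : Fin (k + 1) →o Λ.Label) (s : S.V)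
      (hs : ∀ i, Λ.ok (l i) (MulAction.stabilizer W s)), σ = constantChain Λ w l s hs := by
  have h : ∀ i, (σ i).point = (σ 0).point := fun i => (σ.monotone (Fin.zero_le i)).2.symm
  refine ⟨fun i => (σ i).vertex, ⟨fun i => (σ i).label, fun _ _ h => (σ.monotone h).1⟩,
    (σ 0).point, fun i => ?_, ?_⟩
  · rw [← h i]
    exact (σ i).ok
  · exact OrderHom.ext _ _ (funext fun i => Labelled.ext rfl rfl (h i))

theorem exists_smul_constantChain {k : ℕ} {S : GSet W}
    (σ : Fin (k + 1) →o Labelled (regular W) Λ S) :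
    ∃ (g : W) (w : Fin (k + 1) → W) (l : Fin (k + 1) →o Λ.Label) (s : S.V)
      (hs : ∀ i, Λ.ok (l i) (MulAction.stabilizer W s)),
      w 0 = 1 ∧ g • constantChain Λ w l s hs = σ := by
  let g : W := (σ 0).vertex
  obtain ⟨w, l, s, hs, h⟩ := eq_constantChain Λ (g⁻¹ • σ)
  refine ⟨g, w, l, s, hs, ?_, by rw [← h, smul_inv_smul]⟩
  have h0 : (g⁻¹ • σ 0).vertex = w 0 :=
    congrArg (fun τ : Fin (k + 1) →o Labelled (regular W) Λ S => (τ 0).vertex) h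
  rw [← h0]
  exact inv_mul_cancel g

include hQ hok in
/-- The chains of labelled points with first vertex `1` form a fundamental domain. -/
theorem quasiIsoDG_labelSpace_column (V : GModule W) {Y Z : GSpace W} (g : Y ⟶ Z) (k : ℕ)
    (h : ∀ l, QuasiIsoDG (cochainD (fixedCochains V.V (Q l)) Z)
      (cochainD (fixedCochains V.V (Q l)) Y) (cochainMap (fixedCochains V.V (Q l)) g)) :
    QuasiIsoDG (cochainD ((spaceComplex (labelSpace (regular W) Λ) V).obj k) Z)
      (cochainD ((spaceComplex (labelSpace (regular W) Λ) V).obj k) Y)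
      (cochainMap ((spaceComplex (labelSpace (regular W) Λ) V).obj k) g) := by
  refine quasiIsoDG_cochainMap_of_bijective
    (ι := {w : Fin (k + 1) → W // w 0 = 1} × (Fin (k + 1) →o Λ.Label))
    (fun x => chainRestriction Λ Q hQ hok V x.1.1 x.2) (fun S => ⟨fun φ φ' hφ => ?_, fun ψ => ?_⟩) g
    (fun x => h _)
  · refine Subtype.ext (funext fun (σ : Fin (k + 1) →o Labelled (regular W) Λ S) => ?_)
    obtain ⟨g, w, l, s, hs, hw, rfl⟩ := exists_smul_constantChain Λ σ
    refine (φ.2 g _).trans (Eq.trans (congrArg (V.act g) ?_) (φ'.2 g _).symm)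
    exact congrFun (congrFun hφ ⟨⟨w, hw⟩, l⟩)
      ⟨s, le_stabilizer_iff.1 ((hok _ _).1 (hs (Fin.last k)))⟩
  · classical
    let v : (Fin (k + 1) →o Labelled (regular W) Λ S) → W := fun σ => (σ 0).vertex
    let ψ' : (Fin (k + 1) →o Labelled (regular W) Λ S) → V.V := fun σ =>
      if hσ : (σ 0).vertex = (1 : W) then
        (ψ ⟨⟨fun i => (σ i).vertex, hσ⟩, ⟨fun i => (σ i).label, fun _ _ h => (σ.monotone h).1⟩⟩ :
          (fixedSet (Q (σ (Fin.last k)).label)).obj S → V.V)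
          ⟨(σ (Fin.last k)).point, le_stabilizer_iff.1 ((hok _ _).1 (σ (Fin.last k)).ok)⟩
      else 0
    obtain ⟨φ, hφ⟩ := exists_equivariantMap V
      (S := ((labelSpace (regular W) Λ).obj S).obj (op ⦋k⦌))
      {σ | v σ = 1}
      (fun σ => by
        obtain ⟨g, w, l, s, hs, hw, hσ⟩ := exists_smul_constantChain Λ σ
        exact ⟨g, _, hw, hσ⟩) ψ' (fun r hr r' hr' w hw => by
        obtain rfl : w = 1 := by
          have h1 : w * v r = v r' := congrArg v hw
          rwa [show v r = 1 from hr, show v r' = 1 from hr', mul_one] at h1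
        obtain rfl : r = r' := (one_smul W r).symm.trans hw
        exact (GModule.act_one V _).symm)
    refine ⟨φ, funext fun x => funext fun s => ?_⟩
    exact (hφ (constantChain Λ x.1.1 x.2 s.1 _) x.1.2).trans (dif_pos x.1.2)

end Columns

end Labels

/-! ### The free part of a `W`-space -/

section FreePart

open Simplicial

variable {W : Type u} [Group W]

/-- The sequence with a given entry in degree `0` and zeros in all other degrees. -/
def singleZero (A : ℕ → Type*) [∀ k, AddCommGroup (A k)] : A 0 →+ ∀ k, A k where
  toFun a k := match k with
    | 0 => a
    | _ + 1 => 0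
  map_zero' := by
    funext k
    cases k <;> rfl
  map_add' a b := by
    funext k
    cases k
    · rfl
    · exact (add_zero _).symm

theorem coface_twistedCochains_apply (V : GModule W) (X : GSpace W) (n : ℕ)
    (φ : (twistedCochains V).obj (op (X _⦋n⦌))) (x : (X _⦋n + 1⦌).V) :
    (coface (twistedCochains V) X n φ : equivariantMaps V (X _⦋n + 1⦌)).1 x =
      ∑ i : Fin (n + 2), (-1 : ℤ) ^ (i : ℕ) •
        (φ : equivariantMaps V (X _⦋n⦌)).1 ((X.δ i).hom x) := by
  refine (congrArg (fun c : equivariantMaps V (X _⦋n + 1⦌) => c.1 x)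
    (coface_apply (twistedCochains V) X n φ)).trans ?_
  let e : equivariantMaps V (X _⦋n + 1⦌) →+ V.V :=
    (Pi.evalAddMonoidHom (fun _ => (V.V : Type u)) x).comp (AddSubgroup.subtype _)
  refine (map_sum e _ _).trans (Finset.sum_congr rfl fun i _ => map_zsmul e _ _)

/-- No labels: all points are allowed. -/
def pointLabels (W : Type u) [Group W] : Labels W where
  Label := PUnit
  preorder := inferInstance
  action := { smul := fun _ x => x, one_smul := fun _ => rfl, mul_smul := fun _ _ _ => rfl }
  smul_mono _ _ _ h := h
  ok _ _ := True
  ok_mono _ h := h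
  ok_smul _ _ _ h := h

/-- No labels, but only points with nontrivial stabilizer are allowed. -/
def singularLabels (W : Type u) [Group W] : Labels W where
  Label := PUnit
  preorder := inferInstance
  action := { smul := fun _ x => x, one_smul := fun _ => rfl, mul_smul := fun _ _ _ => rfl }
  smul_mono _ _ _ h := h
  ok _ K := K ≠ ⊥
  ok_mono hK h := fun h' => h (le_bot_iff.1 (hK.trans h'.le))
  ok_smul w _ _ h := fun h' => h
    ((Subgroup.map_eq_bot_iff_of_injective _ (MulAut.conj w).injective).1 h')

/-- The labels are the nontrivial `p`-subgroups; those contained in the stabilizer of a point may be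
attached to this point. -/
def subgroupLabels (p : ℕ) (W : Type u) [Group W] : Labels W where
  Label := NontrivialPSubgroup p W
  preorder := inferInstance
  action :=
    { smul := fun w P => (conjFunctor p w).obj P
      one_smul := fun P => by
        change (conjFunctor p (1 : W)).obj P = P
        rw [conjFunctor_one]
        rfl
      mul_smul := fun w w' P => by
        change (conjFunctor p (w * w')).obj P = (conjFunctor p w).obj ((conjFunctor p w').obj P)
        rw [conjFunctor_mul]
        rfl }
  smul_mono _ _ _ h := Subgroup.map_mono h
  ok P K := P.1 ≤ K
  ok_mono hK h := h.trans hK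
  ok_smul _ _ _ h := Subgroup.map_mono h

/-- The points with nontrivial stabilizer, among all points. -/
def singularToPoint (T : GSet W) :
    labelSpace T (singularLabels W) ⟶ labelSpace T (pointLabels W) :=
  labelSpaceMap T OrderHom.id (fun _ _ => rfl) fun _ _ _ => trivial

/-- Forgetting a nontrivial subgroup of the stabilizer. -/
def subgroupToSingular (p : ℕ) (T : GSet W) :
    labelSpace T (subgroupLabels p W) ⟶ labelSpace T (singularLabels W) :=
  labelSpaceMap T (Λ := subgroupLabels p W) (Λ' := singularLabels W)
    ⟨fun _ => PUnit.unit, fun _ _ _ => le_rfl⟩ (fun _ _ => rfl)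
    fun P _ h h' => P.2.2 (le_bot_iff.1 (le_trans h h'.le))

/-- Forgetting a nontrivial subgroup of the stabilizer. -/
def subgroupToPoint (p : ℕ) (T : GSet W) :
    labelSpace T (subgroupLabels p W) ⟶ labelSpace T (pointLabels W) :=
  subgroupToSingular p T ≫ singularToPoint T

/-- If all stabilizers are `p`-groups, then a nontrivial stabilizer is itself the largest of its
nontrivial `p`-subgroups. -/
theorem quasiIsoDG_subgroupToSingular {p : ℕ} (T : GSet W) (V : GModule W) (S : GSet W)
    (hS : ∀ s : S.V, IsPGroup p (MulAction.stabilizer W s)) :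
    QuasiIsoDG (cochainD (twistedCochains V) ((labelSpace T (singularLabels W)).obj S))
      (cochainD (twistedCochains V) ((labelSpace T (subgroupLabels p W)).obj S))
      (cochainMap (twistedCochains V) ((subgroupToSingular p T).app S)) := by
  refine quasiIsoDG_orderSpaceMap (twistedCochains V) _
    (⟨fun x => ⟨x.vertex, ⟨MulAction.stabilizer W x.point, hS _, x.ok⟩, x.point, le_rfl⟩,
      fun x y h => ⟨?_, h.2⟩⟩ :
      Labelled T (singularLabels W) S →o Labelled T (subgroupLabels p W) S)
    (fun _ _ => Labelled.ext rfl rfl rfl) ?_ ?_ ?_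
  · change MulAction.stabilizer W x.point ≤ MulAction.stabilizer W y.point
    rw [h.2]
  · intro w x
    exact Labelled.ext rfl
      (Subtype.ext (MulAction.stabilizer_smul_eq_stabilizer_map_conj w x.point)) rfl
  · exact Or.inr fun x => ⟨x.ok, rfl⟩
  · exact Or.inr fun x => ⟨le_rfl, rfl⟩

/-- The equivariant cochains that vanish at all points with nontrivial stabilizer. -/
def freeCochains (V : GModule W) : (GSet W)ᵒᵖ ⥤ AddCommGrpCat.{u} where
  obj S := AddCommGrpCat.of
    (({ carrier := {φ | ∀ s, MulAction.stabilizer W s ≠ ⊥ → φ s = 0}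
        zero_mem' := fun _ _ => rfl
        add_mem' := fun {φ ψ} hφ hψ s hs => by rw [Pi.add_apply, hφ s hs, hψ s hs, add_zero]
        neg_mem' := fun {φ} hφ s hs => by rw [Pi.neg_apply, hφ s hs, neg_zero] } :
      AddSubgroup (S.unop.V → V.V)) ⊓ equivariantMaps V S.unop : AddSubgroup _)
  map {S S'} f := AddCommGrpCat.ofHom
    { toFun := fun φ => ⟨fun s => φ.1 (f.unop.hom s), fun s hs => φ.2.1 _ fun h =>
          hs (le_bot_iff.1 ((GSet.stabilizer_le f.unop s).trans h.le)),
        fun w s => (congrArg φ.1 (GSet.hom_smul f.unop w s)).trans (φ.2.2 w _)⟩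
      map_zero' := rfl
      map_add' := fun _ _ => rfl }
  map_id _ := rfl
  map_comp _ _ := rfl

/-- The kernel of a map of complexes of functors. -/
def kernelComplex {C : Type*} [Category* C] {P Q : FunctorComplex.{u} C}
    (f : ∀ k, P.obj k ⟶ Q.obj k) (hf : ∀ k, P.d k ≫ f (k + 1) = f k ≫ Q.d k) :
    FunctorComplex.{u} C where
  obj k :=
    { obj := fun S => AddCommGrpCat.of ((f k).app S).hom.ker
      map := fun {S S'} g => AddCommGrpCat.ofHom
        ((((P.obj k).map g).hom.comp (AddSubgroup.subtype _)).codRestrict _ fun a => by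
          have h := ConcreteCategory.congr_hom ((f k).naturality g) a.1
          rw [AddMonoidHom.mem_ker]
          refine h.trans ?_
          exact (congrArg ((Q.obj k).map g).hom a.2).trans (map_zero _))
      map_id := fun S => by
        ext a
        exact ConcreteCategory.congr_hom ((P.obj k).map_id S) a.1
      map_comp := fun g g' => by
        ext a
        exact ConcreteCategory.congr_hom ((P.obj k).map_comp g g') a.1 }
  d k :=
    { app := fun S => AddCommGrpCat.ofHom
        ((((P.d k).app S).hom.comp (AddSubgroup.subtype _)).codRestrict _ fun a => by
          have h := ConcreteCategory.congr_hom (NatTrans.congr_app (hf k) S) a.1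
          rw [AddMonoidHom.mem_ker]
          refine h.trans ?_
          exact (congrArg ((Q.d k).app S).hom a.2).trans (map_zero _))
      naturality := fun S S' g => by
        ext a
        exact ConcreteCategory.congr_hom ((P.d k).naturality g) a.1 }
  d_d k := by
    ext S a
    exact P.d_d_apply k S a.1

/-- The inclusion of the kernel of a map of complexes of functors. -/
def kernelInclusion {C : Type*} [Category* C] {P Q : FunctorComplex.{u} C}
    (f : ∀ k, P.obj k ⟶ Q.obj k) (hf : ∀ k, P.d k ≫ f (k + 1) = f k ≫ Q.d k) (k : ℕ) :
    (kernelComplex f hf).obj k ⟶ P.obj k where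
  app S := AddCommGrpCat.ofHom (AddSubgroup.subtype _)
  naturality _ _ _ := rfl

/-- The complex of cochains on chains of labelled points. -/
abbrev labelComplex (Λ : Labels W) (V : GModule W) : FunctorComplex.{u} (GSet W) :=
  spaceComplex (labelSpace (regular W) Λ) V

/-- The cochains on `EW × S` that vanish on `EW × S'`, where `S'` is the set of points of `S` with
nontrivial stabilizer. -/
def relativeComplex (V : GModule W) : FunctorComplex.{u} (GSet W) :=
  kernelComplex (spaceComplexMap (singularToPoint (regular W)) V) (spaceComplexMap_d _ V)

/-- The point of a chain of labelled points. -/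
def chainPoint {Λ : Labels W} {S : GSet W} {k : ℕ} (σ : Fin (k + 1) →o Labelled (regular W) Λ S) :
    S.V := (σ 0).point

theorem point_eq_chainPoint {Λ : Labels W} {S : GSet W} {k : ℕ}
    (σ : Fin (k + 1) →o Labelled (regular W) Λ S) (i : Fin (k + 1)) :
    (σ i).point = chainPoint σ := (σ.monotone (Fin.zero_le i)).2.symm

/-- A cochain on a free `W`-set, as a `0`-cochain on its product with `EW`. -/
def freeToRelative (V : GModule W) : freeCochains V ⟶ (relativeComplex V).obj 0 where
  app S := AddCommGrpCat.ofHom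
    { toFun := fun φ => ⟨⟨fun σ => φ.1 (chainPoint (k := 0) (Λ := pointLabels W) σ),
          fun w σ => φ.2.2 w _⟩, by
        refine Subtype.ext (funext fun
          (σ : Fin (0 + 1) →o Labelled (regular W) (singularLabels W) S.unop) => ?_)
        exact φ.2.1 _ (σ 0).ok⟩
      map_zero' := rfl
      map_add' := fun _ _ => rfl }
  naturality _ _ _ := rfl

/-- There is an equivariant map from the free part of a `W`-set to `W`. -/
theorem exists_freeVertex (S : GSet W) : ∃ u : S.V → W,
    ∀ (w : W) (s : S.V), MulAction.stabilizer W s = ⊥ → u (w • s) = w * u s := by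
  have h : ∀ s : S.V, ∃ w : W, w • (Quotient.out (Quotient.mk (MulAction.orbitRel W S.V) s)) = s :=
    fun s => (MulAction.orbitRel W S.V).symm' (@Quotient.mk_out _ (MulAction.orbitRel W S.V) s)
  choose u hu using h
  refine ⟨u, fun w s hs => ?_⟩
  have e : Quotient.mk (MulAction.orbitRel W S.V) (w • s) =
      Quotient.mk (MulAction.orbitRel W S.V) s :=
    Quotient.sound ⟨w, rfl⟩
  have h1 := hu (w • s)
  rw [e] at h1
  have h2 : (u s * (u (w • s))⁻¹ * w) ∈ MulAction.stabilizer W s := by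
    rw [MulAction.mem_stabilizer_iff, mul_smul, mul_smul]
    nth_rewrite 2 [← h1]
    rw [inv_smul_smul, hu]
  rw [hs, Subgroup.mem_bot] at h2
  have h3 : u (w • s) = w * (u s * (u (w • s))⁻¹ * w)⁻¹ * u s := by group
  rw [h3, h2]
  group

/-- A chain of points, preceded by the vertex `u s`, where `s` is the point of the chain. -/
def consChain {S : GSet W} (u : S.V → W) {k : ℕ}
    (σ : Fin (k + 1) →o Labelled (regular W) (pointLabels W) S) :
    Fin (k + 1 + 1) →o Labelled (regular W) (pointLabels W) S :=
  constantChain (pointLabels W) (Fin.cons (u (chainPoint σ)) fun i => (σ i).vertex)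
    ⟨fun _ => PUnit.unit, fun _ _ _ => le_rfl⟩ (chainPoint σ) fun _ => trivial

theorem stabilizer_smul_eq_bot_iff {S : GSet W} (w : W) (s : S.V) :
    MulAction.stabilizer W (w • s) = ⊥ ↔ MulAction.stabilizer W s = ⊥ := by
  rw [MulAction.stabilizer_smul_eq_stabilizer_map_conj]
  exact Subgroup.map_eq_bot_iff_of_injective _ (MulAut.conj w).injective

theorem consChain_smul {S : GSet W} {u : S.V → W}
    (hu : ∀ (w : W) (s : S.V), MulAction.stabilizer W s = ⊥ → u (w • s) = w * u s) (w : W) {k : ℕ}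
    (σ : Fin (k + 1) →o Labelled (regular W) (pointLabels W) S)
    (hσ : MulAction.stabilizer W (chainPoint σ) = ⊥) :
    consChain u (w • σ) = w • consChain u σ := by
  refine OrderHom.ext _ _ (funext fun i => ?_)
  refine Labelled.ext ?_ rfl rfl
  change Fin.cons (α := fun _ => W) (u (w • chainPoint σ)) (fun i => w • (σ i).vertex) i =
    w * Fin.cons (α := fun _ => W) (u (chainPoint σ)) (fun i => (σ i).vertex) i
  refine Fin.cases ?_ (fun i => ?_) i
  · exact hu w _ hσ
  · rfl

theorem consChain_face {S : GSet W} (u : S.V → W) {k : ℕ}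
    (σ : Fin (k + 1 + 1) →o Labelled (regular W) (pointLabels W) S) (i : Fin (k + 2)) :
    (consChain u σ).comp (SimplexCategory.δ i.succ).toOrderHom =
      consChain u (σ.comp (SimplexCategory.δ i).toOrderHom) := by
  have hp : chainPoint σ = chainPoint (σ.comp (SimplexCategory.δ i).toOrderHom) :=
    (point_eq_chainPoint σ _).symm
  refine OrderHom.ext _ _ (funext fun j => Labelled.ext ?_ rfl hp)
  change Fin.cons (α := fun _ => W) (u (chainPoint σ)) (fun i => (σ i).vertex) (i.succ.succAbove j) =
    Fin.cons (α := fun _ => W) (u (chainPoint (σ.comp (SimplexCategory.δ i).toOrderHom)))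
      (fun j => (σ (i.succAbove j)).vertex) j
  refine Fin.cases ?_ (fun j => ?_) j
  · rw [Fin.succ_succAbove_zero, ← hp]
    rfl
  · rw [Fin.succ_succAbove_succ]
    rfl

theorem relativeComplex_apply_eq_zero (V : GModule W) {S : GSet W} {k : ℕ}
    (φ : ((relativeComplex V).obj k).obj (op S))
    (σ : Fin (k + 1) →o Labelled (regular W) (pointLabels W) S)
    (hσ : MulAction.stabilizer W (chainPoint σ) ≠ ⊥) : φ.1.1 σ = 0 := by
  let τ : Fin (k + 1) →o Labelled (regular W) (singularLabels W) S :=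
    ⟨fun i => ⟨(σ i).vertex, (σ i).label, (σ i).point, by
      rw [point_eq_chainPoint]
      exact hσ⟩, σ.monotone⟩
  exact congrArg (fun c : equivariantMaps V (((labelSpace (regular W) (singularLabels W)).obj S).obj
    (op ⦋k⦌)) => c.1 τ) φ.2

theorem relativeComplex_d_apply (V : GModule W) {S : GSet W} {k : ℕ}
    (φ : ((relativeComplex V).obj k).obj (op S))
    (σ : Fin (k + 1 + 1) →o Labelled (regular W) (pointLabels W) S) :
    ((((relativeComplex V).d k).app (op S)).hom φ : ((relativeComplex V).obj (k + 1)).obj _).1.1 σ =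
      ∑ i : Fin (k + 2), (-1 : ℤ) ^ (i : ℕ) • φ.1.1 (σ.comp (SimplexCategory.δ i).toOrderHom) :=
  coface_twistedCochains_apply V ((labelSpace (regular W) (pointLabels W)).obj S) k φ.1 σ

theorem relativeComplex_ext (V : GModule W) {S : GSet W} {k : ℕ}
    {φ ψ : ((relativeComplex V).obj k).obj (op S)}
    (h : ∀ σ : Fin (k + 1) →o Labelled (regular W) (pointLabels W) S, φ.1.1 σ = ψ.1.1 σ) : φ = ψ :=
  Subtype.ext (Subtype.ext (funext h))

theorem freeToRelative_d (V : GModule W) (S : GSet W) (a : (freeCochains V).obj (op S)) :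
    rowD (relativeComplex V) S (singleZero (fun k => ((relativeComplex V).obj k).obj (op S))
      (((freeToRelative V).app (op S)).hom a)) = 0 := by
  funext k
  refine relativeComplex_ext V fun σ => ?_
  match k, σ with
  | 0, σ => rfl
  | 1, σ =>
    refine (relativeComplex_d_apply V _ σ).trans ?_
    rw [Fin.sum_univ_two]
    have h1 : chainPoint (σ.comp (SimplexCategory.δ (1 : Fin 2)).toOrderHom) =
        chainPoint (σ.comp (SimplexCategory.δ (0 : Fin 2)).toOrderHom) :=
      (point_eq_chainPoint σ _).trans (point_eq_chainPoint σ _).symm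
    have h2 : ∀ x : V.V, 0 = (-1 : ℤ) ^ ((0 : Fin 2) : ℕ) • x + (-1 : ℤ) ^ ((1 : Fin 2) : ℕ) • x :=
      fun x => by simp
    refine Eq.symm ((h2 (a.1 (chainPoint (σ.comp (SimplexCategory.δ (0 : Fin 2)).toOrderHom)))).trans
      (congrArg (fun s => _ + (-1 : ℤ) ^ ((1 : Fin 2) : ℕ) • a.1 s) h1.symm))
  | k + 2, σ =>
    exact (relativeComplex_d_apply V 0 σ).trans (Finset.sum_eq_zero fun i _ => smul_zero _)

/-- On the free part of a `W`-set, the cochains of the contractible space `EW` are contractible. -/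
theorem quasiIsoDG_freeToRelative (V : GModule W) (S : GSet W) :
    QuasiIsoDG 0 (rowD (relativeComplex V) S)
      ((singleZero fun k => ((relativeComplex V).obj k).obj (op S)).comp
        ((freeToRelative V).app (op S)).hom) := by
  obtain ⟨u, hu⟩ := exists_freeVertex S
  rw [quasiIsoDG_iff]
  · constructor
    · rintro a - ⟨b, hb⟩
      refine ⟨0, ?_⟩
      have h0 : ((freeToRelative V).app (op S)).hom a = 0 := congrFun hb 0
      rw [map_zero]
      refine Subtype.ext (funext fun s => ?_)
      exact (congrArg (fun φ : ((relativeComplex V).obj 0).obj (op S) =>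
        φ.1.1 (constantChain (pointLabels W) (fun _ => 1)
          ⟨fun _ => PUnit.unit, fun _ _ _ => le_rfl⟩ s fun _ => trivial)) h0).symm
    · intro φ hφ
      let base : S.V → (Fin (0 + 1) →o Labelled (regular W) (pointLabels W) S) := fun s =>
        constantChain (pointLabels W) (fun _ => u s)
          ⟨fun _ => PUnit.unit, fun _ _ _ => le_rfl⟩ s fun _ => trivial
      let a : (freeCochains V).obj (op S) := ⟨fun s => (φ 0).1.1 (base s), fun s hs =>
        relativeComplex_apply_eq_zero V (φ 0) (base s) hs, fun w s => by
          by_cases hs : MulAction.stabilizer W s = ⊥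
          · have e : base (w • s) = w • base s :=
              OrderHom.ext _ _ (funext fun i => Labelled.ext (hu w s hs) rfl rfl)
            exact (congrArg (φ 0).1.1 e).trans ((φ 0).1.2 w (base s))
          · refine (relativeComplex_apply_eq_zero V (φ 0) (base (w • s)) ?_).trans
              (Eq.trans (map_zero (V.act w)).symm (congrArg (V.act w)
                (relativeComplex_apply_eq_zero V (φ 0) (base s) hs).symm))
            exact fun h => hs ((stabilizer_smul_eq_bot_iff w s).1 h)⟩
      let b : ∀ k, ((relativeComplex V).obj k).obj (op S) := fun k =>
        ⟨⟨fun σ => (φ (k + 1)).1.1 (consChain u σ), fun w σ => by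
          by_cases hs : MulAction.stabilizer W (chainPoint (k := k) (Λ := pointLabels W) σ) = ⊥
          · exact (congrArg (φ (k + 1)).1.1 (consChain_smul hu w σ hs)).trans
              ((φ (k + 1)).1.2 w (consChain u σ))
          · refine (relativeComplex_apply_eq_zero V (φ (k + 1)) (consChain u (w • σ)) ?_).trans
              (Eq.trans (map_zero (V.act w)).symm (congrArg (V.act w)
                (relativeComplex_apply_eq_zero V (φ (k + 1)) (consChain u σ) hs).symm))
            exact fun h => hs ((stabilizer_smul_eq_bot_iff w _).1 h)⟩, by
          refine Subtype.ext (funext fun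
            (σ : Fin (k + 1) →o Labelled (regular W) (singularLabels W) S) => ?_)
          exact relativeComplex_apply_eq_zero V (φ (k + 1)) _ (σ 0).ok⟩
      have key : ∀ k (σ : Fin (k + 1) →o Labelled (regular W) (pointLabels W) S),
          (φ k).1.1 σ = ∑ i : Fin (k + 1), (-1 : ℤ) ^ (i : ℕ) • (φ k).1.1 ((consChain u σ).comp
            (SimplexCategory.δ i.succ).toOrderHom) := by
        intro k σ
        have h := (relativeComplex_d_apply V (φ k) (consChain u σ)).symm.trans
          (congrArg (fun φ : ((relativeComplex V).obj (k + 1)).obj (op S) => φ.1.1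
            (consChain u σ)) (congrFun hφ (k + 1)))
        rw [Fin.sum_univ_succ] at h
        have h0 : (consChain u σ).comp (SimplexCategory.δ 0).toOrderHom = σ :=
          OrderHom.ext _ _ (funext fun i => Labelled.ext rfl rfl (point_eq_chainPoint σ i).symm)
        rw [h0] at h
        simp only [Fin.val_zero, pow_zero, one_smul, Fin.val_succ, pow_succ, mul_neg_one,
          neg_smul, Finset.sum_neg_distrib] at h
        exact eq_of_sub_eq_zero ((sub_eq_add_neg _ _).trans h)
      refine ⟨a, rfl, -b, funext fun k => relativeComplex_ext V fun σ => ?_⟩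
      cases k with
      | zero =>
        have h := key 0 σ
        rw [Fin.sum_univ_one] at h
        have h1 : (consChain u σ).comp (SimplexCategory.δ (Fin.succ 0)).toOrderHom =
            base (chainPoint σ) :=
          OrderHom.ext _ _ (funext fun i => by
            obtain rfl : i = (0 : Fin 1) := Subsingleton.elim (α := Fin 1) i 0
            rfl)
        rw [h1] at h
        refine sub_eq_zero.2 (Eq.trans ?_ h.symm)
        exact (one_smul ℤ _).symm
      | succ k =>
        refine (zero_sub _).trans ?_
        refine Eq.trans ?_ (relativeComplex_d_apply V (-b k) σ).symm
        refine (congrArg Neg.neg (key (k + 1) σ)).trans ?_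
        rw [← Finset.sum_neg_distrib]
        refine Finset.sum_congr rfl fun i _ => ?_
        rw [← smul_neg]
        refine congrArg _ (congrArg (fun τ => -(φ (k + 1)).1.1 τ)
          (consChain_face u σ i))
  · exact fun a => (map_zero _).trans (freeToRelative_d V S a).symm

end FreePart

/-! ### Comparison of free parts -/

section Comparison

open Simplicial

variable {W : Type u} [Group W]

/-- Restriction to the points with nontrivial stabilizer. -/
abbrev restrictSingular (V : GModule W) (k : ℕ) :
    (labelComplex (pointLabels W) V).obj k ⟶ (labelComplex (singularLabels W) V).obj k :=
  spaceComplexMap (singularToPoint (regular W)) V k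

/-- Pulling back to the chains labelled by chains of nontrivial `p`-subgroups of the stabilizer. -/
abbrev restrictSubgroup (p : ℕ) (V : GModule W) (k : ℕ) :
    (labelComplex (pointLabels W) V).obj k ⟶ (labelComplex (subgroupLabels p W) V).obj k :=
  spaceComplexMap (subgroupToPoint p (regular W)) V k

/-- Pulling back from the points with nontrivial stabilizer to the chains labelled by chains of
nontrivial `p`-subgroups of the stabilizer. -/
abbrev singularSubgroup (p : ℕ) (V : GModule W) (k : ℕ) :
    (labelComplex (singularLabels W) V).obj k ⟶ (labelComplex (subgroupLabels p W) V).obj k :=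
  spaceComplexMap (subgroupToSingular p (regular W)) V k

theorem restrictSingular_surjective (V : GModule W) (k : ℕ) (S : GSet W) :
    Function.Surjective ((restrictSingular V k).app (op S)).hom := by
  classical
  intro φ
  let lift : ∀ σ : Fin (k + 1) →o Labelled (regular W) (pointLabels W) S,
      MulAction.stabilizer W (chainPoint σ) ≠ ⊥ →
        (Fin (k + 1) →o Labelled (regular W) (singularLabels W) S) := fun σ h =>
    ⟨fun i => ⟨(σ i).vertex, (σ i).label, (σ i).point, by
      rw [point_eq_chainPoint]
      exact h⟩, σ.monotone⟩
  refine ⟨⟨fun (σ : Fin (k + 1) →o Labelled (regular W) (pointLabels W) S) =>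
    if h : MulAction.stabilizer W (chainPoint σ) ≠ ⊥ then φ.1 (lift σ h) else 0, ?_⟩, ?_⟩
  · intro w (σ : Fin (k + 1) →o Labelled (regular W) (pointLabels W) S)
    beta_reduce
    by_cases h : MulAction.stabilizer W (chainPoint σ) = ⊥
    · refine (dif_neg fun h' => h' ((stabilizer_smul_eq_bot_iff w (chainPoint σ)).2 h)).trans ?_
      have h0 : (0 : V.V) = if h : MulAction.stabilizer W (chainPoint σ) ≠ ⊥ then φ.1 (lift σ h)
          else 0 := by
        rw [dif_neg (not_not.2 h)]
      exact (map_zero (V.act w)).symm.trans (congrArg _ h0)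
    · refine (dif_pos fun h' => h ((stabilizer_smul_eq_bot_iff w (chainPoint σ)).1 h')).trans ?_
      refine Eq.trans ?_ (congrArg _ (dif_pos h).symm)
      exact φ.2 w (lift σ h)
  · refine Subtype.ext (funext fun
      (σ : Fin (k + 1) →o Labelled (regular W) (singularLabels W) S) => ?_)
    exact dif_pos (σ 0).ok

/-- The cochains of the free part of a `W`-space are computed by a total complex. -/
def freeToTotal (V : GModule W) (Y : GSpace W) :
    (∀ n : ℕ, (freeCochains V).obj (op (Y _⦋n⦌))) →+
      (∀ n k, ((relativeComplex V).obj k).obj (op (Y _⦋n⦌))) :=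
  piMap (R := fun n => (freeCochains V).obj (op (Y _⦋n⦌)))
    (R' := fun n => ∀ k, ((relativeComplex V).obj k).obj (op (Y _⦋n⦌)))
    fun n => (singleZero fun k => ((relativeComplex V).obj k).obj (op (Y _⦋n⦌))).comp
      ((freeToRelative V).app (op (Y _⦋n⦌))).hom

theorem freeToTotal_coface (V : GModule W) (Y : GSpace W) (n : ℕ)
    (a : (freeCochains V).obj (op (Y _⦋n⦌))) :
    singleZero (fun k => ((relativeComplex V).obj k).obj (op (Y _⦋n + 1⦌)))
      (((freeToRelative V).app (op (Y _⦋n + 1⦌))).hom (coface (freeCochains V) Y n a)) =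
    piMap (fun k => coface ((relativeComplex V).obj k) Y n)
      (singleZero (fun k => ((relativeComplex V).obj k).obj (op (Y _⦋n⦌)))
        (((freeToRelative V).app (op (Y _⦋n⦌))).hom a)) := by
  funext k
  cases k with
  | zero => exact coface_app (freeToRelative V) Y n a
  | succ k => exact (map_zero (coface ((relativeComplex V).obj (k + 1)) Y n)).symm

theorem cochainD_eq_totD {C : Type*} [Category* C] (F : Cᵒᵖ ⥤ AddCommGrpCat.{u})
    (Y : SimplicialObject C) : cochainD F Y = totD (fun _ => 0) fun n => coface F Y n := by
  refine AddMonoidHom.ext fun a => funext fun n => ?_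
  refine Eq.trans ?_ (totD_apply _ _ a n).symm
  refine ((congrArg (· + _) (smul_zero _)).trans (zero_add _)).symm

theorem freeToTotal_d (V : GModule W) (Y : GSpace W)
    (a : ∀ n : ℕ, (freeCochains V).obj (op (Y _⦋n⦌))) :
    freeToTotal V Y (cochainD (freeCochains V) Y a) =
      totalD (relativeComplex V) Y (freeToTotal V Y a) := by
  rw [cochainD_eq_totD]
  exact piMap_totD (R := fun n => (freeCochains V).obj (op (Y _⦋n⦌)))
    (R' := fun n => ∀ k, ((relativeComplex V).obj k).obj (op (Y _⦋n⦌)))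
    (fun n a => (map_zero _).trans (freeToRelative_d V _ a).symm) (freeToTotal_coface V Y) a

theorem quasiIsoDG_freeToTotal (V : GModule W) (Y : GSpace W) :
    QuasiIsoDG (cochainD (freeCochains V) Y) (totalD (relativeComplex V) Y) (freeToTotal V Y) := by
  rw [cochainD_eq_totD]
  exact QuasiIsoDG.tot (R := fun n => (freeCochains V).obj (op (Y _⦋n⦌)))
    (R' := fun n => ∀ k, ((relativeComplex V).obj k).obj (op (Y _⦋n⦌)))
    (fun n a => funext fun k => coface_coface ((relativeComplex V).obj k) Y n (a k))
    (fun n a => (map_zero _).symm) (fun _ => rowD_coface Y _) (freeToTotal_coface V Y)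
    (coface_coface (freeCochains V) Y) (fun n => quasiIsoDG_freeToRelative V _)

theorem quasiIsoDG_total_point (V : GModule W) {Y Z : GSpace W} (f : Y ⟶ Z)
    (h : QuasiIsoDG (cochainD (fixedCochains V.V ⊥) Z)
      (cochainD (fixedCochains V.V ⊥) Y) (cochainMap (fixedCochains V.V ⊥) f)) :
    QuasiIsoDG (totalD (labelComplex (pointLabels W) V) Z)
      (totalD (labelComplex (pointLabels W) V) Y)
      (totalMap (labelComplex (pointLabels W) V) f) :=
  QuasiIsoDG.total_of_columns f fun k => quasiIsoDG_labelSpace_column (pointLabels W) (fun _ => ⊥)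
    (fun _ _ _ => le_rfl) (fun _ _ => ⟨fun _ => bot_le, fun _ => trivial⟩) V f k fun _ => h

theorem quasiIsoDG_total_subgroup (p : ℕ) (V : GModule W) {Y Z : GSpace W} (f : Y ⟶ Z)
    (h : ∀ P : Subgroup W, IsPGroup p P → QuasiIsoDG (cochainD (fixedCochains V.V P) Z)
      (cochainD (fixedCochains V.V P) Y) (cochainMap (fixedCochains V.V P) f)) :
    QuasiIsoDG (totalD (labelComplex (subgroupLabels p W) V) Z)
      (totalD (labelComplex (subgroupLabels p W) V) Y)
      (totalMap (labelComplex (subgroupLabels p W) V) f) :=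
  QuasiIsoDG.total_of_columns f fun k => quasiIsoDG_labelSpace_column (subgroupLabels p W)
    (fun P => P.1) (fun _ _ h => h) (fun _ _ => Iff.rfl) V f k fun P => h P.1 P.2.1

theorem quasiIsoDG_singularSubgroup {p : ℕ} (V : GModule W) (Y : GSpace W)
    (hY : ∀ n (y : (Y _⦋n⦌).V), IsPGroup p (MulAction.stabilizer W y)) :
    QuasiIsoDG (totalD (labelComplex (singularLabels W) V) Y)
      (totalD (labelComplex (subgroupLabels p W) V) Y) (totalRowMap (singularSubgroup p V) Y) :=
  QuasiIsoDG.total_of_rows Y fun n =>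
    quasiIsoDG_subgroupToSingular (regular W) V (Y _⦋n⦌) (hY n)

theorem relativeComplex_exact (V : GModule W) (Y : GSpace W)
    (a : ∀ n k, ((labelComplex (pointLabels W) V).obj k).obj (op (Y _⦋n⦌))) :
    totalRowMap (restrictSingular V) Y a = 0 ↔
      ∃ b, totalRowMap (P := relativeComplex V) (kernelInclusion _ _) Y b = a := by
  constructor
  · exact fun h => ⟨fun n k => ⟨a n k, congrFun (congrFun h n) k⟩, rfl⟩
  · rintro ⟨b, rfl⟩
    exact funext fun n => funext fun k => (b n k).2

theorem kernelInclusion_injective (V : GModule W) (Y : GSpace W) : Function.Injective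
    (totalRowMap (P := relativeComplex V) (Q := labelComplex (pointLabels W) V)
      (kernelInclusion _ _) Y) :=
  fun _ _ h => funext fun n => funext fun k => Subtype.ext (congrFun (congrFun h n) k)

theorem totalRowMap_restrictSingular_surjective (V : GModule W) (Y : GSpace W) :
    Function.Surjective (totalRowMap (restrictSingular V) Y) := fun b =>
  ⟨fun n k => (restrictSingular_surjective V k (Y _⦋n⦌) (b n k)).choose,
    funext fun n => funext fun k => (restrictSingular_surjective V k (Y _⦋n⦌) (b n k)).choose_spec⟩

/-- Maps of `W`-spaces whose isotropy groups are `p`-groups that are equivalences on the fixed points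
of all `p`-subgroups are equivalences on free parts. -/
theorem quasiIsoDG_freeCochains {p : ℕ} (V : GModule W) {Y Z : GSpace W} (f : Y ⟶ Z)
    (hY : ∀ n (y : (Y _⦋n⦌).V), IsPGroup p (MulAction.stabilizer W y))
    (hZ : ∀ n (z : (Z _⦋n⦌).V), IsPGroup p (MulAction.stabilizer W z))
    (h : ∀ P : Subgroup W, IsPGroup p P → QuasiIsoDG (cochainD (fixedCochains V.V P) Z)
      (cochainD (fixedCochains V.V P) Y) (cochainMap (fixedCochains V.V P) f)) :
    QuasiIsoDG (cochainD (freeCochains V) Z) (cochainD (freeCochains V) Y)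
      (cochainMap (freeCochains V) f) := by
  refine (QuasiIsoDG.square_iff (cochainMap_cochainD _ f)
    (totalMap_totalD (P := relativeComplex V) f) (freeToTotal_d V Z) (freeToTotal_d V Y) ?_
    (quasiIsoDG_freeToTotal V Z) (quasiIsoDG_freeToTotal V Y)).2 ?_
  · intro a
    funext n k
    cases k with
    | zero => rfl
    | succ k => exact map_zero (pullbackHom ((relativeComplex V).obj (k + 1)) (f.app (op ⦋n⦌)))
  · refine QuasiIsoDG.ker (totalD_totalD Z) (totalD_totalD Y) (totalMap_totalD f)
      (totalRowMap_totalD (fun _ => rfl) Z) (totalRowMap_totalD (fun _ => rfl) Y)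
      (totalRowMap_totalD (spaceComplexMap_d _ V) Z) (totalRowMap_totalD (spaceComplexMap_d _ V) Y)
      (kernelInclusion_injective V Z) (kernelInclusion_injective V Y)
      (relativeComplex_exact V Z) (relativeComplex_exact V Y)
      (totalRowMap_restrictSingular_surjective V Z) (totalRowMap_restrictSingular_surjective V Y)
      (fun a => (totalRowMap_totalMap (restrictSingular V) f a).symm)
      (fun a => totalRowMap_totalMap _ f a)
      (quasiIsoDG_total_point V f (h ⊥ IsPGroup.of_bot)) ?_
    refine (QuasiIsoDG.square_iff (totalMap_totalD f) (totalMap_totalD f)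
      (totalRowMap_totalD (spaceComplexMap_d _ V) Z) (totalRowMap_totalD (spaceComplexMap_d _ V) Y)
      (fun a => (totalRowMap_totalMap (singularSubgroup p V) f a).symm)
      (quasiIsoDG_singularSubgroup V Z hZ) (quasiIsoDG_singularSubgroup V Y hY)).2
        (quasiIsoDG_total_subgroup p V f h)

/-- If `Z → X` is an equivalence on the fixed points of all `p`-subgroups, if the isotropy groups of
`Z` are `p`-groups, and if restriction to chains labelled by chains of nontrivial `p`-subgroups is
an equivalence for each of the sets of simplices of `X`, then the cochains of the free part of `Z`
are acyclic. -/
theorem freeCochains_acyclic {p : ℕ} (V : GModule W) {Z X : GSpace W} (f : Z ⟶ X)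
    (hZ : ∀ n (z : (Z _⦋n⦌).V), IsPGroup p (MulAction.stabilizer W z))
    (h : ∀ P : Subgroup W, IsPGroup p P → QuasiIsoDG (cochainD (fixedCochains V.V P) X)
      (cochainD (fixedCochains V.V P) Z) (cochainMap (fixedCochains V.V P) f))
    (hX : ∀ n, QuasiIsoDG (rowD (labelComplex (pointLabels W) V) (X _⦋n⦌))
      (rowD (labelComplex (subgroupLabels p W) V) (X _⦋n⦌))
      (rowMap (restrictSubgroup p V) (X _⦋n⦌)))
    (a : ∀ n : ℕ, (freeCochains V).obj (op (Z _⦋n⦌))) (ha : cochainD (freeCochains V) Z a = 0) :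
    ∃ b, cochainD (freeCochains V) Z b = a := by
  have h1 : QuasiIsoDG (totalD (labelComplex (pointLabels W) V) Z)
      (totalD (labelComplex (subgroupLabels p W) V) Z) (totalRowMap (restrictSubgroup p V) Z) :=
    (QuasiIsoDG.square_iff (totalRowMap_totalD (spaceComplexMap_d _ V) X)
      (totalRowMap_totalD (spaceComplexMap_d _ V) Z) (totalMap_totalD f) (totalMap_totalD f)
      (fun a => totalRowMap_totalMap (restrictSubgroup p V) f a)
      (quasiIsoDG_total_point V f (h ⊥ IsPGroup.of_bot)) (quasiIsoDG_total_subgroup p V f h)).1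
        (QuasiIsoDG.total_of_rows X hX)
  have h2 : QuasiIsoDG (totalD (labelComplex (pointLabels W) V) Z)
      (totalD (labelComplex (singularLabels W) V) Z) (totalRowMap (restrictSingular V) Z) :=
    QuasiIsoDG.of_comp_left (totalRowMap_totalD (spaceComplexMap_d _ V) Z)
      (totalRowMap_totalD (spaceComplexMap_d _ V) Z) (quasiIsoDG_singularSubgroup V Z hZ) h1
  have h3 := QuasiIsoDG.ker_acyclic (totalD_totalD Z)
    (totalRowMap_totalD (P := relativeComplex V) (f := kernelInclusion _ _) (fun _ => rfl) Z)
    (totalRowMap_totalD (spaceComplexMap_d _ V) Z) (kernelInclusion_injective V Z)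
    (relativeComplex_exact V Z) (totalRowMap_restrictSingular_surjective V Z) h2
    (freeToTotal V Z a) (by rw [← freeToTotal_d, ha, map_zero])
  obtain ⟨b, hb⟩ := h3
  obtain ⟨c, -, hc, -⟩ := quasiIsoDG_freeToTotal V Z a b ha hb.symm
  exact ⟨c, hc⟩

end Comparison

/-! ### Reduction to stabilizers -/

section Stabilizers

open Simplicial

theorem QuasiIsoDG.of_jointly_bijective {ι : Type*} {V V' : Type*} [AddCommGroup V] [AddCommGroup V']
    {U U' : ι → Type*} [∀ o, AddCommGroup (U o)] [∀ o, AddCommGroup (U' o)] {d : V →+ V}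
    {d' : V' →+ V'} {f : V →+ V'} {e : ∀ o, U o →+ U o} {e' : ∀ o, U' o →+ U' o}
    {g : ∀ o, U o →+ U' o} (α : ∀ o, V →+ U o) (α' : ∀ o, V' →+ U' o)
    (hα : ∀ o a, α o (d a) = e o (α o a)) (hα' : ∀ o a, α' o (d' a) = e' o (α' o a))
    (hf : ∀ o a, α' o (f a) = g o (α o a)) (hb : Function.Bijective fun a o => α o a)
    (hb' : Function.Bijective fun a o => α' o a) (h : ∀ o, QuasiIsoDG (e o) (e' o) (g o)) :
    QuasiIsoDG d d' f := by
  intro a a' ha haa'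
  choose b b' hbb hbb' using fun o => h o (α o a) (α' o a') (by rw [← hα, ha, map_zero])
    (by rw [← hf, haa', hα'])
  obtain ⟨c, hc⟩ := hb.2 b
  obtain ⟨c', hc'⟩ := hb'.2 b'
  refine ⟨c, c', hb.1 (funext fun o => ?_), hb'.1 (funext fun o => ?_)⟩
  · have h1 : α o c = b o := congrFun hc o
    beta_reduce
    rw [hα, h1, hbb]
  · have h1 : α o c = b o := congrFun hc o
    have h1' : α' o c' = b' o := congrFun hc' o
    beta_reduce
    rw [map_sub, hf, hα', h1, h1', hbb']

variable {W H : Type u} [Group W] [Group H] (j : H →* W)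

/-- Restriction of a module along a homomorphism of groups. -/
def GModule.res (V : GModule W) : GModule H := (Action.res _ j).obj V

/-- Restriction of a set with an action along a homomorphism of groups. -/
def GSet.res (S : GSet W) : GSet H := (Action.res _ j).obj S

/-- Restriction of labels along a homomorphism of groups. -/
def Labels.res (Λ : Labels W) : Labels H where
  Label := Λ.Label
  preorder := Λ.preorder
  action := MulAction.compHom _ j
  smul_mono h := Λ.smul_mono (j h)
  ok l K := Λ.ok l (K.map j)
  ok_mono hK h := Λ.ok_mono (Subgroup.map_mono hK) h
  ok_smul h l K hl := by
    have e : (K.map (MulAut.conj h).toMonoidHom).map j =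
        (K.map j).map (MulAut.conj (j h)).toMonoidHom := by
      rw [Subgroup.map_map, Subgroup.map_map]
      congr 1
      ext x
      simp
    rw [e]
    exact Λ.ok_smul (j h) hl

variable (H) in
/-- The `H`-set with a single point. -/
def GSet.pt : GSet H :=
  letI : MulAction H PUnit.{u + 1} :=
    { smul := fun _ x => x, one_smul := fun _ => rfl, mul_smul := fun _ _ _ => rfl }
  Action.ofMulAction H PUnit

theorem stabilizer_pt (x : (GSet.pt H).V) : MulAction.stabilizer H x = ⊤ :=
  top_le_iff.1 fun _ _ => rfl

variable {j} in
/-- Pulling back an equivariant map along a map that is equivariant for a homomorphism of groups. -/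
def changeOfGroup (V : GModule W) {S : GSet W} {T : GSet H} (m : T.V → S.V)
    (hm : ∀ (h : H) (t : T.V), m (h • t) = j h • m t) :
    equivariantMaps V S →+ equivariantMaps (V.res j) T where
  toFun φ := ⟨fun t => φ.1 (m t), fun h t => (congrArg φ.1 (hm h t)).trans (φ.2 (j h) _)⟩
  map_zero' := rfl
  map_add' _ _ := rfl

variable {j} in
theorem changeOfGroup_coface (V : GModule W) {X : GSpace W} {Y : GSpace H}
    (m : ∀ k : ℕ, (Y _⦋k⦌).V → (X _⦋k⦌).V)
    (hm : ∀ k (h : H) (t : (Y _⦋k⦌).V), m k (h • t) = j h • m k t)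
    (hδ : ∀ k (i : Fin (k + 2)) (y : (Y _⦋k + 1⦌).V),
      (X.δ i).hom (m (k + 1) y) = m k ((Y.δ i).hom y)) (k : ℕ)
    (φ : (twistedCochains V).obj (op (X _⦋k⦌))) :
    changeOfGroup V (m (k + 1)) (hm (k + 1)) (coface (twistedCochains V) X k φ) =
      coface (twistedCochains (V.res j)) Y k (changeOfGroup V (m k) (hm k) φ) := by
  refine Subtype.ext (funext fun y => ?_)
  refine (coface_twistedCochains_apply V X k φ (m (k + 1) y)).trans
    (Eq.trans ?_ (coface_twistedCochains_apply (V.res j) Y k _ y).symm)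
  refine Finset.sum_congr rfl fun i _ => congrArg _ ?_
  exact congrArg (Subtype.val φ) (hδ k i y)

/-- The labelled points over a single point with stabilizer the image of `j`. -/
abbrev localSpace (T : GSet H) (Λ : Labels W) : GSpace H :=
  (labelSpace T (Λ.res j)).obj (GSet.pt H)

variable {j}

theorem ok_of_res {Λ : Labels W} {S : GSet W} {s : S.V} (hj : j.range = MulAction.stabilizer W s)
    {T : GSet H} (x : Labelled T (Λ.res j) (GSet.pt H)) :
    Λ.ok x.label (MulAction.stabilizer W s) := by
  have h : Λ.ok x.label ((MulAction.stabilizer H x.point).map j) := x.ok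
  rwa [stabilizer_pt, ← MonoidHom.range_eq_map, hj] at h

/-- The inclusion of the labelled points over a given point with stabilizer the image of `j`. -/
def localInclusion (Λ : Labels W) {S : GSet W} {s : S.V}
    (hj : j.range = MulAction.stabilizer W s) (k : ℕ)
    (σ : Fin (k + 1) →o Labelled ((regular W).res j) (Λ.res j) (GSet.pt H)) :
    Fin (k + 1) →o Labelled (regular W) Λ S :=
  ⟨fun i => ⟨(σ i).vertex, (σ i).label, s, ok_of_res hj (σ i)⟩,
    fun _ _ h => ⟨(σ.monotone h).1, rfl⟩⟩

theorem localInclusion_smul (Λ : Labels W) {S : GSet W} {s : S.V}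
    (hj : j.range = MulAction.stabilizer W s) (k : ℕ) (h : H)
    (σ : Fin (k + 1) →o Labelled ((regular W).res j) (Λ.res j) (GSet.pt H)) :
    localInclusion Λ hj k (h • σ) = j h • localInclusion Λ hj k σ := by
  have hs : j h • s = s := by
    have : j h ∈ MulAction.stabilizer W s := hj ▸ ⟨h, rfl⟩
    exact this
  exact OrderHom.ext _ _ (funext fun i => Labelled.ext rfl rfl hs.symm)

theorem localInclusion_injective (Λ : Labels W) {S : GSet W} {s : S.V}
    (hj : j.range = MulAction.stabilizer W s) (k : ℕ) :
    Function.Injective (localInclusion (j := j) Λ hj k) := fun σ τ h =>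
  OrderHom.ext _ _ (funext fun i => by
    have hv := congrArg (fun ρ : Fin (k + 1) →o Labelled (regular W) Λ S => (ρ i).vertex) h
    have hl := congrArg (fun ρ : Fin (k + 1) →o Labelled (regular W) Λ S => (ρ i).label) h
    exact Labelled.ext hv hl rfl)

theorem exists_localInclusion (Λ : Labels W) {S : GSet W} {s : S.V}
    (hj : j.range = MulAction.stabilizer W s) (k : ℕ)
    (σ : Fin (k + 1) →o Labelled (regular W) Λ S) (hσ : chainPoint σ = s) :
    ∃ τ, localInclusion (j := j) Λ hj k τ = σ := by
  have hp : ∀ i, (σ i).point = s := fun i => (point_eq_chainPoint σ i).trans hσ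
  refine ⟨⟨fun i => ⟨(σ i).vertex, (σ i).label, PUnit.unit, ?_⟩,
    fun _ _ h => ⟨(σ.monotone h).1, rfl⟩⟩,
    OrderHom.ext _ _ (funext fun i => Labelled.ext rfl rfl (hp i).symm)⟩
  have h : MulAction.stabilizer W (σ i).point =
      (MulAction.stabilizer H (show (GSet.pt H).V from PUnit.unit)).map j := by
    rw [hp i, stabilizer_pt, ← MonoidHom.range_eq_map, hj]
  exact h.subst (motive := fun K => Λ.ok (σ i).label K) (σ i).ok

/-- Restriction of cochains to the labelled points over a given point. -/
def localRestriction (V : GModule W) (Λ : Labels W) {S : GSet W} {s : S.V}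
    (hj : j.range = MulAction.stabilizer W s) :
    (∀ k, ((labelComplex Λ V).obj k).obj (op S)) →+
      (∀ k : ℕ, (twistedCochains (V.res j)).obj (op ((localSpace j ((regular W).res j) Λ) _⦋k⦌))) :=
  piMap fun k => changeOfGroup V (localInclusion Λ hj k) (localInclusion_smul Λ hj k)

theorem localRestriction_d (V : GModule W) (Λ : Labels W) {S : GSet W} {s : S.V}
    (hj : j.range = MulAction.stabilizer W s) (a : ∀ k, ((labelComplex Λ V).obj k).obj (op S)) :
    localRestriction V Λ hj (rowD (labelComplex Λ V) S a) =
      cochainD (twistedCochains (V.res j)) (localSpace j ((regular W).res j) Λ)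
        (localRestriction V Λ hj a) :=
  piMap_seqD (fun k a => changeOfGroup_coface (X := (labelSpace (regular W) Λ).obj S)
    (Y := localSpace j ((regular W).res j) Λ) V (fun k => localInclusion Λ hj k)
    (fun k => localInclusion_smul Λ hj k) (fun _ _ _ => rfl) k a) a


theorem smul_eq_of_localInclusion {Λ : Labels W} {S : GSet W} {s s' : S.V}
    (hj : j.range = MulAction.stabilizer W s) {H' : Type u} [Group H'] {j' : H' →* W}
    (hj' : j'.range = MulAction.stabilizer W s') {k : ℕ}
    (τ : Fin (k + 1) →o Labelled ((regular W).res j) (Λ.res j) (GSet.pt H))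
    (τ' : Fin (k + 1) →o Labelled ((regular W).res j') (Λ.res j') (GSet.pt H')) {w : W}
    (h : w • localInclusion Λ hj k τ = localInclusion Λ hj' k τ') : w • s = s' :=
  congrArg (fun σ : Fin (k + 1) →o Labelled (regular W) Λ S => (σ 0).point) h

theorem GSet.out_eq_of_smul_eq {S : GSet W} {o o' : S.Orbits} {w : W}
    (h : w • (Quotient.out o : S.V) = Quotient.out o') : o = o' := by
  rw [← Quotient.out_eq o, ← Quotient.out_eq o', ← h]
  exact Quotient.sound ((MulAction.orbitRel W S.V).symm' ⟨w, rfl⟩)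

theorem GSet.exists_smul_out {S : GSet W} (s : S.V) :
    ∃ (w : W) (o : S.Orbits), w • (Quotient.out o : S.V) = s := by
  obtain ⟨w, hw⟩ := (MulAction.orbitRel W S.V).symm' (@Quotient.mk_out _ (MulAction.orbitRel W S.V) s)
  exact ⟨w, _, hw⟩

/-- An equivariant cochain on labelled points amounts to a family of equivariant cochains for the
stabilizers of representatives of the orbits. -/
theorem localRestriction_bijective (V : GModule W) (Λ : Labels W) {S : GSet W} {H : S.V → Type u}
    [∀ s, Group (H s)] (j : ∀ s, H s →* W)
    (hj : ∀ s, (j s).range = MulAction.stabilizer W s) :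
    Function.Bijective fun a (o : S.Orbits) => localRestriction V Λ (hj (Quotient.out o)) a := by
  constructor
  · intro a a' h
    refine funext fun k => Subtype.ext (funext fun
      (σ : Fin (k + 1) →o Labelled (regular W) Λ S) => ?_)
    obtain ⟨w, o, hw⟩ := GSet.exists_smul_out (chainPoint σ)
    obtain ⟨τ, hτ⟩ := exists_localInclusion Λ (hj (Quotient.out o)) k (w⁻¹ • σ)
      (inv_smul_eq_iff.2 hw.symm)
    have hσ : w • localInclusion Λ (hj (Quotient.out o)) k τ = σ := by
      rw [hτ, smul_inv_smul]
    rw [← hσ]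
    refine ((a k).2 w _).trans (Eq.trans (congrArg (V.act w) ?_) ((a' k).2 w _).symm)
    exact congrFun (congrArg Subtype.val (congrFun (congrFun h o) k)) τ
  · intro b
    suffices H : ∀ k, ∃ φ : ((labelComplex Λ V).obj k).obj (op S), ∀ (o : S.Orbits) τ,
        φ.1 (localInclusion Λ (hj (Quotient.out o)) k τ) = (b o k).1 τ by
      choose φ hφ using H
      exact ⟨φ, funext fun o => funext fun k => Subtype.ext (funext fun τ => hφ k o τ)⟩
    intro k
    classical
    let I := Σ o : S.Orbits, (Fin (k + 1) →o Labelled ((regular W).res (j (Quotient.out o)))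
      (Λ.res (j (Quotient.out o))) (GSet.pt (H (Quotient.out o))))
    let m : I → (Fin (k + 1) →o Labelled (regular W) Λ S) := fun x =>
      localInclusion Λ (hj (Quotient.out x.1)) k x.2
    let ψ₀ : I → V.V := fun x => (b x.1 k).1 x.2
    -- the prescribed values are compatible with translations
    have key : ∀ (x x' : I) (w : W), w • m x = m x' → ψ₀ x' = V.act w (ψ₀ x) := by
      rintro ⟨o, τ⟩ ⟨o', τ'⟩ w h
      have hw := smul_eq_of_localInclusion _ _ τ τ' h
      obtain rfl := GSet.out_eq_of_smul_eq hw
      have hw' : w ∈ (j (Quotient.out o)).range := by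
        rw [hj]
        exact hw
      obtain ⟨g, rfl⟩ := hw'
      have hτ : g • τ = τ' := localInclusion_injective Λ (hj _) k
        ((localInclusion_smul Λ (hj _) k g τ).trans h)
      rw [← hτ]
      exact (b o k).2 g τ
    let ψ : (Fin (k + 1) →o Labelled (regular W) Λ S) → V.V := fun σ =>
      if h : ∃ x, m x = σ then ψ₀ h.choose else 0
    have hψ : ∀ x, ψ (m x) = ψ₀ x := fun x => by
      have h : ∃ x', m x' = m x := ⟨x, rfl⟩
      refine (dif_pos h).trans ?_
      have := key _ _ 1 ((one_smul W _).trans h.choose_spec)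
      rw [this, GModule.act_one]
    obtain ⟨φ, hφ⟩ := exists_equivariantMap V
      (S := ((labelSpace (regular W) Λ).obj S).obj (op ⦋k⦌)) (Set.range m)
      (fun (σ : Fin (k + 1) →o Labelled (regular W) Λ S) => by
        obtain ⟨w, o, hw⟩ := GSet.exists_smul_out (chainPoint σ)
        obtain ⟨τ, hτ⟩ := exists_localInclusion Λ (hj (Quotient.out o)) k (w⁻¹ • σ)
          (inv_smul_eq_iff.2 hw.symm)
        refine ⟨w, _, ⟨⟨o, τ⟩, rfl⟩, ?_⟩
        exact (congrArg (w • ·) hτ).trans (smul_inv_smul w σ)) ψ (by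
        rintro _ ⟨x, rfl⟩ _ ⟨x', rfl⟩ w h
        rw [hψ, hψ]
        exact key x x' w h)
    exact ⟨φ, fun o τ => (hφ _ ⟨⟨o, τ⟩, rfl⟩).trans (hψ ⟨o, τ⟩)⟩

variable (j) in
/-- Forgetting the nontrivial `p`-subgroups that label the points. -/
def localProjection (p : ℕ) (T : GSet H) :
    localSpace j T (subgroupLabels p W) ⟶ localSpace j T (pointLabels W) :=
  (labelSpaceMap T (Λ := (subgroupLabels p W).res j) (Λ' := (pointLabels W).res j)
    ⟨fun _ => PUnit.unit, fun _ _ _ => le_rfl⟩ (fun _ _ => rfl) fun _ _ _ => trivial).app _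

variable (j) in
/-- Replacing the vertices in `W` by vertices in the subgroup. -/
def localVertexMap (Λ : Labels W) :
    localSpace j (regular H) Λ ⟶ localSpace j ((regular W).res j) Λ :=
  orderSpaceMap
    (⟨fun x => ⟨j x.vertex, x.label, x.point, x.ok⟩, fun _ _ h => h⟩ :
      Labelled (regular H) (Λ.res j) (GSet.pt H) →o
        Labelled ((regular W).res j) (Λ.res j) (GSet.pt H))
    fun h x => Labelled.ext (map_mul j h x.vertex) rfl rfl

theorem quasiIsoDG_localVertexMap (hinj : Function.Injective j) (Λ : Labels W) (V : GModule H) :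
    QuasiIsoDG (cochainD (twistedCochains V) (localSpace j ((regular W).res j) Λ))
      (cochainD (twistedCochains V) (localSpace j (regular H) Λ))
      (cochainMap (twistedCochains V) (localVertexMap j Λ)) := by
  obtain ⟨u, hu⟩ := exists_freeVertex ((regular W).res j)
  have hu' : ∀ (h : H) (w : ((regular W).res j).V), u (h • w) = h * u w := fun h w =>
    hu h w ((Subgroup.eq_bot_iff_forall _).2 fun g hg => hinj (by
      have hg' : j g * (show W from w) = w := hg
      rw [map_one, mul_eq_right.1 hg']))
  refine quasiIsoDG_orderSpaceMap (twistedCochains V) _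
    (⟨fun x => ⟨u x.vertex, x.label, x.point, x.ok⟩, fun _ _ h => h⟩ :
      Labelled ((regular W).res j) (Λ.res j) (GSet.pt H) →o
        Labelled (regular H) (Λ.res j) (GSet.pt H)) _ ?_ ?_ ?_
  · exact fun h x => Labelled.ext (hu' h x.vertex) rfl rfl
  · exact Or.inl fun x => ⟨le_rfl, rfl⟩
  · exact Or.inl fun x => ⟨le_rfl, rfl⟩

theorem quasiIsoDG_cochainMap_of_levelwise_bijective (V : GModule H) {X Y : GSpace H} (f : X ⟶ Y)
    (hf : ∀ n : ℕ, Function.Bijective (f.app (op ⦋n⦌)).hom) :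
    QuasiIsoDG (cochainD (twistedCochains V) Y) (cochainD (twistedCochains V) X)
      (cochainMap (twistedCochains V) f) := by
  refine QuasiIsoDG.of_bijective (cochainMap_cochainD _ f) ⟨fun a a' h => funext fun n =>
    Subtype.ext (funext fun y => ?_), fun b => ?_⟩
  · obtain ⟨x, rfl⟩ := (hf n).2 y
    exact congrFun (congrArg Subtype.val (congrFun h n)) x
  · choose g hg using fun n => (hf n).2
    refine ⟨fun n => ⟨fun y => (b n).1 (g n y), fun h y => ?_⟩, funext fun n =>
      Subtype.ext (funext fun x => congrArg (b n).1 ((hf n).1 (hg n _)))⟩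
    refine Eq.trans (congrArg (b n).1 ((hf n).1 ?_)) ((b n).2 h (g n y))
    exact (hg n _).trans ((congrArg (h • ·) (hg n y)).symm.trans
      (GSet.hom_smul (f.app (op ⦋n⦌)) h (g n y)).symm)

variable (j) in
/-- `EH`, as a space of labelled points. -/
def universalToLocal : universalSpace H ⟶ localSpace j (regular H) (pointLabels W) where
  app n :=
    { hom := ↾fun (x : Fin (n.unop.len + 1) → H) =>
        (⟨fun i => ⟨x i, PUnit.unit, PUnit.unit, trivial⟩, fun _ _ _ => ⟨le_rfl, rfl⟩⟩ :
          Fin (n.unop.len + 1) →o Labelled (regular H) ((pointLabels W).res j) (GSet.pt H))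
      comm := fun _ => rfl }
  naturality _ _ _ := rfl

/-- The image of a nontrivial `p`-subgroup under an injective homomorphism. -/
def NontrivialPSubgroup.map (hinj : Function.Injective j) (p : ℕ) (P : NontrivialPSubgroup p H) :
    NontrivialPSubgroup p W :=
  ⟨P.1.map j, P.2.1.map j, fun h => P.2.2 ((Subgroup.map_eq_bot_iff_of_injective _ hinj).1 h)⟩

/-- The chains of nontrivial `p`-subgroups of `H` with vertices in `H`, as labelled points. -/
def prodToLocal (hinj : Function.Injective j) (p : ℕ) :
    (universalSpace H).prod (pSubgroupSpace p H) ⟶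
      localSpace j (regular H) (subgroupLabels p W) where
  app n :=
    { hom := ↾fun (x : (Fin (n.unop.len + 1) → H) ×
          (Fin (n.unop.len + 1) ⥤ NontrivialPSubgroup p H)) =>
        (⟨fun i => ⟨x.1 i, (x.2.obj i).map hinj, PUnit.unit, Subgroup.map_mono
            (le_trans le_top (stabilizer_pt (show (GSet.pt H).V from PUnit.unit)).ge)⟩,
          fun _ _ h => ⟨Subgroup.map_mono (x.2.map (homOfLE h)).le, rfl⟩⟩ :
          Fin (n.unop.len + 1) →o Labelled (regular H) ((subgroupLabels p W).res j) (GSet.pt H))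
      comm := fun w => by
        ext x
        refine OrderHom.ext _ _ (funext fun i => Labelled.ext rfl (Subtype.ext ?_) rfl)
        change ((x.2.obj i).1.map (MulAut.conj w).toMonoidHom).map j =
          ((x.2.obj i).1.map j).map (MulAut.conj (j w)).toMonoidHom
        rw [Subgroup.map_map, Subgroup.map_map]
        congr 1
        ext y
        simp }
  naturality _ _ _ := rfl

theorem universalToLocal_bijective (n : ℕ) :
    Function.Bijective ((universalToLocal j).app (op ⦋n⦌)).hom := by
  constructor
  · intro x y h
    exact funext fun i => congrArg (fun σ : Fin (n + 1) →o
      Labelled (regular H) ((pointLabels W).res j) (GSet.pt H) => (σ i).vertex) h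
  · intro (σ : Fin (n + 1) →o Labelled (regular H) ((pointLabels W).res j) (GSet.pt H))
    exact ⟨fun i => (σ i).vertex, rfl⟩

theorem prodToLocal_bijective (hinj : Function.Injective j) (p : ℕ) (n : ℕ) :
    Function.Bijective ((prodToLocal hinj p).app (op ⦋n⦌)).hom := by
  constructor
  · intro (x : (Fin (n + 1) → H) × (Fin (n + 1) ⥤ NontrivialPSubgroup p H))
      (y : (Fin (n + 1) → H) × (Fin (n + 1) ⥤ NontrivialPSubgroup p H)) h
    refine Prod.ext (funext fun i => congrArg (fun σ : Fin (n + 1) →o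
      Labelled (regular H) ((subgroupLabels p W).res j) (GSet.pt H) => (σ i).vertex) h)
      (CategoryTheory.Functor.ext (fun i => Subtype.ext (Subgroup.map_injective hinj ?_))
        fun _ _ _ => Subsingleton.elim _ _)
    exact congrArg (fun σ : Fin (n + 1) →o
      Labelled (regular H) ((subgroupLabels p W).res j) (GSet.pt H) =>
        (σ i).label.1) h
  · intro (σ : Fin (n + 1) →o Labelled (regular H) ((subgroupLabels p W).res j) (GSet.pt H))
    have hσ : ∀ i, ((σ i).label.1.comap j).map j = (σ i).label.1 := fun i =>
      Subgroup.map_comap_eq_self (le_trans (σ i).ok (Subgroup.map_le_range j _))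
    refine ⟨(fun i => (σ i).vertex, Monotone.functor (f := fun i =>
      ⟨(σ i).label.1.comap j, (σ i).label.2.1.comap_of_injective j hinj, fun h =>
        (σ i).label.2.2 (by rw [← hσ i, h, Subgroup.map_bot])⟩)
        fun _ _ h => Subgroup.comap_mono (σ.monotone h).1), ?_⟩
    exact OrderHom.ext _ _ (funext fun i => Labelled.ext rfl (Subtype.ext (hσ i)) rfl)

theorem quasiIsoDG_localProjection (hinj : Function.Injective j) (p : ℕ) (V : GModule H)
    (h : QuasiIsoDG (cochainD (twistedCochains V) (universalSpace H))
      (cochainD (twistedCochains V) ((universalSpace H).prod (pSubgroupSpace p H)))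
      (cochainMap (twistedCochains V) (GSpace.fst (universalSpace H) (pSubgroupSpace p H)))) :
    QuasiIsoDG (cochainD (twistedCochains V) (localSpace j ((regular W).res j) (pointLabels W)))
      (cochainD (twistedCochains V) (localSpace j ((regular W).res j) (subgroupLabels p W)))
      (cochainMap (twistedCochains V) (localProjection j p ((regular W).res j))) := by
  refine (QuasiIsoDG.square_iff (cochainMap_cochainD _ _) (cochainMap_cochainD _ _)
    (cochainMap_cochainD _ (localVertexMap j (pointLabels W)))
    (cochainMap_cochainD _ (localVertexMap j (subgroupLabels p W))) (fun _ => rfl)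
    (quasiIsoDG_localVertexMap hinj _ V) (quasiIsoDG_localVertexMap hinj _ V)).2
    ((QuasiIsoDG.square_iff (cochainMap_cochainD _ (localProjection j p (regular H)))
      (cochainMap_cochainD _ _)
      (cochainMap_cochainD _ (universalToLocal j))
      (cochainMap_cochainD _ (prodToLocal hinj p)) (fun _ => rfl)
      (quasiIsoDG_cochainMap_of_levelwise_bijective V _ universalToLocal_bijective)
      (quasiIsoDG_cochainMap_of_levelwise_bijective V _ (prodToLocal_bijective hinj p))).2 h)

/-- Restriction to the chains labelled by chains of nontrivial `p`-subgroups is an equivalence if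
it is one for each stabilizer. -/
theorem quasiIsoDG_restrictSubgroup (p : ℕ) (V : GModule W) (S : GSet W)
    (h : ∀ s : S.V, ∃ (H : Type u) (_ : Group H) (j : H →* W), Function.Injective j ∧
      j.range = MulAction.stabilizer W s ∧
      QuasiIsoDG (cochainD (twistedCochains (V.res j)) (universalSpace H))
        (cochainD (twistedCochains (V.res j)) ((universalSpace H).prod (pSubgroupSpace p H)))
        (cochainMap (twistedCochains (V.res j))
          (GSpace.fst (universalSpace H) (pSubgroupSpace p H)))) :
    QuasiIsoDG (rowD (labelComplex (pointLabels W) V) S)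
      (rowD (labelComplex (subgroupLabels p W) V) S) (rowMap (restrictSubgroup p V) S) := by
  choose H _ j hinj hj hq using h
  exact QuasiIsoDG.of_jointly_bijective
    (fun o : S.Orbits => localRestriction V (pointLabels W) (hj (Quotient.out o)))
    (fun o => localRestriction V (subgroupLabels p W) (hj (Quotient.out o)))
    (fun o => localRestriction_d V _ _) (fun o => localRestriction_d V _ _) (fun o a => rfl)
    (localRestriction_bijective V _ j hj) (localRestriction_bijective V _ j hj)
    fun o => quasiIsoDG_localProjection (hinj _) p _ (hq _)

end Stabilizers

/-! ### Fixed points with the action of the Weyl group -/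

section WeylGroup

open Simplicial

variable {G : Type u} [Group G]

/-- The action of the normalizer of `D` on the `D`-fixed points of a `G`-set. -/
instance normalizerFixedAction (D : Subgroup G) (S : GSet G) :
    MulAction (normalizerIn ⊤ D) {s : S.V // ∀ k ∈ D, k • s = s} where
  smul n s := ⟨(n : G) • s.1, fun k hk => by
    have h := (Subgroup.mem_normalizer_iff''.mp n.2.2 k).mp hk
    have h' : k * n = n * ((n : G)⁻¹ * k * n) := by group
    rw [← mul_smul, h', mul_smul, s.2 _ h]⟩
  one_smul s := Subtype.ext (one_smul G s.1)
  mul_smul m n s := Subtype.ext (mul_smul (m : G) (n : G) s.1)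

/-- The action of `N(D) / D` on the `D`-fixed points of a `G`-set. -/
instance weylFixedAction (D : Subgroup G) (S : GSet G) :
    MulAction (weyl ⊤ D) {s : S.V // ∀ k ∈ D, k • s = s} :=
  MulAction.compHom _ (QuotientGroup.lift (D.subgroupOf (normalizerIn ⊤ D))
    (MulAction.toPermHom (normalizerIn ⊤ D) {s : S.V // ∀ k ∈ D, k • s = s})
    fun n hn => Equiv.ext fun s => Subtype.ext (s.2 n hn))

/-- The functor of `D`-fixed points, with the action of `N(D) / D`. -/
def weylFixed (D : Subgroup G) : GSet G ⥤ GSet (weyl ⊤ D) where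
  obj S := Action.ofMulAction (weyl ⊤ D) {s : S.V // ∀ k ∈ D, k • s = s}
  map {S T} f :=
    { hom := ↾fun (s : {s : S.V // ∀ k ∈ D, k • s = s}) =>
        (⟨f.hom s.1, fun k hk => by rw [← GSet.hom_smul, s.2 k hk]⟩ :
          {s : T.V // ∀ k ∈ D, k • s = s})
      comm := fun w => by
        induction w using QuotientGroup.induction_on with
        | H n =>
          ext s
          exact Subtype.ext (GSet.hom_smul f (n : G) s.1) }
  map_id _ := rfl
  map_comp _ _ := rfl

/-- The preimage in `N(D)` of a subgroup of `N(D) / D`. -/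
def weylPreimage (D : Subgroup G) (P : Subgroup (weyl ⊤ D)) : Subgroup G :=
  (P.comap (QuotientGroup.mk' _)).map (normalizerIn ⊤ D).subtype

theorem le_weylPreimage (D : Subgroup G) (P : Subgroup (weyl ⊤ D)) : D ≤ weylPreimage D P :=
  fun d hd => ⟨⟨d, Subgroup.mem_top d, Subgroup.le_normalizer hd⟩, by
    change (QuotientGroup.mk' _ _) ∈ P
    have h : QuotientGroup.mk' (D.subgroupOf (normalizerIn ⊤ D))
        ⟨d, Subgroup.mem_top d, Subgroup.le_normalizer hd⟩ = 1 :=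
      (QuotientGroup.eq_one_iff _).2 hd
    rw [h]
    exact P.one_mem, rfl⟩

theorem isPGroup_weylPreimage {p : ℕ} {D : Subgroup G} (hD : IsPGroup p D)
    {P : Subgroup (weyl ⊤ D)} (hP : IsPGroup p P) : IsPGroup p (weylPreimage D P) := by
  refine IsPGroup.map (IsPGroup.comap_of_ker_isPGroup hP _ ?_) _
  rw [QuotientGroup.ker_mk']
  exact hD.comap_subtype

/-- The `P`-fixed points of the `D`-fixed points. -/
def weylFixedFixedIso (D : Subgroup G) (P : Subgroup (weyl ⊤ D)) :
    weylFixed D ⋙ fixedSet P ≅ fixedSet (weylPreimage D P) :=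
  NatIso.ofComponents (fun S => Equiv.toIso
    { toFun := fun s => ⟨s.1.1, by
        rintro _ ⟨n, hn, rfl⟩
        exact congrArg Subtype.val (s.2 (n : weyl ⊤ D) hn)⟩
      invFun := fun s => ⟨⟨s.1, fun k hk => s.2 k (le_weylPreimage D P hk)⟩, fun w hw => by
        induction w using QuotientGroup.induction_on with
        | H n => exact Subtype.ext (s.2 n ⟨n, hw, rfl⟩)⟩
      left_inv := fun _ => rfl
      right_inv := fun _ => rfl }) fun _ => rfl

/-- The `D`-fixed points of a `G`-space. -/
abbrev weylSpace (D : Subgroup G) : GSpace G ⥤ GSpace (weyl ⊤ D) :=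
  (SimplicialObject.whiskering _ _).obj (weylFixed D)

theorem quasiIsoDG_fixedCochains_weylSpace (A : Type u) [AddCommGroup A] {Y Z : GSpace G}
    (f : Y ⟶ Z) (D : Subgroup G) (P : Subgroup (weyl ⊤ D))
    (hf : IsWeakEquivalence ((fixedPoints (weylPreimage D P)).map f)) :
    QuasiIsoDG (cochainD (fixedCochains A P) ((weylSpace D).obj Z))
      (cochainD (fixedCochains A P) ((weylSpace D).obj Y))
      (cochainMap (fixedCochains A P) ((weylSpace D).map f)) :=
  quasiIsoDG_cochainMap_of_iso (F := (fixedSet (weylPreimage D P)).op ⋙ mapFunctor A)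
    (F' := (weylFixed D ⋙ fixedSet P).op ⋙ mapFunctor A)
    (Functor.isoWhiskerRight (NatIso.op (weylFixedFixedIso D P)) (mapFunctor A)) f
    (quasiIsoDG_of_isWeakEquivalence A hf)

theorem fixed_le_stabilizer {D : Subgroup G} {S : GSet G} (s : ((weylFixed D).obj S).V) :
    D ≤ MulAction.stabilizer G (show S.V from s.1) := fun k hk => s.2 k hk

theorem mk_mem_stabilizer_iff {D : Subgroup G} {S : GSet G} (s : ((weylFixed D).obj S).V)
    (n : normalizerIn ⊤ D) : (n : weyl ⊤ D) ∈ MulAction.stabilizer (weyl ⊤ D) s ↔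
      (n : G) ∈ MulAction.stabilizer G (show S.V from s.1) :=
  ⟨fun h => congrArg Subtype.val h, fun h => Subtype.ext h⟩

theorem weylPreimage_stabilizer_le {D : Subgroup G} {S : GSet G} (s : ((weylFixed D).obj S).V) :
    weylPreimage D (MulAction.stabilizer (weyl ⊤ D) s) ≤
      MulAction.stabilizer G (show S.V from s.1) := by
  rintro _ ⟨n, hn, rfl⟩
  exact (mk_mem_stabilizer_iff s n).1 hn

theorem isPGroup_stabilizer_weylFixed {p : ℕ} {D : Subgroup G} {S : GSet G}
    (s : ((weylFixed D).obj S).V)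
    (hs : IsPGroup p (MulAction.stabilizer G (show S.V from s.1))) :
    IsPGroup p (MulAction.stabilizer (weyl ⊤ D) s) := by
  have h1 := hs.to_le (weylPreimage_stabilizer_le s)
  have h2 := (h1.comap_of_injective (normalizerIn ⊤ D).subtype Subtype.val_injective).map
    (QuotientGroup.mk' (D.subgroupOf (normalizerIn ⊤ D)))
  refine h2.to_le fun w hw => ?_
  induction w using QuotientGroup.induction_on with
  | H n => exact ⟨n, ⟨n, hw, rfl⟩, rfl⟩

/-- If a point of a `G`-set that is fixed by `D` has trivial isotropy in `N(D) / D`, then it has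
isotropy `D` in `G`, provided that this isotropy group is a `p`-group: a proper subgroup of a
`p`-group is properly contained in its normalizer. -/
theorem stabilizer_eq_of_weyl_eq_bot [Finite G] {p : ℕ} [Fact p.Prime] {D : Subgroup G}
    {S : GSet G} (s : ((weylFixed D).obj S).V)
    (hs : IsPGroup p (MulAction.stabilizer G (show S.V from s.1)))
    (h : MulAction.stabilizer (weyl ⊤ D) s = ⊥) :
    MulAction.stabilizer G (show S.V from s.1) = D := by
  set Q := MulAction.stabilizer G (show S.V from s.1) with hQ
  refine le_antisymm ?_ (fixed_le_stabilizer s)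
  by_contra hlt
  have := hs.isNilpotent
  have hD : D.subgroupOf Q < ⊤ := lt_top_iff_ne_top.2 fun h' => hlt (Subgroup.subgroupOf_eq_top.1 h')
  obtain ⟨n, hn, hnD⟩ := Set.exists_of_ssubset
    (Group.normalizerCondition_of_isNilpotent (D.subgroupOf Q) hD)
  have hN : (n : G) ∈ normalizerIn ⊤ D := by
    refine ⟨Subgroup.mem_top _, Subgroup.mem_normalizer_iff.2 fun d => ?_⟩
    have h1 := Subgroup.mem_normalizer_iff.1 hn
    constructor
    · intro hd
      exact (h1 ⟨d, fixed_le_stabilizer s hd⟩).1 hd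
    · intro hd
      have hdQ : d ∈ Q := by
        have h2 := Q.mul_mem (Q.mul_mem (Q.inv_mem n.2) (fixed_le_stabilizer s hd)) n.2
        simpa [mul_assoc] using h2
      exact (h1 ⟨d, hdQ⟩).2 hd
  have h2 : ((⟨n, hN⟩ : normalizerIn ⊤ D) : weyl ⊤ D) ∈ MulAction.stabilizer (weyl ⊤ D) s :=
    (mk_mem_stabilizer_iff s ⟨n, hN⟩).2 n.2
  rw [h, Subgroup.mem_bot] at h2
  exact hnD ((QuotientGroup.eq_one_iff (⟨n, hN⟩ : normalizerIn ⊤ D)).1 h2)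

theorem weyl_eq_bot_of_stabilizer_eq {D : Subgroup G} {S : GSet G} (s : ((weylFixed D).obj S).V)
    (h : MulAction.stabilizer G (show S.V from s.1) = D) :
    MulAction.stabilizer (weyl ⊤ D) s = ⊥ := by
  refine (Subgroup.eq_bot_iff_forall _).2 fun w hw => ?_
  induction w using QuotientGroup.induction_on with
  | H n =>
    have h1 := (mk_mem_stabilizer_iff s n).1 hw
    rw [h] at h1
    exact (QuotientGroup.eq_one_iff _).2 h1

/-- The homomorphism `N_K(D) / D → N_G(D) / D`. -/
def weylInclusion (K D : Subgroup G) : weyl K D →* weyl ⊤ D :=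
  QuotientGroup.map _ _ (Subgroup.inclusion (inf_le_inf_right _ le_top)) fun _ hn => hn

theorem weylInclusion_injective (K D : Subgroup G) : Function.Injective (weylInclusion K D) :=
  (injective_iff_map_eq_one _).2 fun w hw => by
    induction w using QuotientGroup.induction_on with
    | H n => exact (QuotientGroup.eq_one_iff _).2 ((QuotientGroup.eq_one_iff
      (Subgroup.inclusion (inf_le_inf_right _ le_top) n : normalizerIn ⊤ D)).1 hw)

theorem weylInclusion_range {D : Subgroup G} {S : GSet G} (s : ((weylFixed D).obj S).V) :
    (weylInclusion (MulAction.stabilizer G (show S.V from s.1)) D).range =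
      MulAction.stabilizer (weyl ⊤ D) s := by
  ext w
  constructor
  · rintro ⟨w, rfl⟩
    induction w using QuotientGroup.induction_on with
    | H n => exact (mk_mem_stabilizer_iff s _).2 n.2.1
  · intro hw
    induction w using QuotientGroup.induction_on with
    | H n => exact ⟨((⟨n, (mk_mem_stabilizer_iff s n).1 hw, n.2.2⟩ :
        normalizerIn (MulAction.stabilizer G (show S.V from s.1)) D) : weyl _ D), rfl⟩

variable [Finite G] (M : (FinGSet G)ᵒᵖ ⥤ AddCommGrpCat.{u})

/-- The value at `G/D` of a contravariant functor, as a module over `N_K(D) / D`: an element `w`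
acts through the endomorphism of `G/D` that corresponds to `w⁻¹`. -/
def contraModule (K D : Subgroup G) : GModule (weyl K D) where
  V := M.obj (op (cosets D))
  ρ :=
    { toFun := fun w => M.map (Quiver.Hom.op (show cosets D ⟶ cosets D from weylAction K D w⁻¹))
      map_one' := by
        rw [inv_one, map_one]
        exact M.map_id _
      map_mul' := fun w w' => by
        rw [mul_inv_rev, map_mul]
        exact M.map_comp (Quiver.Hom.op (show cosets D ⟶ cosets D from weylAction K D w'⁻¹))
          (Quiver.Hom.op (show cosets D ⟶ cosets D from weylAction K D w⁻¹)) }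

theorem contraModule_res (K D : Subgroup G) :
    (contraModule M ⊤ D).res (weylInclusion K D) = contraModule M K D := by
  refine congrArg (Action.mk (M.obj (op (cosets D)))) (MonoidHom.ext fun w => ?_)
  induction w using QuotientGroup.induction_on with
  | H n => rfl

omit [Finite G] in
/-- If the isotropy groups of `Y` and `Z` are `p`-groups, and `f : Y ⟶ Z` is an equivalence on
fixed points of all `p`-subgroups that contain `D`, then it is an equivalence on the parts with
isotropy group `D`. -/
theorem quasiIsoDG_weylSpace {p : ℕ} {D : Subgroup G} (V : GModule (weyl ⊤ D)) {Y Z : GSpace G}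
    (f : Y ⟶ Z) (hY : isotropy Y ⊆ pSubgroups p G) (hZ : isotropy Z ⊆ pSubgroups p G)
    (h : ∀ P : Subgroup (weyl ⊤ D), IsPGroup p P →
      QuasiIsoDG (cochainD (fixedCochains V.V P) ((weylSpace D).obj Z))
      (cochainD (fixedCochains V.V P) ((weylSpace D).obj Y))
      (cochainMap (fixedCochains V.V P) ((weylSpace D).map f))) :
    QuasiIsoDG (cochainD (freeCochains V) ((weylSpace D).obj Z))
      (cochainD (freeCochains V) ((weylSpace D).obj Y))
      (cochainMap (freeCochains V) ((weylSpace D).map f)) :=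
  quasiIsoDG_freeCochains V _
    (fun n y => isPGroup_stabilizer_weylFixed (S := Y _⦋n⦌) y (hY ⟨_, _, rfl⟩))
    (fun n z => isPGroup_stabilizer_weylFixed (S := Z _⦋n⦌) z (hZ ⟨_, _, rfl⟩)) h

theorem freeCochains_weylFixed_eq_zero {p : ℕ} [Fact p.Prime] {D : Subgroup G}
    (V : GModule (weyl ⊤ D)) (S : GSet G)
    (hS : ∀ s : S.V, IsPGroup p (MulAction.stabilizer G s) ∧ MulAction.stabilizer G s ≠ D)
    (φ : (freeCochains V).obj (op ((weylFixed D).obj S))) : φ = 0 :=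
  Subtype.ext (funext fun s => φ.2.1 s fun h =>
    (hS s.1).2 (stabilizer_eq_of_weyl_eq_bot s (hS s.1).1 h))

/-- The map from the `𝒞`-approximation to the `𝒜`-approximation induces an equivalence on the parts
with isotropy group `D`: if `D` is in `𝒞`, because it is an equivalence on the fixed points of all
`p`-subgroups that contain `D`; otherwise, because the cochains on both sides are acyclic. -/
theorem quasiIsoDG_freeCochains_weylSpace (p : ℕ) [Fact p.Prime] (𝒞 : Set (Subgroup G))
    (h𝒞 : 𝒞 ⊆ pSubgroups p G) (hclosed : ClosedUnderPSupergroups p 𝒞) (X : GSpace G)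
    (hX : ∀ K ∈ isotropy X, ∀ D ∈ restrictTo (pSubgroups p G \ 𝒞) K,
      QuasiIsoDG (cochainD (twistedCochains (contraModule M K D)) (universalSpace (weyl K D)))
        (cochainD (twistedCochains (contraModule M K D))
          ((universalSpace (weyl K D)).prod (pSubgroupSpace p (weyl K D))))
        (cochainMap (twistedCochains (contraModule M K D))
          (GSpace.fst (universalSpace (weyl K D)) (pSubgroupSpace p (weyl K D)))))
    {X𝒜 X𝒞 : GSpace G} (a : X𝒜 ⟶ X) (ha : IsApproximation (pSubgroups p G) a)
    (f : X𝒞 ⟶ X𝒜) (hf : IsApproximation 𝒞 (f ≫ a)) (D : Subgroup G) :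
    QuasiIsoDG (cochainD (freeCochains (contraModule M ⊤ D)) ((weylSpace D).obj X𝒜))
      (cochainD (freeCochains (contraModule M ⊤ D)) ((weylSpace D).obj X𝒞))
      (cochainMap (freeCochains (contraModule M ⊤ D)) ((weylSpace D).map f)) := by
  have ha' : ∀ P : Subgroup (weyl ⊤ D), IsPGroup p D → IsPGroup p P →
      QuasiIsoDG (cochainD (fixedCochains (contraModule M ⊤ D).V P) ((weylSpace D).obj X))
        (cochainD (fixedCochains (contraModule M ⊤ D).V P) ((weylSpace D).obj X𝒜))
        (cochainMap (fixedCochains (contraModule M ⊤ D).V P) ((weylSpace D).map a)) :=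
    fun P hD hP => quasiIsoDG_fixedCochains_weylSpace _ a D P
      (ha.isWeakEquivalence _ (isPGroup_weylPreimage hD hP))
  by_cases hD𝒞 : D ∈ 𝒞
  · refine quasiIsoDG_weylSpace _ f (hf.isotropy_subset.trans h𝒞) ha.isotropy_subset fun P hP => ?_
    have hD : IsPGroup p D := h𝒞 hD𝒞
    refine QuasiIsoDG.of_comp_right (cochainMap_cochainD _ _) (cochainMap_cochainD _ _)
      (ha' P hD hP) ?_
    have hfa := quasiIsoDG_fixedCochains_weylSpace (contraModule M ⊤ D).V (f ≫ a) D P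
      (hf.isWeakEquivalence _
        (hclosed D hD𝒞 _ (le_weylPreimage D P) (isPGroup_weylPreimage hD hP)))
    have e : cochainMap (fixedCochains (contraModule M ⊤ D).V P) ((weylSpace D).map (f ≫ a)) =
        (cochainMap (fixedCochains (contraModule M ⊤ D).V P) ((weylSpace D).map f)).comp
          (cochainMap (fixedCochains (contraModule M ⊤ D).V P) ((weylSpace D).map a)) :=
      AddMonoidHom.ext fun b =>
        cochainMap_comp (fixedCochains (contraModule M ⊤ D).V P) ((weylSpace D).map f)
          ((weylSpace D).map a) b
    rwa [e] at hfa
  · have h0 : ∀ (n : ℕ) (φ : (freeCochains (contraModule M ⊤ D)).obj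
        (op (((weylSpace D).obj X𝒞) _⦋n⦌))), φ = 0 := fun n =>
      freeCochains_weylFixed_eq_zero _ (X𝒞 _⦋n⦌) fun s =>
        ⟨h𝒞 (hf.isotropy_subset ⟨_, s, rfl⟩), fun h => hD𝒞 (h ▸ hf.isotropy_subset ⟨_, s, rfl⟩)⟩
    suffices H : ∀ b, cochainD (freeCochains (contraModule M ⊤ D)) ((weylSpace D).obj X𝒜) b = 0 →
        ∃ c, cochainD (freeCochains (contraModule M ⊤ D)) ((weylSpace D).obj X𝒜) c = b by
      intro b b' hb _
      obtain ⟨c, hc⟩ := H b hb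
      exact ⟨c, 0, hc, funext fun n => (h0 n _).trans (h0 n _).symm⟩
    by_cases hD : IsPGroup p D
    · refine freeCochains_acyclic _ ((weylSpace D).map a)
        (fun n y => isPGroup_stabilizer_weylFixed (S := X𝒜 _⦋n⦌) y (ha.isotropy_subset ⟨_, _, rfl⟩))
        (fun P hP => ha' P hD hP) fun n => quasiIsoDG_restrictSubgroup p _ _ fun s => ?_
      refine ⟨weyl (MulAction.stabilizer G (show (X _⦋n⦌).V from s.1)) D, inferInstance,
        weylInclusion _ D, weylInclusion_injective _ _,
        weylInclusion_range (S := X _⦋n⦌) s, ?_⟩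
      rw [contraModule_res]
      exact hX _ ⟨_, _, rfl⟩ D ⟨⟨hD, hD𝒞⟩, fixed_le_stabilizer (S := X _⦋n⦌) s⟩
    · have h1 : ∀ (n : ℕ) (φ : (freeCochains (contraModule M ⊤ D)).obj
          (op (((weylSpace D).obj X𝒜) _⦋n⦌))), φ = 0 := fun n =>
        freeCochains_weylFixed_eq_zero _ (X𝒜 _⦋n⦌) fun s =>
          ⟨ha.isotropy_subset ⟨_, s, rfl⟩, fun h => hD (h ▸ ha.isotropy_subset ⟨_, s, rfl⟩)⟩
      exact fun b _ => ⟨0, funext fun n => (h1 n _).trans (h1 n _).symm⟩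

end WeylGroup

/-! ### The filtration of Bredon cochains by the size of orbits -/

section Filtration

open Simplicial

variable {G : Type u} [Group G] [Finite G]

/-- The orbit of a point. -/
def GSet.toOrbit {S : GSet G} (s : S.V) : S.Orbits := Quotient.mk'' s

omit [Finite G] in
theorem GSet.toOrbit_smul {S : GSet G} (g : G) (s : S.V) :
    GSet.toOrbit (g • s) = GSet.toOrbit s := Quotient.sound ⟨g, rfl⟩

/-- The map `G/D ⟶ S`, `gD ↦ g s`, given by a `D`-fixed point `s`, with values in the orbit of `s`. -/
def cosetMap {D : Subgroup G} {S : GSet G} (s : S.V) (hs : ∀ k ∈ D, k • s = s) (ω : S.Orbits)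
    (hω : GSet.toOrbit s = ω) : cosets D ⟶ S.orbit ω :=
  haveI := S.finite_orbit ω
  FinGSet.homMk
    (fun x => Quotient.liftOn' x (fun g => (⟨g • s, MulAction.orbitRel.Quotient.mem_orbit.2
      ((GSet.toOrbit_smul g s).trans hω)⟩ : ω.orbit)) fun a b h => Subtype.ext (by
        have h1 := hs _ (QuotientGroup.leftRel_apply.1 h)
        rwa [mul_smul, inv_smul_eq_iff, eq_comm] at h1))
    (by
      rintro g ⟨a⟩
      exact Subtype.ext (mul_smul g a s))

theorem cosetMap_orbitMap {D : Subgroup G} {S T : GSet G} (f : S ⟶ T) (s : S.V)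
    (hs : ∀ k ∈ D, k • s = s) (hs' : ∀ k ∈ D, k • f.hom s = f.hom s) (ω : S.Orbits)
    (hω : GSet.toOrbit s = ω) (hω' : GSet.toOrbit (f.hom s) = GSet.orbitsMap f ω) :
    cosetMap s hs ω hω ≫ GSet.orbitMap f ω = cosetMap (f.hom s) hs' _ hω' := by
  apply Action.hom_ext
  ext x
  induction x using Quotient.inductionOn with
  | h a => exact Subtype.ext (GSet.hom_smul f a s)

theorem cosetMap_smul {D : Subgroup G} {S : GSet G} (n : normalizerIn ⊤ D) (s : S.V)
    (hs : ∀ k ∈ D, k • s = s) (hs' : ∀ k ∈ D, k • (n : G) • s = (n : G) • s) (ω : S.Orbits)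
    (hω : GSet.toOrbit s = ω) (hω' : GSet.toOrbit ((n : G) • s) = ω) :
    cosetMap ((n : G) • s) hs' ω hω' =
      (show cosets D ⟶ cosets D from normalizerAction ⊤ D n⁻¹) ≫ cosetMap s hs ω hω := by
  apply Action.hom_ext
  ext x
  induction x using Quotient.inductionOn with
  | h a =>
    refine Subtype.ext ?_
    change a • (n : G) • s = (a * ((n⁻¹ : normalizerIn ⊤ D) : G)⁻¹) • s
    simp [mul_smul]

theorem isIso_cosetMap {D : Subgroup G} {S : GSet G} (s : S.V) (hs : ∀ k ∈ D, k • s = s)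
    (ω : S.Orbits) (hω : GSet.toOrbit s = ω) (hD : MulAction.stabilizer G s = D) :
    IsIso (cosetMap s hs ω hω) := by
  have : IsIso (cosetMap s hs ω hω).hom := by
    rw [ConcreteCategory.isIso_iff_bijective]
    constructor
    · intro x y
      induction x using Quotient.inductionOn
      induction y using Quotient.inductionOn
      intro h
      refine QuotientGroup.eq.2 ?_
      rw [← hD, MulAction.mem_stabilizer_iff, mul_smul, inv_smul_eq_iff]
      exact (congrArg Subtype.val h).symm
    · rintro ⟨t, ht⟩
      rw [← hω] at ht
      obtain ⟨g, rfl⟩ := ht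
      exact ⟨QuotientGroup.mk g, rfl⟩
  infer_instance

variable (M : (FinGSet G)ᵒᵖ ⥤ AddCommGrpCat.{u})

/-- The component of a Bredon cochain at an orbit. -/
def orbitProj {S : GSet G} (ω : S.Orbits) :
    (extendContravariant M).obj (op S) →+ M.obj (op (S.orbit ω)) :=
  (Pi.π (fun ω : S.Orbits => M.obj (op (S.orbit ω))) ω).hom

theorem orbitProj_map {S T : GSet G} (f : S ⟶ T) (ω : S.Orbits)
    (a : (extendContravariant M).obj (op T)) :
    orbitProj M ω (pullbackHom (extendContravariant M) f a) =
      (M.map (GSet.orbitMap f ω).op).hom (orbitProj M (GSet.orbitsMap f ω) a) :=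
  ConcreteCategory.congr_hom (Pi.lift_π (fun ω : S.Orbits =>
    Pi.π (fun ω' : T.Orbits => M.obj (op (T.orbit ω'))) (GSet.orbitsMap f ω) ≫
      M.map (GSet.orbitMap f ω).op) ω) a

theorem orbitProj_ext {S : GSet G} {a b : (extendContravariant M).obj (op S)}
    (h : ∀ ω, orbitProj M ω a = orbitProj M ω b) : a = b :=
  (Concrete.productEquiv fun ω : S.Orbits => M.obj (op (S.orbit ω))).injective (funext fun ω =>
    (Concrete.productEquiv_apply_apply _ _ _).trans
      ((h ω).trans (Concrete.productEquiv_apply_apply _ _ _).symm))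

theorem exists_orbitProj {S : GSet G} (x : ∀ ω : S.Orbits, M.obj (op (S.orbit ω))) :
    ∃ a, ∀ ω, orbitProj M ω a = x ω :=
  ⟨(Concrete.productEquiv fun ω : S.Orbits => M.obj (op (S.orbit ω))).symm x,
    fun ω => Concrete.productEquiv_symm_apply_π _ x ω⟩

/-- The value of a Bredon cochain at a `D`-fixed point `s`: its restriction along the map
`G/D ⟶ S` given by `s`. -/
def fixedValue {D : Subgroup G} {S : GSet G} (s : S.V) (hs : ∀ k ∈ D, k • s = s) :
    (extendContravariant M).obj (op S) →+ M.obj (op (cosets D)) :=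
  (M.map (cosetMap s hs _ rfl).op).hom.comp (orbitProj M (GSet.toOrbit s))

theorem fixedValue_eq {D : Subgroup G} {S : GSet G} (s : S.V) (hs : ∀ k ∈ D, k • s = s)
    (ω : S.Orbits) (hω : GSet.toOrbit s = ω) (a : (extendContravariant M).obj (op S)) :
    fixedValue M s hs a = (M.map (cosetMap s hs ω hω).op).hom (orbitProj M ω a) := by
  subst hω
  rfl

/-- The restriction of Bredon cochains to the points fixed by `D`. -/
def fixedValues (D : Subgroup G) :
    extendContravariant M ⟶ (weylFixed D).op ⋙ twistedCochains (contraModule M ⊤ D) where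
  app S := AddCommGrpCat.ofHom
    { toFun := fun a => ⟨fun s => fixedValue M s.1 s.2 a, fun w s => by
        induction w using QuotientGroup.induction_on with
        | H n =>
          refine (fixedValue_eq M (D := D) _ _ (GSet.toOrbit (S := S.unop) s.1)
            (GSet.toOrbit_smul (S := S.unop) (n : G) s.1) a).trans ?_
          have h := cosetMap_smul (S := S.unop) n s.1 s.2 (((n : weyl ⊤ D) • s).2) _ rfl
            (GSet.toOrbit_smul (S := S.unop) (n : G) s.1)
          refine (congrArg (fun k => (M.map k.op).hom (orbitProj M _ a)) h).trans ?_
          exact ConcreteCategory.congr_hom (M.map_comp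
            (cosetMap (S := S.unop) s.1 s.2 _ rfl).op
            (Quiver.Hom.op (show cosets D ⟶ cosets D from normalizerAction ⊤ D n⁻¹))) _⟩
      map_zero' := Subtype.ext (funext fun s => map_zero (fixedValue M s.1 s.2))
      map_add' := fun a b => Subtype.ext (funext fun s => map_add (fixedValue M s.1 s.2) a b) }
  naturality T S f := by
    ext a
    refine Subtype.ext (funext fun s => ?_)
    change M.map _ (orbitProj M _ (pullbackHom (extendContravariant M) f.unop a)) =
      M.map _ (orbitProj M _ a)
    rw [orbitProj_map]
    refine (ConcreteCategory.congr_hom (M.map_comp (GSet.orbitMap f.unop _).op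
      (cosetMap (S := S.unop) s.1 s.2 _ rfl).op) _).symm.trans ?_
    exact congrArg (fun k => (M.map (Quiver.Hom.op k)).hom (orbitProj M _ a))
      (cosetMap_orbitMap f.unop s.1 s.2 _ _ rfl rfl)

/-- The Bredon cochains that vanish at all points whose isotropy group has index less than `j`. -/
def indexFiltration (j : ℕ) (S : GSet G) : AddSubgroup ((extendContravariant M).obj (op S)) where
  carrier := {a | ∀ s : S.V, (MulAction.stabilizer G s).index < j →
    orbitProj M (GSet.toOrbit s) a = 0}
  zero_mem' s _ := map_zero _
  add_mem' ha hb s hs := by rw [map_add, ha s hs, hb s hs, add_zero]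
  neg_mem' ha s hs := by rw [map_neg, ha s hs, neg_zero]

theorem index_le_of_le {H K : Subgroup G} (h : H ≤ K) : K.index ≤ H.index :=
  Nat.le_of_dvd (Nat.pos_of_ne_zero H.index_ne_zero_of_finite) (Subgroup.index_dvd_of_le h)

theorem eq_of_le_of_index_le {H K : Subgroup G} (h : H ≤ K) (h' : H.index ≤ K.index) : H = K := by
  refine Subgroup.eq_of_le_of_card_ge h ?_
  have e := (H.index_mul_card).trans (K.index_mul_card).symm
  have hK : 0 < K.index := Nat.pos_of_ne_zero K.index_ne_zero_of_finite
  by_contra! hlt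
  have := Nat.mul_lt_mul_of_le_of_lt h' hlt hK
  omega

theorem pullbackHom_mem_indexFiltration {S T : GSet G} (f : S ⟶ T) {j : ℕ}
    {a : (extendContravariant M).obj (op T)} (ha : a ∈ indexFiltration M j T) :
    pullbackHom (extendContravariant M) f a ∈ indexFiltration M j S := fun s hs => by
  rw [orbitProj_map]
  have h := ha (f.hom s) ((index_le_of_le (GSet.stabilizer_le f s)).trans_lt hs)
  exact (congrArg _ h).trans (map_zero _)

theorem indexFiltration_zero (S : GSet G) : indexFiltration M 0 S = ⊤ :=
  top_le_iff.1 fun _ _ _ h => absurd h (Nat.not_lt_zero _)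

theorem indexFiltration_card (S : GSet G) : indexFiltration M (Nat.card G + 1) S = ⊥ := by
  refine (AddSubgroup.eq_bot_iff_forall _).2 fun a ha => orbitProj_ext M fun ω => ?_
  induction ω using Quotient.inductionOn with
  | h s =>
    refine (ha s ?_).trans (map_zero _).symm
    exact Nat.lt_succ_of_le (Nat.le_of_dvd Nat.card_pos (Subgroup.index_dvd_card _))

theorem fixedValue_eq_zero {D : Subgroup G} {S : GSet G} (s : S.V) (hs : ∀ k ∈ D, k • s = s)
    {j : ℕ} {a : (extendContravariant M).obj (op S)} (ha : a ∈ indexFiltration M j S)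
    (hj : (MulAction.stabilizer G s).index < j) : fixedValue M s hs a = 0 :=
  (congrArg (M.map (cosetMap s hs _ rfl).op).hom (ha s hj)).trans (map_zero _)

theorem fixedValues_eq_zero {D : Subgroup G} {S : GSet G}
    {a : (extendContravariant M).obj (op S)} (ha : a ∈ indexFiltration M (D.index + 1) S) :
    ((fixedValues M D).app (op S)).hom a = 0 :=
  Subtype.ext (funext fun s => fixedValue_eq_zero M s.1 s.2 ha
    (Nat.lt_succ_of_le (index_le_of_le s.2)))

theorem fixedValues_apply_eq_zero {D : Subgroup G} {S : GSet G}
    {a : (extendContravariant M).obj (op S)} (ha : a ∈ indexFiltration M D.index S)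
    (s : ((weylFixed D).obj S).V) (hs : MulAction.stabilizer (weyl ⊤ D) s ≠ ⊥) :
    (((fixedValues M D).app (op S)).hom a : equivariantMaps _ _).1 s = 0 := by
  refine fixedValue_eq_zero M s.1 s.2 ha (lt_of_not_ge fun h => hs ?_)
  exact weyl_eq_bot_of_stabilizer_eq s (eq_of_le_of_index_le (fixed_le_stabilizer s) h).symm

/-- The inclusion of the cochains that vanish at points with nontrivial isotropy. -/
def freeInclusion {W : Type u} [Group W] (V : GModule W) : freeCochains V ⟶ twistedCochains V where
  app S := AddCommGrpCat.ofHom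
    { toFun := fun φ => ⟨φ.1, φ.2.2⟩
      map_zero' := rfl
      map_add' := fun _ _ => rfl }
  naturality _ _ _ := rfl

open Pointwise in
/-- A choice of a subgroup from each conjugacy class. -/
theorem exists_conjugacy_representatives (G : Type u) [Group G] :
    ∃ r : Subgroup G → Subgroup G,
      (∀ K, ∃ g : G, r K = K.map (MulAut.conj g).toMonoidHom) ∧
      ∀ K (g : G), r (K.map (MulAut.conj g).toMonoidHom) = r K := by
  let _ : MulAction G (Subgroup G) := MulAction.compHom (Subgroup G) (MulAut.conj (G := G))
  refine ⟨fun K => Quotient.out (Quotient.mk (MulAction.orbitRel G (Subgroup G)) K), fun K => ?_,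
    fun K g => congrArg Quotient.out (Quotient.sound ⟨g, rfl⟩)⟩
  obtain ⟨g, hg⟩ := @Quotient.mk_out _ (MulAction.orbitRel G (Subgroup G)) K
  exact ⟨g, hg.symm⟩

omit [Finite G] in
theorem index_map_conj (K : Subgroup G) (g : G) :
    (K.map (MulAut.conj g).toMonoidHom).index = K.index :=
  Subgroup.index_map_equiv K (MulAut.conj g)

/-- A cochain in the `j`-th step of the filtration is in the next step if it vanishes at the points
whose isotropy group is a chosen representative of its conjugacy class. -/
theorem mem_indexFiltration_succ {r : Subgroup G → Subgroup G}
    (hr : ∀ K, ∃ g : G, r K = K.map (MulAut.conj g).toMonoidHom)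
    (hr' : ∀ K (g : G), r (K.map (MulAut.conj g).toMonoidHom) = r K) {S : GSet G} {j : ℕ}
    {a : (extendContravariant M).obj (op S)} (ha : a ∈ indexFiltration M j S)
    (h : ∀ D, r D = D → D.index = j → ((fixedValues M D).app (op S)).hom a = 0) :
    a ∈ indexFiltration M (j + 1) S := by
  intro s hs
  rcases Nat.lt_succ_iff_lt_or_eq.1 hs with hs | hs
  · exact ha s hs
  obtain ⟨g, hg⟩ := hr (MulAction.stabilizer G s)
  have hst : MulAction.stabilizer G (g • s) = r (MulAction.stabilizer G s) :=
    (MulAction.stabilizer_smul_eq_stabilizer_map_conj g s).trans hg.symm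
  have hfix : ∀ k ∈ r (MulAction.stabilizer G s), k • g • s = g • s := fun k hk => by
    rw [← hst] at hk
    exact hk
  have h1 := h (r (MulAction.stabilizer G s)) (by
    conv_lhs => rw [hg]
    exact hr' _ g) (by rw [hg, index_map_conj, hs])
  have h2 : fixedValue M (g • s) hfix a = 0 :=
    congrFun (congrArg Subtype.val h1) ⟨g • s, hfix⟩
  rw [fixedValue_eq M _ _ (GSet.toOrbit s) (GSet.toOrbit_smul g s)] at h2
  have := isIso_cosetMap (g • s) hfix (GSet.toOrbit s) (GSet.toOrbit_smul g s) hst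
  have hb := (ConcreteCategory.isIso_iff_bijective
    (M.map (cosetMap (g • s) hfix (GSet.toOrbit s) (GSet.toOrbit_smul g s)).op)).1 inferInstance
  exact hb.1 (h2.trans (map_zero _).symm)

/-- Cochains on the points with isotropy group `D`, given for representatives `D` of the conjugacy
classes of subgroups of index `j`, come from a Bredon cochain in the `j`-th step of the filtration. -/
theorem exists_mem_indexFiltration {p : ℕ} [Fact p.Prime] {r : Subgroup G → Subgroup G}
    (hr : ∀ K, ∃ g : G, r K = K.map (MulAut.conj g).toMonoidHom)
    (hr' : ∀ K (g : G), r (K.map (MulAut.conj g).toMonoidHom) = r K) {S : GSet G}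
    (hS : ∀ s : S.V, IsPGroup p (MulAction.stabilizer G s)) (j : ℕ)
    (ψ : ∀ D, (freeCochains (contraModule M ⊤ D)).obj (op ((weylFixed D).obj S))) :
    ∃ a ∈ indexFiltration M j S, ∀ D, r D = D → D.index = j →
      ((fixedValues M D).app (op S)).hom a = ((freeInclusion _).app (op _)).hom (ψ D) := by
  classical
  have ht : ∀ ω : S.Orbits, ∃ t : S.V, GSet.toOrbit t = ω ∧
      r (MulAction.stabilizer G t) = MulAction.stabilizer G t := fun ω => by
    induction ω using Quotient.inductionOn with
    | h s =>
      obtain ⟨g, hg⟩ := hr (MulAction.stabilizer G s)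
      refine ⟨g • s, GSet.toOrbit_smul g s, ?_⟩
      rw [MulAction.stabilizer_smul_eq_stabilizer_map_conj, hr', hg]
  choose t htω htr using ht
  have hx : ∀ ω : S.Orbits, ∃ x : M.obj (op (S.orbit ω)),
      ((MulAction.stabilizer G (t ω)).index ≠ j → x = 0) ∧
      ∀ D, MulAction.stabilizer G (t ω) = D → D.index = j → ∀ hD : ∀ k ∈ D, k • t ω = t ω,
        (M.map (cosetMap (t ω) hD ω (htω ω)).op).hom x = (ψ D).1 ⟨t ω, hD⟩ := by
    intro ω
    by_cases hω : (MulAction.stabilizer G (t ω)).index = j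
    · have := isIso_cosetMap (D := MulAction.stabilizer G (t ω)) (t ω) (fun _ h => h) ω (htω ω) rfl
      have hb := (ConcreteCategory.isIso_iff_bijective (M.map (cosetMap
        (D := MulAction.stabilizer G (t ω)) (t ω) (fun _ h => h) ω (htω ω)).op)).1 inferInstance
      obtain ⟨x, hx⟩ := hb.2 ((ψ (MulAction.stabilizer G (t ω))).1 ⟨t ω, fun _ h => h⟩)
      refine ⟨x, fun h => absurd hω h, ?_⟩
      rintro _ rfl _ _
      exact hx
    · refine ⟨0, fun _ => rfl, ?_⟩
      rintro _ rfl h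
      exact absurd h hω
  choose x hx0 hx using hx
  obtain ⟨a, ha⟩ := exists_orbitProj M x
  have hconj : ∀ s : S.V, ∃ g : G, g • t (GSet.toOrbit s) = s := fun s =>
    (MulAction.orbitRel G S.V).symm' (Quotient.exact (htω (GSet.toOrbit s)))
  have haj : a ∈ indexFiltration M j S := fun s hs => by
    rw [ha]
    refine hx0 _ fun h => hs.ne ?_
    obtain ⟨g, hg⟩ := hconj s
    rw [← hg, MulAction.stabilizer_smul_eq_stabilizer_map_conj, index_map_conj, h]
  refine ⟨a, haj, fun D hD hDj => Subtype.ext (funext fun s => ?_)⟩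
  by_cases hs : MulAction.stabilizer (weyl ⊤ D) s = ⊥
  · have hsD := stabilizer_eq_of_weyl_eq_bot s (hS s.1) hs
    obtain ⟨g, hg⟩ := hconj s.1
    -- the chosen point of the orbit has the same isotropy group as `s`, since both of these groups
    -- are the representative of the same conjugacy class
    have htD : MulAction.stabilizer G (t (GSet.toOrbit (S := S) s.1)) = D := by
      rw [← htr, ← hr' _ g, ← MulAction.stabilizer_smul_eq_stabilizer_map_conj, hg]
      exact (congrArg r hsD).trans hD
    have hgD : g ∈ normalizerIn ⊤ D := by
      refine ⟨Subgroup.mem_top g, Subgroup.mem_normalizer_iff_map_conj_eq.2 ?_⟩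
      have h := MulAction.stabilizer_smul_eq_stabilizer_map_conj g
        (t (GSet.toOrbit (S := S) s.1))
      rw [hg, htD] at h
      exact h.symm.trans hsD
    have hfix : ∀ k ∈ D, k • t (GSet.toOrbit (S := S) s.1) = t (GSet.toOrbit (S := S) s.1) :=
      fun k hk => by
        rw [← htD] at hk
        exact hk
    let t' : ((weylFixed D).obj S).V := ⟨t (GSet.toOrbit (S := S) s.1), hfix⟩
    have hst : ((⟨g, hgD⟩ : normalizerIn ⊤ D) : weyl ⊤ D) • t' = s := Subtype.ext hg
    rw [← hst]
    refine ((((fixedValues M D).app (op S)).hom a : equivariantMaps _ _).2 _ t').trans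
      (Eq.trans (congrArg (GModule.act _ _) ?_) ((ψ D).2.2 _ t').symm)
    refine (fixedValue_eq M _ hfix _ (htω _) a).trans ?_
    rw [ha]
    exact hx _ D htD hDj hfix
  · exact (fixedValues_apply_eq_zero M (hDj ▸ haj) s hs).trans ((ψ D).2.1 s hs).symm

/-- The Bredon cochains of a `G`-space that vanish at all simplices whose isotropy group has index
less than `j`. -/
def cochainFiltration (j : ℕ) (Y : GSpace G) :
    AddSubgroup (∀ n : ℕ, (extendContravariant M).obj (op (Y _⦋n⦌))) :=
  AddSubgroup.pi Set.univ fun n => indexFiltration M j (Y _⦋n⦌)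

theorem cochainD_mem_cochainFiltration {j : ℕ} {Y : GSpace G}
    {a : ∀ n : ℕ, (extendContravariant M).obj (op (Y _⦋n⦌))} (ha : a ∈ cochainFiltration M j Y) :
    cochainD (extendContravariant M) Y a ∈ cochainFiltration M j Y := fun n _ => by
  cases n with
  | zero => exact zero_mem (indexFiltration M j (Y _⦋0⦌))
  | succ n =>
    change coface (extendContravariant M) Y n (a n) ∈ indexFiltration M j (Y _⦋n + 1⦌)
    rw [coface_apply]
    exact sum_mem fun i _ => zsmul_mem (pullbackHom_mem_indexFiltration M _ (ha n trivial)) _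

theorem cochainMap_mem_cochainFiltration {j : ℕ} {Y Z : GSpace G} (f : Y ⟶ Z)
    {a : ∀ n : ℕ, (extendContravariant M).obj (op (Z _⦋n⦌))} (ha : a ∈ cochainFiltration M j Z) :
    cochainMap (extendContravariant M) f a ∈ cochainFiltration M j Y := fun n _ =>
  pullbackHom_mem_indexFiltration M (f.app (op ⦋n⦌)) (ha n trivial)

/-- The restriction of Bredon cochains of a `G`-space to the simplices fixed by `D`. -/
def spaceValues (D : Subgroup G) (Y : GSpace G) :
    (∀ n : ℕ, (extendContravariant M).obj (op (Y _⦋n⦌))) →+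
      (∀ n : ℕ, (twistedCochains (contraModule M ⊤ D)).obj (op (((weylSpace D).obj Y) _⦋n⦌))) :=
  piMap fun n => ((fixedValues M D).app (op (Y _⦋n⦌))).hom

theorem spaceValues_cochainD (D : Subgroup G) (Y : GSpace G)
    (a : ∀ n : ℕ, (extendContravariant M).obj (op (Y _⦋n⦌))) :
    spaceValues M D Y (cochainD (extendContravariant M) Y a) =
      cochainD (twistedCochains (contraModule M ⊤ D)) ((weylSpace D).obj Y)
        (spaceValues M D Y a) :=
  piMap_seqD (fun n a => coface_app (fixedValues M D) Y n a) a

theorem spaceValues_cochainMap (D : Subgroup G) {Y Z : GSpace G} (f : Y ⟶ Z)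
    (a : ∀ n : ℕ, (extendContravariant M).obj (op (Z _⦋n⦌))) :
    spaceValues M D Y (cochainMap (extendContravariant M) f a) =
      cochainMap (twistedCochains (contraModule M ⊤ D)) ((weylSpace D).map f)
        (spaceValues M D Z a) :=
  funext fun n => pullbackHom_app (fixedValues M D) (f.app (op ⦋n⦌)) (a n)

/-- The inclusion of the cochains that vanish at simplices with nontrivial isotropy. -/
def spaceFreeInclusion {W : Type u} [Group W] (V : GModule W) (Y : GSpace W) :
    (∀ n : ℕ, (freeCochains V).obj (op (Y _⦋n⦌))) →+
      (∀ n : ℕ, (twistedCochains V).obj (op (Y _⦋n⦌))) :=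
  piMap fun n => ((freeInclusion V).app (op (Y _⦋n⦌))).hom

theorem spaceFreeInclusion_cochainD {W : Type u} [Group W] (V : GModule W) (Y : GSpace W)
    (a : ∀ n : ℕ, (freeCochains V).obj (op (Y _⦋n⦌))) :
    spaceFreeInclusion V Y (cochainD (freeCochains V) Y a) =
      cochainD (twistedCochains V) Y (spaceFreeInclusion V Y a) :=
  piMap_seqD (fun n a => coface_app (freeInclusion V) Y n a) a

theorem spaceFreeInclusion_injective {W : Type u} [Group W] (V : GModule W) (Y : GSpace W) :
    Function.Injective (spaceFreeInclusion V Y) := fun _ _ h =>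
  funext fun n => Subtype.ext
    (congrArg (fun φ : equivariantMaps V (Y _⦋n⦌) => φ.1) (congrFun h n))

theorem spaceFreeInclusion_cochainMap {W : Type u} [Group W] (V : GModule W) {Y Z : GSpace W}
    (f : Y ⟶ Z) (a : ∀ n : ℕ, (freeCochains V).obj (op (Z _⦋n⦌))) :
    spaceFreeInclusion V Y (cochainMap (freeCochains V) f a) =
      cochainMap (twistedCochains V) f (spaceFreeInclusion V Z a) := rfl

theorem spaceValues_eq_zero {D : Subgroup G} {Y : GSpace G}
    {a : ∀ n : ℕ, (extendContravariant M).obj (op (Y _⦋n⦌))}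
    (ha : a ∈ cochainFiltration M (D.index + 1) Y) : spaceValues M D Y a = 0 :=
  funext fun n => fixedValues_eq_zero M (ha n trivial)

theorem exists_spaceFreeInclusion {D : Subgroup G} {Y : GSpace G}
    {a : ∀ n : ℕ, (extendContravariant M).obj (op (Y _⦋n⦌))}
    (ha : a ∈ cochainFiltration M D.index Y) :
    ∃ b, spaceFreeInclusion _ ((weylSpace D).obj Y) b = spaceValues M D Y a :=
  ⟨fun n => ⟨(spaceValues M D Y a n).1, fun s hs =>
    fixedValues_apply_eq_zero M (ha n trivial) s hs, (spaceValues M D Y a n).2⟩, rfl⟩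

theorem exists_spaceValues {p : ℕ} [Fact p.Prime] {r : Subgroup G → Subgroup G}
    (hr : ∀ K, ∃ g : G, r K = K.map (MulAut.conj g).toMonoidHom)
    (hr' : ∀ K (g : G), r (K.map (MulAut.conj g).toMonoidHom) = r K) {Y : GSpace G}
    (hY : isotropy Y ⊆ pSubgroups p G) (j : ℕ)
    (ψ : ∀ D, ∀ n : ℕ, (freeCochains (contraModule M ⊤ D)).obj
      (op (((weylSpace D).obj Y) _⦋n⦌))) :
    ∃ a ∈ cochainFiltration M j Y, ∀ D, r D = D → D.index = j →
      spaceValues M D Y a = spaceFreeInclusion _ _ (ψ D) := by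
  choose a ha h using fun n => exists_mem_indexFiltration M hr hr' (S := Y _⦋n⦌)
    (fun s => hY ⟨_, s, rfl⟩) j fun D => ψ D n
  exact ⟨a, fun n _ => ha n, fun D hD hj => funext fun n => h n D hD hj⟩

theorem mem_cochainFiltration_succ {r : Subgroup G → Subgroup G}
    (hr : ∀ K, ∃ g : G, r K = K.map (MulAut.conj g).toMonoidHom)
    (hr' : ∀ K (g : G), r (K.map (MulAut.conj g).toMonoidHom) = r K) {Y : GSpace G} {j : ℕ}
    {a : ∀ n : ℕ, (extendContravariant M).obj (op (Y _⦋n⦌))} (ha : a ∈ cochainFiltration M j Y)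
    (h : ∀ D, r D = D → D.index = j → spaceValues M D Y a = 0) :
    a ∈ cochainFiltration M (j + 1) Y := fun n _ =>
  mem_indexFiltration_succ M hr hr' (ha n trivial) fun D hD hj => congrFun (h D hD hj) n

/-- A map of spaces whose isotropy groups are `p`-groups gives an isomorphism of Bredon cohomology
if, for each `D`, it is an equivalence on the parts with isotropy group `D`. -/
theorem quasiIsoDG_extendContravariant {p : ℕ} [Fact p.Prime] {Y Z : GSpace G} (f : Y ⟶ Z)
    (hY : isotropy Y ⊆ pSubgroups p G) (hZ : isotropy Z ⊆ pSubgroups p G)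
    (h : ∀ D, QuasiIsoDG (cochainD (freeCochains (contraModule M ⊤ D)) ((weylSpace D).obj Z))
      (cochainD (freeCochains (contraModule M ⊤ D)) ((weylSpace D).obj Y))
      (cochainMap (freeCochains (contraModule M ⊤ D)) ((weylSpace D).map f))) :
    QuasiIsoDG (cochainD (extendContravariant M) Z) (cochainD (extendContravariant M) Y)
      (cochainMap (extendContravariant M) f) := by
  obtain ⟨r, hr, hr'⟩ := exists_conjugacy_representatives G
  refine QuasiIsoDG.of_filtration (fun j => cochainFiltration M j Z)
    (fun j => cochainFiltration M j Y) (Nat.card G + 1) ?_ ?_ ?_ ?_ (cochainD_cochainD _ Z)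
    (cochainD_cochainD _ Y) (fun a => cochainMap_cochainD _ f a) ?_
  · exact top_le_iff.1 fun a _ n _ =>
      (indexFiltration_zero M (Z _⦋n⦌)).ge (AddSubgroup.mem_top (a n))
  · exact top_le_iff.1 fun a _ n _ =>
      (indexFiltration_zero M (Y _⦋n⦌)).ge (AddSubgroup.mem_top (a n))
  · exact (AddSubgroup.eq_bot_iff_forall _).2 fun a ha => funext fun n =>
      (AddSubgroup.eq_bot_iff_forall _).1 (indexFiltration_card M (Z _⦋n⦌)) _ (ha n trivial)
  · exact (AddSubgroup.eq_bot_iff_forall _).2 fun a ha => funext fun n =>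
      (AddSubgroup.eq_bot_iff_forall _).1 (indexFiltration_card M (Y _⦋n⦌)) _ (ha n trivial)
  intro j a a' ha ha' hda hfa
  have key : ∀ D, ∃ b b', D.index = j →
      spaceFreeInclusion _ _ (cochainD (freeCochains (contraModule M ⊤ D)) ((weylSpace D).obj Z) b)
        = spaceValues M D Z a ∧
      spaceFreeInclusion _ _ (cochainMap (freeCochains _) ((weylSpace D).map f) b -
        cochainD (freeCochains (contraModule M ⊤ D)) ((weylSpace D).obj Y) b') =
          spaceValues M D Y a' := by
    intro D
    by_cases hD : D.index = j
    · subst hD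
      obtain ⟨α, hα⟩ := exists_spaceFreeInclusion M ha
      obtain ⟨α', hα'⟩ := exists_spaceFreeInclusion M ha'
      obtain ⟨b, b', hb, hb'⟩ := h D α α'
        (spaceFreeInclusion_injective _ _ (by
          rw [spaceFreeInclusion_cochainD, hα, ← spaceValues_cochainD, map_zero]
          exact spaceValues_eq_zero M hda))
        (spaceFreeInclusion_injective _ _ (by
          rw [spaceFreeInclusion_cochainD, spaceFreeInclusion_cochainMap, hα, hα',
            ← spaceValues_cochainD, ← spaceValues_cochainMap, ← sub_eq_zero, ← map_sub]
          exact spaceValues_eq_zero M hfa))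
      refine ⟨b, b', fun _ => ⟨by rw [hb, hα], ?_⟩⟩
      rw [← hb', sub_sub_cancel, hα']
    · exact ⟨0, 0, fun h => absurd h hD⟩
  choose b b' hb using key
  obtain ⟨c, hc, hcb⟩ := exists_spaceValues M hr hr' hZ j b
  obtain ⟨c', hc', hcb'⟩ := exists_spaceValues M hr hr' hY j b'
  refine ⟨c, c', hc, hc', mem_cochainFiltration_succ M hr hr'
    (sub_mem ha (cochainD_mem_cochainFiltration M hc)) fun D hD hj => ?_,
    mem_cochainFiltration_succ M hr hr' (add_mem
      (sub_mem ha' (cochainMap_mem_cochainFiltration M f hc))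
      (cochainD_mem_cochainFiltration M hc')) fun D hD hj => ?_⟩
  · rw [map_sub, spaceValues_cochainD, hcb D hD hj, ← spaceFreeInclusion_cochainD, (hb D hj).1,
      sub_self]
  · rw [map_add, map_sub, spaceValues_cochainD, spaceValues_cochainMap, hcb D hD hj, hcb' D hD hj,
      ← spaceFreeInclusion_cochainD, ← spaceFreeInclusion_cochainMap, ← (hb D hj).2, map_sub]
    abel

end Filtration

/-! ### Mackey functors and duality -/

section MackeyDuality

open Simplicial

theorem SpanCat.contravariant_map_eq {C : Type u} [Category.{v} C] [HasPullbacks C] {X Y : C}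
    (e : X ≅ Y) :
    (SpanCat.contravariant C).map e.hom.op = (SpanCat.covariant C).map e.inv :=
  Quotient.sound ⟨e, Category.comp_id _, e.hom_inv_id⟩

variable {G : Type u} [Group G] [Finite G]

/-- An element `w` of `N_K(D) / D` acts on `Γ(G/D)` through the covariant functor; the
contravariant functor takes the inverse endomorphism of `G/D` to the same map. -/
theorem contraModule_upper (Γ : MackeyFunctor G) (K D : Subgroup G) :
    contraModule Γ.upper K D = coefficientModule Γ K D := by
  refine congrArg (Action.mk (Γ.lower.obj (cosets D))) (MonoidHom.ext fun w => ?_)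
  let e : cosets D ≅ cosets D :=
    { hom := (show cosets D ⟶ cosets D from weylAction K D w⁻¹)
      inv := (show cosets D ⟶ cosets D from weylAction K D w)
      hom_inv_id := by
        refine ((weylAction K D).map_mul w w⁻¹).symm.trans ?_
        rw [mul_inv_cancel, map_one]
        rfl
      inv_hom_id := by
        refine ((weylAction K D).map_mul w⁻¹ w).symm.trans ?_
        rw [inv_mul_cancel, map_one]
        rfl }
  exact congrArg Γ.functor.map (SpanCat.contravariant_map_eq e)

/-- Restriction of a character of `⨁ γ(ω)` to the summands. -/
def dualExtension (γ : FinGSet G ⥤ AddCommGrpCat.{u}) :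
    dualFunctor (extendCovariant γ) ⟶ extendContravariant (dualFunctor γ) where
  app S := Pi.lift fun ω : S.unop.Orbits => (preadditiveYoneda.obj ratCircle).map
    (Sigma.ι (fun ω : S.unop.Orbits => γ.obj (S.unop.orbit ω)) ω).op
  naturality T S f := by
    apply Pi.hom_ext
    intro ω
    refine (Category.assoc _ _ _).trans ((congrArg (_ ≫ ·) (Pi.lift_π _ ω)).trans ?_)
    refine Eq.trans ?_ (Category.assoc _ _ _).symm
    refine Eq.trans ?_ (congrArg (_ ≫ ·) (Pi.lift_π (fun ω : S.unop.Orbits =>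
      Pi.π (fun ω' : T.unop.Orbits => (dualFunctor γ).obj (op (T.unop.orbit ω')))
        (GSet.orbitsMap f.unop ω) ≫ (dualFunctor γ).map (GSet.orbitMap f.unop ω).op) ω).symm)
    refine Eq.trans ?_ (Category.assoc _ _ _)
    refine Eq.trans ?_ (congrArg (· ≫ _) (Pi.lift_π (fun ω : T.unop.Orbits =>
      (preadditiveYoneda.obj ratCircle).map
        (Sigma.ι (fun ω : T.unop.Orbits => γ.obj (T.unop.orbit ω)) ω).op)
      (GSet.orbitsMap f.unop ω)).symm)
    refine ((preadditiveYoneda.obj ratCircle).map_comp _ _).symm.trans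
      (Eq.trans ?_ ((preadditiveYoneda.obj ratCircle).map_comp _ _))
    refine congrArg (fun k => (preadditiveYoneda.obj ratCircle).map (Quiver.Hom.op k)) ?_
    exact Sigma.ι_desc _ ω

theorem orbitProj_dualExtension (γ : FinGSet G ⥤ AddCommGrpCat.{u}) (S : GSet G) (ω : S.Orbits)
    (x : (extendCovariant γ).obj S ⟶ ratCircle) :
    orbitProj (dualFunctor γ) ω (((dualExtension γ).app (op S)).hom x) =
      Sigma.ι (fun ω : S.Orbits => γ.obj (S.orbit ω)) ω ≫ x :=
  ConcreteCategory.congr_hom (Pi.lift_π (fun ω : S.Orbits => (preadditiveYoneda.obj ratCircle).map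
    (Sigma.ι (fun ω : S.Orbits => γ.obj (S.orbit ω)) ω).op) ω) x

theorem isIso_of_bijective {C : Type*} [Category* C] {F F' : Cᵒᵖ ⥤ AddCommGrpCat.{u}} (α : F ⟶ F')
    (h : ∀ S, Function.Bijective (α.app (op S)).hom) : IsIso α := by
  have : ∀ S, IsIso (α.app S) := fun S => (ConcreteCategory.isIso_iff_bijective _).2 (h S.unop)
  exact NatIso.isIso_of_isIso_app α

theorem dualExtension_bijective (γ : FinGSet G ⥤ AddCommGrpCat.{u}) (S : GSet G) :
    Function.Bijective ((dualExtension γ).app (op S)).hom := by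
  constructor
  · intro x y h
    refine Sigma.hom_ext (f := fun ω : S.Orbits => γ.obj (S.orbit ω)) x y fun ω => ?_
    refine (orbitProj_dualExtension γ S ω x).symm.trans
      (Eq.trans ?_ (orbitProj_dualExtension γ S ω y))
    exact congrArg (orbitProj (dualFunctor γ) ω) h
  · intro a
    refine ⟨Sigma.desc (f := fun ω : S.Orbits => γ.obj (S.orbit ω)) fun ω =>
      orbitProj (dualFunctor γ) ω a, orbitProj_ext _ fun ω => ?_⟩
    exact (orbitProj_dualExtension γ S ω _).trans (Sigma.ι_desc _ ω)

/-- The characters of a `W`-module. -/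
def dualModule {W : Type u} [Group W] (M : GModule W) : GModule W where
  V := (preadditiveYoneda.obj ratCircle).obj (op M.V)
  ρ :=
    { toFun := fun w => (preadditiveYoneda.obj ratCircle).map
        (Quiver.Hom.op (show M.V ⟶ M.V from M.ρ w⁻¹))
      map_one' := by
        rw [inv_one, map_one]
        exact (preadditiveYoneda.obj ratCircle).map_id _
      map_mul' := fun w w' => by
        rw [mul_inv_rev, map_mul]
        exact (preadditiveYoneda.obj ratCircle).map_comp
          (Quiver.Hom.op (show M.V ⟶ M.V from M.ρ w'⁻¹))
          (Quiver.Hom.op (show M.V ⟶ M.V from M.ρ w⁻¹)) }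

theorem contraModule_dualFunctor (Γ : MackeyFunctor G) (K D : Subgroup G) :
    contraModule (dualFunctor Γ.lower) K D = dualModule (coefficientModule Γ K D) := rfl

/-- The class of `s ⊗ m`. -/
def twistedChain {W : Type u} [Group W] (M : GModule W) {S : GSet W} (s : S.V) :
    M.V →+ (S.V →₀ M.V) ⧸ twistedRelations M S :=
  (QuotientAddGroup.mk' _).comp (Finsupp.singleAddHom s)

theorem twistedChain_smul {W : Type u} [Group W] (M : GModule W) {S : GSet W} (w : W) (s : S.V)
    (m : M.V) : twistedChain M (w • s) m = twistedChain M s (M.act w⁻¹ m) := by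
  refine QuotientAddGroup.eq_iff_sub_mem.2 (AddSubgroup.subset_closure
    ⟨w, s, M.act w⁻¹ m, ?_⟩)
  rw [← GModule.act_mul, mul_inv_cancel, GModule.act_one]
  rfl

/-- A character of `ℤ[S] ⊗_{ℤ[W]} M` as an equivariant map from `S` to the characters of `M`. -/
def dualTwisted {W : Type u} [Group W] (M : GModule W) :
    dualFunctor (twistedChains M) ⟶ twistedCochains (dualModule M) where
  app S := AddCommGrpCat.ofHom
    { toFun := fun x => ⟨fun s => AddCommGrpCat.ofHom
          ((show (twistedChains M).obj S.unop ⟶ ratCircle from x).hom.comp (twistedChain M s)),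
        fun w s => AddCommGrpCat.hom_ext (AddMonoidHom.ext fun m =>
          congrArg (show (twistedChains M).obj S.unop ⟶ ratCircle from x).hom
            (twistedChain_smul M w s m))⟩
      map_zero' := rfl
      map_add' := fun _ _ => rfl }
  naturality S T f := by
    ext x
    refine Subtype.ext (funext fun s => AddCommGrpCat.hom_ext (AddMonoidHom.ext fun m => ?_))
    refine congrArg (show (twistedChains M).obj S.unop ⟶ ratCircle from x).hom ?_
    exact congrArg (QuotientAddGroup.mk (s := twistedRelations M S.unop)) Finsupp.mapDomain_single

theorem dualTwisted_bijective {W : Type u} [Group W] (M : GModule W) (S : GSet W) :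
    Function.Bijective ((dualTwisted M).app (op S)).hom := by
  constructor
  · intro (x : (twistedChains M).obj S ⟶ ratCircle) (y : (twistedChains M).obj S ⟶ ratCircle) h
    refine AddCommGrpCat.hom_ext (QuotientAddGroup.addMonoidHom_ext _ ?_)
    refine Finsupp.addHom_ext fun s m => ?_
    have h1 := congrFun (congrArg Subtype.val h) s
    exact ConcreteCategory.congr_hom (show (_ : M.V ⟶ ratCircle) = _ from h1) m
  · intro φ
    let φ' : S.V → (M.V →+ ratCircle.{u}) := fun s => (show M.V ⟶ ratCircle from φ.1 s).hom
    have hφ : ∀ (w : W) (s : S.V) (m : M.V), φ' (w • s) (M.act w m) = φ' s m := fun w s m => by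
      have h := ConcreteCategory.congr_hom (show (φ.1 (w • s) : M.V ⟶ ratCircle) = _ from φ.2 w s)
        (M.act w m)
      refine h.trans ?_
      refine congrArg (φ' s) ((GModule.act_mul M w⁻¹ w m).symm.trans ?_)
      rw [inv_mul_cancel, GModule.act_one]
    refine ⟨AddCommGrpCat.ofHom (QuotientAddGroup.lift (twistedRelations M S)
      (Finsupp.liftAddHom φ') ?_), ?_⟩
    · rw [twistedRelations, AddSubgroup.closure_le]
      rintro _ ⟨w, s, m, rfl⟩
      change Finsupp.liftAddHom φ' _ = 0
      rw [map_sub, Finsupp.liftAddHom_apply_single, Finsupp.liftAddHom_apply_single, hφ, sub_self]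
    · refine Subtype.ext (funext fun s => AddCommGrpCat.hom_ext (AddMonoidHom.ext fun m => ?_))
      exact Finsupp.liftAddHom_apply_single φ' s m

theorem quasiIsoDG_twistedCochains_dualModule {W : Type u} [Group W] (M : GModule W) {X Y : GSpace W}
    (f : X ⟶ Y) : QuasiIsoDG (cochainD (dualFunctor (twistedChains M)) Y)
        (cochainD (dualFunctor (twistedChains M)) X)
        (cochainMap (dualFunctor (twistedChains M)) f) →
      QuasiIsoDG (cochainD (twistedCochains (dualModule M)) Y)
        (cochainD (twistedCochains (dualModule M)) X)
        (cochainMap (twistedCochains (dualModule M)) f) :=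
  have := isIso_of_bijective _ (dualTwisted_bijective M)
  quasiIsoDG_cochainMap_of_iso (asIso (dualTwisted M)) f

theorem quasiIsoDG_dual_extendCovariant (γ : FinGSet G ⥤ AddCommGrpCat.{u}) {X Y : GSpace G}
    (f : X ⟶ Y) (h : QuasiIsoDG (cochainD (extendContravariant (dualFunctor γ)) Y)
      (cochainD (extendContravariant (dualFunctor γ)) X)
      (cochainMap (extendContravariant (dualFunctor γ)) f)) :
    QuasiIsoDG (cochainD (dualFunctor (extendCovariant γ)) Y)
      (cochainD (dualFunctor (extendCovariant γ)) X)
      (cochainMap (dualFunctor (extendCovariant γ)) f) :=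
  have := isIso_of_bijective _ (dualExtension_bijective γ)
  quasiIsoDG_cochainMap_of_iso (asIso (dualExtension γ)).symm f h

/-- The comparison of approximations, on Bredon cochains with coefficients in any contravariant
functor. -/
theorem quasiIsoDG_approximation (M : (FinGSet G)ᵒᵖ ⥤ AddCommGrpCat.{u}) (p : ℕ) [Fact p.Prime]
    (𝒞 : Set (Subgroup G)) (h𝒞 : 𝒞 ⊆ pSubgroups p G) (hclosed : ClosedUnderPSupergroups p 𝒞)
    (X : GSpace G)
    (hX : ∀ K ∈ isotropy X, ∀ D ∈ restrictTo (pSubgroups p G \ 𝒞) K,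
      QuasiIsoDG (cochainD (twistedCochains (contraModule M K D)) (universalSpace (weyl K D)))
        (cochainD (twistedCochains (contraModule M K D))
          ((universalSpace (weyl K D)).prod (pSubgroupSpace p (weyl K D))))
        (cochainMap (twistedCochains (contraModule M K D))
          (GSpace.fst (universalSpace (weyl K D)) (pSubgroupSpace p (weyl K D)))))
    {X𝒜 X𝒞 : GSpace G} (a : X𝒜 ⟶ X) (ha : IsApproximation (pSubgroups p G) a)
    (f : X𝒞 ⟶ X𝒜) (hf : IsApproximation 𝒞 (f ≫ a)) :
    QuasiIsoDG (cochainD (extendContravariant M) X𝒜) (cochainD (extendContravariant M) X𝒞)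
      (cochainMap (extendContravariant M) f) :=
  quasiIsoDG_extendContravariant M f (hf.isotropy_subset.trans h𝒞) ha.isotropy_subset fun D =>
    quasiIsoDG_freeCochains_weylSpace M p 𝒞 h𝒞 hclosed X hX a ha f hf D

end MackeyDuality

end

end Bredon

theorem proposition5p2 {G : Type u} [Group G] [Finite G] (p : ℕ) [Fact p.Prime]
    (Γ : Bredon.MackeyFunctor G)
    (𝒞 : Set (Subgroup G)) (h𝒞 : Bredon.IsCollection 𝒞) (h𝒞𝒜 : 𝒞 ⊆ Bredon.pSubgroups p G)
    (hclosed : Bredon.ClosedUnderPSupergroups p 𝒞)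
    (X : Bredon.GSpace G)
    (hsuperfluous : ∀ K ∈ Bredon.isotropy X,
      ∀ D ∈ Bredon.restrictTo (Bredon.pSubgroups p G \ 𝒞) K,
        Bredon.IsSuperfluous p (Bredon.coefficientModule Γ K D))
    {X𝒜 X𝒞 : Bredon.GSpace G}
    (a : X𝒜 ⟶ X) (ha : Bredon.IsApproximation (Bredon.pSubgroups p G) a)
    (f : X𝒞 ⟶ X𝒜) (hf : Bredon.IsApproximation 𝒞 (f ≫ a)) :
    Bredon.IsMackeyIso Γ f := by
  constructor
  · refine (Bredon.isIso_homologyWith_iff _ f).2 (Bredon.quasiIsoDG_dual_extendCovariant _ f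
      (Bredon.quasiIsoDG_approximation _ p 𝒞 h𝒞𝒜 hclosed X (fun K hK D hD => ?_) a ha f hf))
    rw [Bredon.contraModule_dualFunctor]
    exact Bredon.quasiIsoDG_twistedCochains_dualModule _ _
      ((Bredon.isIso_homologyWith_iff _ _).1 (hsuperfluous K hK D hD).1)
  · refine (Bredon.isIso_cohomologyWith_iff _ f).2
      (Bredon.quasiIsoDG_approximation _ p 𝒞 h𝒞𝒜 hclosed X (fun K hK D hD => ?_) a ha f hf)
    rw [Bredon.contraModule_upper]
    exact (Bredon.isIso_cohomologyWith_iff _ _).1 (hsuperfluous K hK D hD).2
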